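/- **Proposition 3.1.** Let $R>0$ and use coordinates $(r,\theta,\phi)$, $y=r-R$, $0<\theta<\pi$, $\phi$ being $2\pi$-periodic. Consider a 3-metric $$h=s_{\alpha\beta}(dx^\alpha+\mathcal B^\alpha dr)(dx^\beta+\mathcal B^\beta dr)+\mathcal A^2dr^2,\qquad x^2=\theta,\ x^3=\phi,\quad \mathcal B_\alpha=s_{\alpha\beta}\mathcal B^\beta,$$ in the quasi-isotropic gauge $s=\mathrm{diag}\bigl(r^2\mathcal A^2,\ r^2\sin^2\theta\,(1-R^2/r^2)^2\bigr)$, and an Ernst potential $\mathcal E=f+ib$, subject to the projected vacuum equations $$f\,D_aD^a\mathcal E=D_a\mathcal E\,D^a\mathcal E,\qquad R_{ab}=\frac1{2f^2}\,\Re(\mathcal E_{,a}\bar{\mathcal E}_{,b}),$$ where $D$ and $R_{ab}$ are the covariant derivative and the Ricci tensor of $h$. A *formal horizon solution* is a family of formal series $$f=y^2\sum_{j\ge0}f_jy^j,\quad b=y^4\sum_{j\ge0}b_jy^j,\quad \mathcal A=y\sum_{j\ge0}\mathcal A_jy^j,\quad \mathcal B_2=y^3\sum_{j\ge0}\Theta_jy^j,\quad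 \mathcal B_3=y^3\sum_{j\ge0}\Phi_jy^j$$ whose coefficients are smooth functions of $(\theta,\phi)\in(0,\pi)\times\mathbb R$, $2\pi$-periodic in $\phi$, with $f_0>0$ and $\mathcal A_0>0$, which satisfies these equations identically as formal series in $y$. It has a *regular axis* if $f_0$ extends continuously to the axis $\theta=0$ with positive values $f_0(0,\phi)$ and the axis is elementary flat on the horizon: for the metric $q=\lim_{y\to0}s/f$ on the horizon and every $\phi$, $\int_0^{2\pi}\sqrt{q_{\phi\phi}(\theta,\psi)}\,d\psi\Big/\int_0^{\theta}\sqrt{q_{\theta\theta}(t,\phi)}\,dt\to2\pi$ as $\theta\to0$. 1. Every formal horizon solution satisfies $$\mathcal A_0=\kappa f_0\ \text{ with a constant }\kappa,\qquad \frac{\mathcal A_1}{\mathcal A_0}=-\frac3{2R},\qquad f_1=-\frac{f_0}{R},\qquad b_1=-\frac{2b_0}{R}.$$ If it has a regular axis, then $f_{0,\phi}(0,\phi)=0$ for all $\phi$, and $\kappa=2/(Rf_0(0,0))$. 2. The functions $f_0$ and $b_0$ are free: let $f_0>0$ and $b_0$ be smooth on $(0,\pi)\times\mathbb R$ and $2\pi$-periodic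 in $\phi$, and let $f_0$ extend continuously to $\theta=0$ with positive values satisfying $f_{0,\phi}(0,\phi)=0$. Then there is a formal horizon solution with a regular axis and with these leading coefficients. Moreover, for any $\theta_0\in(0,\pi)$, the values of $\Theta_n(\theta_0,\phi)$ and $\Phi_n(\theta_0,\phi)$, $n\ge0$, can be prescribed as arbitrary smooth $2\pi$-periodic functions of $\phi$ (integration functions, reflecting the residual gauge freedom). 3. Up to these integration functions all other coefficients are determined, order by order, by $f_0$ and $b_0$: if two formal horizon solutions with regular axis have the same $f_0$ and $b_0$, and if, for some $\theta_0\in(0,\pi)$ and $N\ge0$, their functions $\Theta_n(\theta_0,\cdot)$ and $\Phi_n(\theta_0,\cdot)$ coincide for all $n<N$, then their coefficients $\Theta_n,\Phi_n$ coincide for $n<N$, and their coefficients $f_n,b_n,\mathcal A_n$ coincide for $n<N+2$. -/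

import Mathlib

open scoped ContDiff

noncomputable section

namespace KillingHorizon

/-- The coordinate domain `0 < θ < π`, `φ ∈ ℝ` of the angles; points are pairs `(θ, φ)`. -/
abbrev Angles : Set (ℝ × ℝ) := Set.Ioo 0 Real.pi ×ˢ Set.univ

/-- Extension by zero of a function of the angles to the whole plane. -/
def ext (g : Angles → ℝ) : ℝ × ℝ → ℝ := Function.extend Subtype.val g 0

lemma ext_apply (g : Angles → ℝ) (x : Angles) : ext g x = g x :=
  Subtype.val_injective.extend_apply g 0 x

lemma ext_of_mem (g : Angles → ℝ) {x : ℝ × ℝ} (hx : x ∈ Angles) : ext g x = g ⟨x, hx⟩ :=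
  ext_apply g ⟨x, hx⟩

lemma ext_of_notMem (g : Angles → ℝ) {x : ℝ × ℝ} (hx : x ∉ Angles) : ext g x = 0 :=
  Function.extend_apply' _ _ _ (by rintro ⟨y, rfl⟩; exact hx y.2)

lemma isOpen_angles : IsOpen Angles := isOpen_Ioo.prod isOpen_univ

lemma shift_mem {x : ℝ × ℝ} : (x.1, x.2 + 2 * Real.pi) ∈ Angles ↔ x ∈ Angles := by
  simp [Angles]

/-- The ring of angular functions: smooth functions of `(θ, φ)`, `0 < θ < π`, which are
`2π`-periodic in `φ`. -/
def Ang : Subalgebra ℝ (Angles → ℝ) where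
  carrier := {g | ContDiffOn ℝ ∞ (ext g) Angles ∧
    ∀ x : ℝ × ℝ, ext g (x.1, x.2 + 2 * Real.pi) = ext g x}
  mul_mem' := by
    rintro a b ⟨ha, ha'⟩ ⟨hb, hb'⟩
    have e : ext (a * b) = fun x => ext a x * ext b x := by
      funext x
      by_cases hx : x ∈ Angles
      · simp [ext_of_mem _ hx]
      · simp [ext_of_notMem _ hx]
    refine ⟨?_, fun x => ?_⟩
    · rw [e]; exact ha.mul hb
    · rw [e]; simp only [ha', hb']
  add_mem' := by
    rintro a b ⟨ha, ha'⟩ ⟨hb, hb'⟩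
    have e : ext (a + b) = fun x => ext a x + ext b x := by
      funext x
      by_cases hx : x ∈ Angles
      · simp [ext_of_mem _ hx]
      · simp [ext_of_notMem _ hx]
    refine ⟨?_, fun x => ?_⟩
    · rw [e]; exact ha.add hb
    · rw [e]; simp only [ha', hb']
  algebraMap_mem' := by
    intro c
    refine ⟨?_, fun x => ?_⟩
    · exact (contDiffOn_const (c := c)).congr (fun x hx => by rw [ext_of_mem _ hx]; rfl)
    · by_cases hx : x ∈ Angles
      · rw [ext_of_mem _ hx, ext_of_mem _ (shift_mem.2 hx)]; rfl
      · rw [ext_of_notMem _ hx, ext_of_notMem _ (fun h => hx (shift_mem.1 h))]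

lemma ext_differentiableAt (g : Ang) (x : Angles) : DifferentiableAt ℝ (ext g.1) x :=
  ((g.2.1.differentiableOn (by simp)) x x.2).differentiableAt (isOpen_angles.mem_nhds x.2)

/-- The derivative of an angular function in the constant direction `v` of the `(θ, φ)`-plane. -/
def dirDeriv (v : ℝ × ℝ) (g : Ang) : Ang :=
  ⟨fun x => fderiv ℝ (ext g.1) x v, by
    constructor
    · have h : ContDiffOn ℝ ∞ (fun x => fderiv ℝ (ext g.1) x v) Angles :=
        (g.2.1.fderiv_of_isOpen isOpen_angles (by simp)).clm_apply contDiffOn_const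
      exact h.congr (fun x hx => by rw [ext_of_mem _ hx])
    · intro x
      by_cases hx : x ∈ Angles
      · rw [ext_of_mem _ hx, ext_of_mem _ (shift_mem.2 hx)]
        have e : ext g.1 = fun z => ext g.1 (z + (0, 2 * Real.pi)) := by
          funext z
          rw [← g.2.2 z]
          simp [Prod.add_def]
        have h2 : fderiv ℝ (ext g.1) x
            = fderiv ℝ (ext g.1) (x + (0, 2 * Real.pi)) := by
          conv_lhs => rw [e]
          exact fderiv_comp_add_right _
        have h3 : x + (0, 2 * Real.pi) = (x.1, x.2 + 2 * Real.pi) := by simp [Prod.add_def]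
        rw [h3] at h2
        exact congrArg (fun T => T v) h2.symm
      · rw [ext_of_notMem _ hx, ext_of_notMem _ (fun h => hx (shift_mem.1 h))]⟩

lemma ext_eventuallyEq {F : ℝ × ℝ → ℝ} (g : Angles → ℝ) (x : Angles)
    (h : ∀ y : Angles, g y = F y) : ext g =ᶠ[nhds (x : ℝ × ℝ)] F := by
  filter_upwards [isOpen_angles.mem_nhds x.2] with y hy
  rw [ext_of_mem _ hy]
  exact h ⟨y, hy⟩

/-- `dirDeriv v` as a derivation of the ring of angular functions. -/
def dirDerivation (v : ℝ × ℝ) : Derivation ℝ Ang Ang :=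
  Derivation.mk'
    { toFun := dirDeriv v
      map_add' := fun a b => by
        apply Subtype.ext; funext x
        have e : ext (a + b).1 =ᶠ[nhds (x : ℝ × ℝ)] (ext a.1 + ext b.1) :=
          ext_eventuallyEq _ x (fun y => by simp [ext_apply])
        change fderiv ℝ (ext (a + b).1) x v = fderiv ℝ (ext a.1) x v + fderiv ℝ (ext b.1) x v
        rw [e.fderiv_eq, fderiv_add (ext_differentiableAt a x) (ext_differentiableAt b x)]
        rfl
      map_smul' := fun c a => by
        apply Subtype.ext; funext x
        have e : ext (c • a).1 =ᶠ[nhds (x : ℝ × ℝ)] (c • ext a.1) :=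
          ext_eventuallyEq _ x (fun y => by simp [ext_apply])
        change fderiv ℝ (ext (c • a).1) x v = c • fderiv ℝ (ext a.1) x v
        rw [e.fderiv_eq, fderiv_const_smul (ext_differentiableAt a x)]
        rfl }
    (fun a b => by
      apply Subtype.ext; funext x
      have e : ext (a * b).1 =ᶠ[nhds (x : ℝ × ℝ)] (ext a.1 * ext b.1) :=
        ext_eventuallyEq _ x (fun y => by simp [ext_apply])
      change fderiv ℝ (ext (a * b).1) x v
        = a.1 x * fderiv ℝ (ext b.1) x v + b.1 x * fderiv ℝ (ext a.1) x v
      rw [e.fderiv_eq, fderiv_mul (ext_differentiableAt a x) (ext_differentiableAt b x)]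
      simp [ext_apply])

/-- The angular function `sin θ`. -/
def sinTheta : Ang :=
  ⟨fun x => Real.sin x.1.1, by
    constructor
    · exact (Real.contDiff_sin.comp contDiff_fst).contDiffOn.congr
        (fun x hx => by rw [ext_of_mem _ hx]; rfl)
    · intro x
      by_cases hx : x ∈ Angles
      · rw [ext_of_mem _ hx, ext_of_mem _ (shift_mem.2 hx)]
      · rw [ext_of_notMem _ hx, ext_of_notMem _ (fun h => hx (shift_mem.1 h))]⟩

/-! ### Formal series in `y = r - R` with angular functions as coefficients -/

/-- Formal Laurent series in `y = r - R` whose coefficients are angular functions. -/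
abbrev Ser : Type := LaurentSeries Ang

/-- The series `y ^ m * ∑ j, F j * y ^ j`. -/
def ser (m : ℤ) (F : ℕ → Ang) : Ser :=
  HahnSeries.single m 1 * HahnSeries.ofPowerSeries ℤ Ang (PowerSeries.mk F)

/-- The partial derivatives with respect to the coordinates `x⁰ = r`, `x¹ = θ`, `x² = φ`
(so `∂_r = d/dy`, and the angular derivatives act on the coefficients). -/
def pd (a : Fin 3) (u : Ser) : Ser :=
  ![LaurentSeries.hasseDeriv ℝ 1 u, u.map (dirDerivation (1, 0)), u.map (dirDerivation (0, 1))] a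

/-- The radial coordinate `r = R + y`. -/
def radius (R : ℝ) : Ser := HahnSeries.C (algebraMap ℝ Ang R) + HahnSeries.single 1 1

/-! ### Riemannian geometry of a formal 3-metric -/

section Geometry

variable (h : Matrix (Fin 3) (Fin 3) Ser)

/-- Christoffel symbols `Γ^a_{bc}` of the metric `h`. -/
def christoffel (a b c : Fin 3) : Ser :=
  ∑ d, (1 / 2 : ℝ) • (h⁻¹ a d * (pd b (h d c) + pd c (h d b) - pd d (h b c)))

/-- The Ricci tensor `R_{bc}` of the metric `h`. -/
def ricci (b c : Fin 3) : Ser :=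
  ∑ a, (pd a (christoffel h a b c) - pd c (christoffel h a b a)
    + ∑ d, (christoffel h a a d * christoffel h d b c
      - christoffel h a c d * christoffel h d b a))

/-- Formal complexification of the ring of series: pairs `u + i v` with `i ^ 2 = -1`;
`star` is complex conjugation. -/
abbrev CSer : Type := QuadraticAlgebra Ser (-1) 0

/-- Partial derivatives of complex series. -/
def cpd (a : Fin 3) (E : CSer) : CSer := ⟨pd a E.re, pd a E.im⟩

/-- `D_a D^a E = h^{ab} (∂_a ∂_b E - Γ^c_{ab} ∂_c E)`. -/
def laplacian (E : CSer) : CSer :=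
  ∑ a, ∑ b, h⁻¹ a b • (cpd a (cpd b E) - ∑ c, christoffel h c a b • cpd c E)

/-- `D_a E D^a E = h^{ab} ∂_a E ∂_b E`. -/
def gradSq (E : CSer) : CSer :=
  ∑ a, ∑ b, h⁻¹ a b • (cpd a E * cpd b E)

/-- The Ernst equation `f D_a D^a ℰ = D_a ℰ D^a ℰ`, where `f = Re ℰ`. -/
def ErnstEquation (E : CSer) : Prop := E.re • laplacian h E = gradSq h E

/-- The equations `R_{ab} = Re (∂_a ℰ * conj (∂_b ℰ)) / (2 f ^ 2)`, where `f = Re ℰ`. -/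
def RicciEquations (E : CSer) : Prop :=
  ∀ a b, ricci h a b = (1 / 2 : ℝ) • (Ring.inverse (E.re ^ 2) * (cpd a E * star (cpd b E)).re)

end Geometry

/-! ### The ansatz at the horizon in the quasi-isotropic gauge -/

/-- The coefficient functions of the expansions
`f = y² ∑ f_j y^j`, `b = y⁴ ∑ b_j y^j`, `𝒜 = y ∑ 𝒜_j y^j`,
`ℬ_θ = y³ ∑ Θ_j y^j`, `ℬ_φ = y³ ∑ Φ_j y^j`. -/
@[ext] structure Expansion where
  f : ℕ → Ang
  b : ℕ → Ang
  A : ℕ → Ang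
  Θ : ℕ → Ang
  Φ : ℕ → Ang

namespace Expansion

variable (R : ℝ) (E : Expansion)

/-- The lapse `𝒜`. -/
def lapse : Ser := ser 1 E.A

/-- The shift with lower indices, `ℬ_θ`. -/
def shiftTheta : Ser := ser 3 E.Θ

/-- The shift with lower indices, `ℬ_φ`. -/
def shiftPhi : Ser := ser 3 E.Φ

/-- `s_{θθ} = r² 𝒜²`. -/
def sTheta : Ser := radius R ^ 2 * E.lapse ^ 2

end Expansion

/-- `s_{φφ} = r² sin² θ (1 - R² / r²)²`. -/
def sPhi (R : ℝ) : Ser :=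
  radius R ^ 2 * HahnSeries.C sinTheta ^ 2 * (1 - R ^ 2 • Ring.inverse (radius R ^ 2)) ^ 2

namespace Expansion

variable (R : ℝ) (E : Expansion)

/-- The 3-metric `h = s_{αβ} (dx^α + ℬ^α dr) (dx^β + ℬ^β dr) + 𝒜² dr²` with
`s = diag(s_{θθ}, s_{φφ})`, written out in terms of `ℬ_α = s_{αβ} ℬ^β`. -/
def metric : Matrix (Fin 3) (Fin 3) Ser :=
  !![E.lapse ^ 2 + E.shiftTheta ^ 2 * Ring.inverse (E.sTheta R)
        + E.shiftPhi ^ 2 * Ring.inverse (sPhi R), E.shiftTheta, E.shiftPhi;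
     E.shiftTheta, E.sTheta R, 0;
     E.shiftPhi, 0, sPhi R]

/-- The Ernst potential `ℰ = f + i b`. -/
def ernst : CSer := ⟨ser 2 E.f, ser 4 E.b⟩

/-- Formal solutions near the horizon: the leading coefficients of the norm `f` of the Killing
vector and of the lapse are positive, and the field equations hold as identities of formal
series. -/
structure IsSolution : Prop where
  f_pos : ∀ x, 0 < (E.f 0).1 x
  A_pos : ∀ x, 0 < (E.A 0).1 x
  ernst_eq : ErnstEquation (E.metric R) E.ernst
  ricci_eq : RicciEquations (E.metric R) E.ernst

/-- The component `θθ` of the metric `s / f` induced on the horizon `y = 0`. -/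
def horizonTheta : Ang := (E.sTheta R * Ring.inverse (ser 2 E.f)).coeff 0

/-- The component `φφ` of the metric `s / f` induced on the horizon `y = 0`. -/
def horizonPhi : Ang := (sPhi R * Ring.inverse (ser 2 E.f)).coeff 0

end Expansion

/-- The angular function `g` extends continuously to the axis `θ = 0`, with values `a φ` there. -/
def HasAxisValues (g : Ang) (a : ℝ → ℝ) : Prop :=
  ∀ φ : ℝ, Filter.Tendsto (ext g.1) (nhdsWithin (0, φ) Angles) (nhds (a φ))

/-- Regularity of the axis `θ = 0` on the horizon: `f_0` has positive boundary values `a φ` on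
the axis, and the axis is elementary flat, i.e. the circumference of a small circle
`θ = const` is asymptotically `2π` times its radius (measured along any meridian). -/
structure Expansion.RegularAxis (R : ℝ) (E : Expansion) (a : ℝ → ℝ) : Prop where
  axis : HasAxisValues (E.f 0) a
  pos : ∀ φ, 0 < a φ
  flat : ∀ φ : ℝ, Filter.Tendsto
    (fun θ : ℝ => (∫ ψ in (0 : ℝ)..(2 * Real.pi), Real.sqrt (ext (E.horizonPhi R).1 (θ, ψ)))
      / ∫ t in (0 : ℝ)..θ, Real.sqrt (ext (E.horizonTheta R).1 (t, φ)))
    (nhdsWithin 0 (Set.Ioi 0)) (nhds (2 * Real.pi))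

end KillingHorizon

end

/-! Count powers of y, giving one extra power to every quantity with an odd number of angular
indices. With this weight the field equations are homogeneous to leading order, and changes of 𝒜_n,
f_n, b_n and of Θ_{n-2}, Φ_{n-2} first show up in the equations at one common relative order n,
where they enter linearly. The proof solves this linear problem for each n ≥ 2; the orders 0 and 1
are treated separately (`solUpTo_two_iff`).

Let α be the relative change of 𝒜_n and (τ, π) the change of the shift. At order n the angular Ricci
equations do not see f and b. In the φφ-equation the terms with α cancel. Together with the
θφ-equation it becomes a first-order system ∂_θ τ = -c ∂_φ π + ..., ∂_θ π = -∂_φ τ + ..., where c >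
0 is n + 1 times the ratio of the leading coefficients of s_θθ and s_φφ. With θ as time this is
strictly hyperbolic, hence uniquely solvable on all of 0 < θ < π for arbitrary periodic data on θ =
θ₀: these data are the integration functions (`exists_hyperbolic`, `hyperbolic_unique`). The
difference of the θθ- and φφ-equations then yields nα algebraically, and the two parts of the Ernst
equation yield n² δf and n (n + 4) δb (`levelChange`, `exists_succ`, `agree_succ`).

The equations with an index r are constraints. Once the Ernst equation holds, the contracted Bianchi
identity is a conservation law for the Ricci residual (`divTrace_resid`). If the angular residuals
vanish, it multiplies the first possibly nonzero coefficients of the remaining ones by factors that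
are nonzero except at the lowest order (`resid_eq_zero`). At that order the rr-equation is an
identity, and the other two say that 𝒜_0 and f_0 have the same logarithmic derivatives, so that 𝒜_0
= κ f_0 (`resid_zero_ang_iff`).

On the horizon q_φφ = 4 sin² θ / f_0 and q_θθ = R² κ² f_0. The quotient of circumference and radius
tends to 2 ∫ a^{-1/2} / (R κ a(φ)^{1/2}), where a is the axis value of f_0. It equals 2π for every φ
exactly if a is constant and κ = 2 / (R a) (`tendsto_circumference`).

The hyperbolic system is diagonalized by Riemann invariants and transported to the plane.
Characteristic coordinates turn it into integral equations solved by Picard iteration. Uniqueness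
from cones of dependence allows solutions on growing strips to be glued and makes them periodic. -/

noncomputable section

namespace KillingHorizon

/-! Shortcut instances, which speed up the search; they are not visible outside. -/

namespace Shortcuts

scoped instance : CommRing Ang := inferInstance
scoped instance : AddCommGroup Ang := inferInstance
scoped instance : Algebra ℝ Ang := inferInstance
scoped instance : Module ℝ Ang := inferInstance
scoped instance : CommRing Ser := inferInstance
scoped instance : AddCommGroup Ser := inferInstance
scoped instance : AddGroup Ser := inferInstance
scoped instance : AddCommMonoid Ser := inferInstance
scoped instance : AddMonoid Ser := inferInstance
scoped instance : Module ℝ Ser := inferInstance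
scoped instance : Module Ser Ser := inferInstance

end Shortcuts

open scoped Shortcuts

/-! ### The angular derivatives -/

/-- The derivation `∂_θ`. -/
abbrev dθ : Derivation ℝ Ang Ang := dirDerivation (1, 0)

/-- The derivation `∂_φ`. -/
abbrev dφ : Derivation ℝ Ang Ang := dirDerivation (0, 1)

lemma dirDerivation_apply (v : ℝ × ℝ) (g : Ang) (x : Angles) :
    (dirDerivation v g).1 x = fderiv ℝ (ext g.1) x v := rfl

lemma ext_contDiffAt (g : Ang) (x : Angles) : ContDiffAt ℝ ∞ (ext g.1) x :=
  g.2.1.contDiffAt (isOpen_angles.mem_nhds x.2)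

/-- Symmetry of the second Fréchet derivative. The Bianchi identity rests on commuting coordinate
derivatives. -/
lemma dirDerivation_comm (v w : ℝ × ℝ) (g : Ang) :
    dirDerivation v (dirDerivation w g) = dirDerivation w (dirDerivation v g) := by
  have key : ∀ (v w : ℝ × ℝ) (x : Angles), (dirDerivation v (dirDerivation w g)).1 x
      = fderiv ℝ (fderiv ℝ (ext g.1)) x v w := by
    intro v w x
    rw [dirDerivation_apply]
    have e : ext (dirDerivation w g).1 =ᶠ[nhds (x : ℝ × ℝ)] fun y => fderiv ℝ (ext g.1) y w :=
      ext_eventuallyEq _ x (fun y => rfl)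
    rw [e.fderiv_eq]
    have hd : DifferentiableAt ℝ (fderiv ℝ (ext g.1)) x :=
      ((ext_contDiffAt g x).fderiv_right (m := 1) (by norm_cast)).differentiableAt (by simp)
    have := fderiv_clm_apply hd (differentiableAt_const w)
    simp [this]
  apply Subtype.ext; funext x
  rw [key, key]
  have := ((ext_contDiffAt g x).of_le (m := 2) (by norm_cast)).isSymmSndFDerivAt (by simp)
  exact this v w

/-! ### Partial derivatives of formal series -/

/-- The operator acting on the coefficient of `y ^ k` by `T k`. -/
def termwise (T : ℤ → Ang →ₗ[ℝ] Ang) (u : Ser) : Ser :=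
  HahnSeries.ofSuppBddBelow (fun k => T k (u.coeff k)) ⟨u.order, fun k hk => by
    contrapose! hk
    rw [Function.notMem_support, HahnSeries.coeff_eq_zero_of_lt_order hk, map_zero]⟩

@[simp] lemma termwise_coeff (T : ℤ → Ang →ₗ[ℝ] Ang) (u : Ser) (k : ℤ) :
    (termwise T u).coeff k = T k (u.coeff k) := rfl

lemma termwise_support (T : ℤ → Ang →ₗ[ℝ] Ang) (u : Ser) :
    (termwise T u).support ⊆ u.support := by
  intro k hk h
  simp only [HahnSeries.mem_support, termwise_coeff] at hk
  rw [h, map_zero] at hk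
  exact hk rfl

/-- Both sides become sums over the same antidiagonal once the supports of the factors containing
`T` are enlarged to those of `u` and `v`. A Leibniz rule depending on the degree covers the Euler
operator as well as the angular derivatives. -/
lemma termwise_mul (T : ℤ → Ang →ₗ[ℝ] Ang)
    (hT : ∀ i j a b, T (i + j) (a * b) = a * T j b + T i a * b) (u v : Ser) :
    termwise T (u * v) = u * termwise T v + termwise T u * v := by
  ext1; funext k
  rw [termwise_coeff, HahnSeries.coeff_add,
    HahnSeries.coeff_mul_right' v.isPWO_support (termwise_support T v),
    HahnSeries.coeff_mul_left' u.isPWO_support (termwise_support T u),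
    HahnSeries.coeff_mul, map_sum, ← Finset.sum_add_distrib]
  refine Finset.sum_congr rfl fun ij hij => ?_
  rw [Finset.mem_antidiagonal] at hij
  rw [← hij.2.2, hT]
  rfl

lemma pd_zero_coeff (u : Ser) (k : ℤ) :
    (pd 0 u).coeff k = ((k : ℝ) + 1) • u.coeff (k + 1) := by
  change (LaurentSeries.hasseDeriv ℝ 1 u).coeff k = _
  rw [LaurentSeries.hasseDeriv_coeff]
  simp only [Nat.cast_one, Ring.choose_one_right]
  rw [← Int.cast_smul_eq_zsmul ℝ]
  push_cast
  rfl

lemma pd_one_coeff (u : Ser) (k : ℤ) : (pd 1 u).coeff k = dθ (u.coeff k) := rfl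

lemma pd_two_coeff (u : Ser) (k : ℤ) : (pd 2 u).coeff k = dφ (u.coeff k) := rfl

/-- The Euler operator y ∂_y preserves degrees and so acts termwise, which ∂_y does not. This
reduces the Leibniz rule for ∂_y to `termwise_mul`. -/
lemma pd_zero_eq (u : Ser) :
    pd 0 u = HahnSeries.single (-1) 1 * termwise (fun k => (k : ℝ) • LinearMap.id) u := by
  ext1; funext k
  have h := HahnSeries.coeff_single_mul_add (r := (1 : Ang))
    (x := termwise (fun k => (k : ℝ) • LinearMap.id) u) (a := k + 1) (b := -1)
  rw [show k + 1 + -1 = k by ring] at h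
  rw [h, pd_zero_coeff]
  simp

lemma pd_add (a : Fin 3) (u v : Ser) : pd a (u + v) = pd a u + pd a v := by
  ext1; funext k
  fin_cases a <;> simp [pd_zero_coeff, pd_one_coeff, pd_two_coeff]

lemma pd_smul (a : Fin 3) (c : ℝ) (u : Ser) : pd a (c • u) = c • pd a u := by
  ext1; funext k
  fin_cases a <;> simp [pd_zero_coeff, pd_one_coeff, pd_two_coeff, smul_comm c]

lemma pd_mul (a : Fin 3) (u v : Ser) : pd a (u * v) = u * pd a v + pd a u * v := by
  fin_cases a
  · change pd 0 (u * v) = u * pd 0 v + pd 0 u * v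
    rw [pd_zero_eq, pd_zero_eq, pd_zero_eq, termwise_mul]
    · ring
    · intro i j a b
      simp only [LinearMap.smul_apply, LinearMap.id_apply]
      push_cast
      rw [add_smul, mul_smul_comm, smul_mul_assoc, add_comm]
  · change termwise (fun _ => (dθ : Ang →ₗ[ℝ] Ang)) (u * v) = _
    rw [termwise_mul]
    · rfl
    · intro i j a b
      simp only [Derivation.coeFn_coe, Derivation.leibniz, smul_eq_mul]
      ring
  · change termwise (fun _ => (dφ : Ang →ₗ[ℝ] Ang)) (u * v) = _
    rw [termwise_mul]
    · rfl
    · intro i j a b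
      simp only [Derivation.coeFn_coe, Derivation.leibniz, smul_eq_mul]
      ring

/-- The partial derivatives as additive maps. -/
def pdHom (a : Fin 3) : Ser →+ Ser := AddMonoidHom.mk' (pd a) (pd_add a)

lemma pd_sub (a : Fin 3) (u v : Ser) : pd a (u - v) = pd a u - pd a v := map_sub (pdHom a) u v

lemma pd_comm (a b : Fin 3) (u : Ser) : pd a (pd b u) = pd b (pd a u) := by
  ext1; funext k
  fin_cases a <;> fin_cases b <;>
    simp [pd_zero_coeff, pd_one_coeff, pd_two_coeff, dirDerivation_comm (0, 1) (1, 0)]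

/-- Constant series. -/
def cst : ℝ →+* Ser := (HahnSeries.C : Ang →+* Ser).comp (algebraMap ℝ Ang)

lemma smul_eq_cst_mul (c : ℝ) (u : Ser) : c • u = cst c * u := by
  ext1; funext k
  have h := HahnSeries.coeff_single_mul_add (r := algebraMap ℝ Ang c) (x := u) (a := k) (b := 0)
  rw [add_zero] at h
  rw [HahnSeries.coeff_smul, Algebra.smul_def, ← h]
  rfl

instance : IsScalarTower ℝ Ser Ser :=
  ⟨fun c u v => by simp only [smul_eq_cst_mul, smul_eq_mul, mul_assoc]⟩

instance : SMulCommClass ℝ Ser Ser :=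
  ⟨fun c u v => by simp only [smul_eq_cst_mul, smul_eq_mul, mul_left_comm]⟩

/-! ### The order of a formal series -/

/-- `u = O(y ^ m)`. -/
def Ord (m : ℤ) (u : Ser) : Prop := ∀ k < m, u.coeff k = 0

lemma Ord.mono {m k : ℤ} {u : Ser} (h : Ord m u) (hk : k ≤ m) : Ord k u :=
  fun i hi => h i (hi.trans_le hk)

lemma Ord.zero (m : ℤ) : Ord m 0 := fun _ _ => rfl

lemma Ord.add {m : ℤ} {u v : Ser} (hu : Ord m u) (hv : Ord m v) : Ord m (u + v) :=
  fun k hk => by simp [hu k hk, hv k hk]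

lemma Ord.sub {m : ℤ} {u v : Ser} (hu : Ord m u) (hv : Ord m v) : Ord m (u - v) :=
  fun k hk => by simp [hu k hk, hv k hk]

lemma Ord.neg {m : ℤ} {u : Ser} (hu : Ord m u) : Ord m (-u) :=
  fun k hk => by simp [hu k hk]

lemma Ord.smul {m : ℤ} {u : Ser} (c : ℝ) (hu : Ord m u) : Ord m (c • u) :=
  fun k hk => by simp [hu k hk]

lemma Ord.mul {m k : ℤ} {u v : Ser} (hu : Ord m u) (hv : Ord k v) : Ord (m + k) (u * v) := by
  intro l hl
  rw [HahnSeries.coeff_mul]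
  refine Finset.sum_eq_zero fun ij hij => ?_
  rw [Finset.mem_antidiagonal] at hij
  by_cases h : ij.1 < m
  · rw [hu _ h, zero_mul]
  · rw [hv ij.2 (by omega), mul_zero]

lemma ord_single (m : ℤ) (a : Ang) : Ord m (HahnSeries.single m a) := fun k hk => by
  rw [HahnSeries.coeff_single_of_ne (by omega)]

lemma Ord.succ {m : ℤ} {u : Ser} (h : Ord m u) (h0 : u.coeff m = 0) : Ord (m + 1) u := by
  intro k hk
  rcases (Int.lt_add_one_iff.1 hk).lt_or_eq with h' | rfl
  · exact h k h'
  · exact h0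

lemma Ord.sub_single {m : ℤ} {u : Ser} (h : Ord m u) :
    Ord (m + 1) (u - HahnSeries.single m (u.coeff m)) :=
  (h.sub (ord_single m _)).succ (by
    rw [HahnSeries.coeff_sub, HahnSeries.coeff_single_same, sub_self])

lemma Ord.coeff_mul {m k : ℤ} {u v : Ser} (hu : Ord m u) (hv : Ord k v) :
    (u * v).coeff (m + k) = u.coeff m * v.coeff k := by
  have e : u * v = HahnSeries.single m (u.coeff m) * v
      + (u - HahnSeries.single m (u.coeff m)) * v := by ring
  rw [e, HahnSeries.coeff_add, (hu.sub_single.mul hv) (m + k) (by omega), add_zero, add_comm m k,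
    HahnSeries.coeff_single_mul_add]

/-- Splitting off the leading monomial of `u` leaves a product of one order higher, of which only
the leading coefficient is needed. -/
lemma Ord.coeff_mul_succ {m k : ℤ} {u v : Ser} (hu : Ord m u) (hv : Ord k v) :
    (u * v).coeff (m + k + 1) = u.coeff m * v.coeff (k + 1) + u.coeff (m + 1) * v.coeff k := by
  have e : u * v = HahnSeries.single m (u.coeff m) * v
      + (u - HahnSeries.single m (u.coeff m)) * v := by ring
  have h2 := hu.sub_single.coeff_mul hv
  rw [show m + 1 + k = m + k + 1 by ring] at h2
  rw [e, HahnSeries.coeff_add, h2, show m + k + 1 = (k + 1) + m by ring,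
    HahnSeries.coeff_single_mul_add, HahnSeries.coeff_sub,
    HahnSeries.coeff_single_of_ne (by omega), sub_zero]

lemma Ord.pd_zero {m : ℤ} {u : Ser} (h : Ord m u) : Ord (m - 1) (pd 0 u) := fun k hk => by
  rw [pd_zero_coeff, h _ (by omega), smul_zero]

lemma Ord.pd_ang {m : ℤ} {u : Ser} (h : Ord m u) {a : Fin 3} (ha : a ≠ 0) : Ord m (pd a u) := by
  intro k hk
  fin_cases a
  · exact absurd rfl ha
  · change dθ (u.coeff k) = 0
    rw [h k hk, map_zero]
  · change dφ (u.coeff k) = 0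
    rw [h k hk, map_zero]

lemma Ord.eq_zero {u : Ser} (h : ∀ m, Ord m u) : u = 0 := by
  ext1; funext k; exact h (k + 1) k (by omega)

/-- A series with invertible leading coefficient is invertible. -/
lemma Ord.exists_inverse {m : ℤ} {u : Ser} (h : Ord m u) {a : Ang} (ha : u.coeff m * a = 1) :
    ∃ v : Ser, u * v = 1 ∧ Ord (-m) v ∧ v.coeff (-m) = a := by
  set p : PowerSeries Ang := PowerSeries.mk fun k => u.coeff (m + k) with hp
  have hup : u = HahnSeries.single m 1 * HahnSeries.ofPowerSeries ℤ Ang p := by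
    ext1; funext k
    have h1 := HahnSeries.coeff_single_mul_add (r := (1 : Ang))
      (x := HahnSeries.ofPowerSeries ℤ Ang p) (a := k - m) (b := m)
    rw [sub_add_cancel] at h1
    rw [h1, one_mul]
    by_cases hk : k < m
    · rw [h k hk, HahnSeries.ofPowerSeries_apply, HahnSeries.embDomain_of_notMem_range]
      rintro ⟨n, hn⟩
      change (n : ℤ) = _ at hn
      omega
    · obtain ⟨n, hn⟩ := Int.eq_ofNat_of_zero_le (show 0 ≤ k - m by omega)
      rw [hn]
      have := HahnSeries.ofPowerSeries_apply_coeff (Γ := ℤ) p n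
      rw [this, hp, PowerSeries.coeff_mk]
      congr 1
      omega
  have hc : PowerSeries.constantCoeff p = u.coeff m := by
    rw [← PowerSeries.coeff_zero_eq_constantCoeff_apply, hp, PowerSeries.coeff_mk]; simp
  have hunit : IsUnit p := by
    rw [PowerSeries.isUnit_iff_constantCoeff, hc]
    exact IsUnit.of_mul_eq_one _ ha
  obtain ⟨q, hq⟩ := hunit.exists_right_inv
  refine ⟨HahnSeries.single (-m) 1 * HahnSeries.ofPowerSeries ℤ Ang q, ?_, ?_, ?_⟩
  · rw [hup]
    calc _ = (HahnSeries.single m 1 * HahnSeries.single (-m) 1)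
        * (HahnSeries.ofPowerSeries ℤ Ang p * HahnSeries.ofPowerSeries ℤ Ang q) := by ring
      _ = 1 := by
          rw [← map_mul, hq, RingHom.map_one, HahnSeries.single_mul_single, mul_one, mul_one,
            add_neg_cancel]
          rfl
  · have hq0 : Ord 0 (HahnSeries.ofPowerSeries ℤ Ang q) := by
      intro k hk
      rw [HahnSeries.ofPowerSeries_apply, HahnSeries.embDomain_of_notMem_range]
      rintro ⟨n, hn⟩
      change (n : ℤ) = _ at hn
      omega
    have := (ord_single (-m) 1).mul hq0
    rwa [add_zero] at this
  · have h1 := HahnSeries.coeff_single_mul_add (r := (1 : Ang))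
      (x := HahnSeries.ofPowerSeries ℤ Ang q) (a := 0) (b := -m)
    rw [zero_add] at h1
    rw [h1, one_mul]
    have h2 : (HahnSeries.ofPowerSeries ℤ Ang q).coeff 0 = PowerSeries.constantCoeff q := by
      have := HahnSeries.ofPowerSeries_apply_coeff (Γ := ℤ) q 0
      rw [← PowerSeries.coeff_zero_eq_constantCoeff_apply]
      simpa using this
    have h3 : u.coeff m * PowerSeries.constantCoeff q = 1 := by
      rw [← hc, ← map_mul, hq, map_one]
    rw [h2]
    calc PowerSeries.constantCoeff q = (u.coeff m * a) * PowerSeries.constantCoeff q := by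
          rw [ha, one_mul]
      _ = a * (u.coeff m * PowerSeries.constantCoeff q) := by ring
      _ = a := by rw [h3, mul_one]

lemma ringInverse_eq {u v : Ser} (h : u * v = 1) : Ring.inverse u = v := by
  have hu : IsUnit u := IsUnit.of_mul_eq_one _ h
  calc Ring.inverse u = Ring.inverse u * (u * v) := by rw [h, mul_one]
    _ = v := by rw [← mul_assoc, Ring.inverse_mul_cancel u hu, one_mul]

lemma ser_ord (m : ℤ) (F : ℕ → Ang) : Ord m (ser m F) := by
  have hq0 : Ord 0 (HahnSeries.ofPowerSeries ℤ Ang (PowerSeries.mk F)) := by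
    intro k hk
    rw [HahnSeries.ofPowerSeries_apply, HahnSeries.embDomain_of_notMem_range]
    rintro ⟨n, hn⟩
    change (n : ℤ) = _ at hn
    omega
  have := (ord_single m 1).mul hq0
  rwa [add_zero] at this

lemma ser_coeff (m : ℤ) (F : ℕ → Ang) (n : ℕ) : (ser m F).coeff (m + n) = F n := by
  have h1 := HahnSeries.coeff_single_mul_add (r := (1 : Ang))
    (x := HahnSeries.ofPowerSeries ℤ Ang (PowerSeries.mk F)) (a := n) (b := m)
  rw [ser, add_comm m, h1, one_mul]
  have := HahnSeries.ofPowerSeries_apply_coeff (Γ := ℤ) (PowerSeries.mk F) n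
  rw [this, PowerSeries.coeff_mk]

end KillingHorizon

end

noncomputable section

namespace KillingHorizon

open scoped Shortcuts

/-! ### The contracted Bianchi identity -/

section Bianchi

variable {K : Type*} [CommRing K] (D : Fin 3 → Derivation ℤ K K)

/-- Entrywise derivative of a matrix. -/
def mder (c : Fin 3) (M : Matrix (Fin 3) (Fin 3) K) : Matrix (Fin 3) (Fin 3) K := M.map (D c)

lemma mder_add (c : Fin 3) (M N : Matrix (Fin 3) (Fin 3) K) :
    mder D c (M + N) = mder D c M + mder D c N := by
  ext i j; simp [mder]

lemma mder_sub (c : Fin 3) (M N : Matrix (Fin 3) (Fin 3) K) :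
    mder D c (M - N) = mder D c M - mder D c N := by
  ext i j; simp [mder]

lemma mder_mul (c : Fin 3) (M N : Matrix (Fin 3) (Fin 3) K) :
    mder D c (M * N) = mder D c M * N + M * mder D c N := by
  ext i j
  simp only [mder, Matrix.map_apply, Matrix.mul_apply, Matrix.add_apply, map_sum,
    Derivation.leibniz, smul_eq_mul, ← Finset.sum_add_distrib]
  refine Finset.sum_congr rfl fun l _ => ?_
  ring

lemma mder_one (c : Fin 3) : mder D c (1 : Matrix (Fin 3) (Fin 3) K) = 0 := by
  ext i j
  simp [mder, Matrix.one_apply, apply_ite (D c)]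

lemma mder_transpose (c : Fin 3) (M : Matrix (Fin 3) (Fin 3) K) :
    mder D c M.transpose = (mder D c M).transpose := rfl

lemma mder_comm (hD : ∀ a b u, D a (D b u) = D b (D a u)) (a b : Fin 3)
    (M : Matrix (Fin 3) (Fin 3) K) : mder D a (mder D b M) = mder D b (mder D a M) := by
  ext i j; exact hD a b _

/-- The matrix `(Γ_c)^a_b = Γ^a_{cb}`. -/
def connMatrix (Γ : Fin 3 → Fin 3 → Fin 3 → K) (c : Fin 3) : Matrix (Fin 3) (Fin 3) K :=
  Matrix.of fun a b => Γ a c b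

/-- The curvature matrices `∂_c Γ_d - ∂_d Γ_c + [Γ_c, Γ_d]`. -/
def curvMatrix (G : Fin 3 → Matrix (Fin 3) (Fin 3) K) (c d : Fin 3) :
    Matrix (Fin 3) (Fin 3) K :=
  mder D c (G d) - mder D d (G c) + G c * G d - G d * G c

lemma curvMatrix_swap (G : Fin 3 → Matrix (Fin 3) (Fin 3) K) (c d : Fin 3) :
    curvMatrix D G d c = -curvMatrix D G c d := by
  unfold curvMatrix; noncomm_ring

/-- For commuting derivatives this is the Jacobi identity for the operators ∂_c + Γ_c; neither a
metric nor symmetry of the connection is involved. -/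
lemma curvMatrix_bianchi (hD : ∀ a b u, D a (D b u) = D b (D a u))
    (G : Fin 3 → Matrix (Fin 3) (Fin 3) K) (e c d : Fin 3) :
    mder D e (curvMatrix D G c d) + (G e * curvMatrix D G c d - curvMatrix D G c d * G e)
    + (mder D c (curvMatrix D G d e) + (G c * curvMatrix D G d e - curvMatrix D G d e * G c))
    + (mder D d (curvMatrix D G e c) + (G d * curvMatrix D G e c - curvMatrix D G e c * G d))
      = 0 := by
  simp only [curvMatrix, mder_add, mder_sub, mder_mul]
  rw [mder_comm D hD e c, mder_comm D hD e d, mder_comm D hD c d]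
  noncomm_ring

variable {D} {h k : Matrix (Fin 3) (Fin 3) K} {G : Fin 3 → Matrix (Fin 3) (Fin 3) K}

lemma mder_inv (hk : h * k = 1)
    (compat : ∀ c, mder D c h = h * G c + (G c).transpose * h) (c : Fin 3) :
    mder D c k = -(G c * k + k * (G c).transpose) := by
  have kh : k * h = 1 := mul_eq_one_comm.1 hk
  have h1 : mder D c h * k + h * mder D c k = 0 := by rw [← mder_mul, hk, mder_one]
  calc mder D c k = (k * h) * mder D c k := by rw [kh, one_mul]
    _ = k * (mder D c h * k + h * mder D c k) - k * mder D c h * k := by noncomm_ring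
    _ = -((k * h) * G c * k + k * (G c).transpose * (h * k)) := by
        rw [h1, compat]; noncomm_ring
    _ = _ := by rw [kh, hk]; noncomm_ring

/-- The second derivatives of `h` commute. Inserting the compatibility condition twice leaves
exactly the action of the curvature on `h`. -/
lemma curvMatrix_antisymm (hD : ∀ a b u, D a (D b u) = D b (D a u))
    (compat : ∀ c, mder D c h = h * G c + (G c).transpose * h) (c d : Fin 3) :
    h * curvMatrix D G c d + (curvMatrix D G c d).transpose * h = 0 := by
  have h1 := mder_comm D hD c d h
  rw [compat c, compat d, mder_add, mder_add, mder_mul, mder_mul, mder_mul, mder_mul, compat c,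
    compat d, mder_transpose, mder_transpose] at h1
  rw [← sub_eq_zero] at h1
  rw [← h1]
  simp only [curvMatrix, Matrix.transpose_sub, Matrix.transpose_add, Matrix.transpose_mul]
  noncomm_ring

/-- The curvature with raised second index is antisymmetric in its first two indices. -/
lemma curvMatrix_mul_inv_antisymm (hD : ∀ a b u, D a (D b u) = D b (D a u)) (hk : h * k = 1)
    (kT : k.transpose = k)
    (compat : ∀ c, mder D c h = h * G c + (G c).transpose * h) (c d : Fin 3) :
    (curvMatrix D G c d * k).transpose = -(curvMatrix D G c d * k) := by
  have kh : k * h = 1 := mul_eq_one_comm.1 hk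
  have h1 := curvMatrix_antisymm hD compat c d
  rw [Matrix.transpose_mul, kT]
  calc k * (curvMatrix D G c d).transpose
      = k * (h * curvMatrix D G c d + (curvMatrix D G c d).transpose * h) * k
        - (k * h) * curvMatrix D G c d * k
        + k * (curvMatrix D G c d).transpose * (1 - h * k) := by noncomm_ring
    _ = _ := by rw [h1, kh, hk]; noncomm_ring

/-- The inverse metric is parallel by `mder_inv`, so the second index can be raised under the
covariant derivative. With two upper indices both antisymmetries are available for the contraction.
-/
lemma curvMatrix_mul_inv_bianchi (hD : ∀ a b u, D a (D b u) = D b (D a u)) (hk : h * k = 1)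
    (compat : ∀ c, mder D c h = h * G c + (G c).transpose * h) (e c d : Fin 3) :
    (mder D e (curvMatrix D G c d * k) + G e * (curvMatrix D G c d * k)
      + (curvMatrix D G c d * k) * (G e).transpose)
    + (mder D c (curvMatrix D G d e * k) + G c * (curvMatrix D G d e * k)
      + (curvMatrix D G d e * k) * (G c).transpose)
    + (mder D d (curvMatrix D G e c * k) + G d * (curvMatrix D G e c * k)
      + (curvMatrix D G e c * k) * (G d).transpose) = 0 := by
  have h1 := curvMatrix_bianchi D hD G e c d
  have h2 := congrArg (· * k) h1
  simp only [zero_mul] at h2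
  simp only [mder_mul, mder_inv hk compat]
  rw [← h2]
  noncomm_ring

/-- Twice the divergence of a mixed tensor `M^a_e` minus the derivative of its trace. -/
def divTrace (D : Fin 3 → Derivation ℤ K K) (Γ : Fin 3 → Fin 3 → Fin 3 → K)
    (M : Matrix (Fin 3) (Fin 3) K) (e : Fin 3) : K :=
  2 * ∑ a, (D a (M a e) + ∑ f, (Γ a a f * M f e - Γ a e f * M f a)) - D e (∑ a, M a a)

/-- The Ricci tensor of a connection. -/
def ricciOf (D : Fin 3 → Derivation ℤ K K) (Γ : Fin 3 → Fin 3 → Fin 3 → K) :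
    Matrix (Fin 3) (Fin 3) K :=
  Matrix.of fun b c => ∑ a, (D a (Γ a b c) - D c (Γ a b a)
    + ∑ d, (Γ a a d * Γ d b c - Γ a c d * Γ d b a))

variable {Γ : Fin 3 → Fin 3 → Fin 3 → K}

lemma ricciOf_eq (hΓ : ∀ a b c, Γ a b c = Γ a c b) (b c : Fin 3) :
    ricciOf D Γ b c = ∑ a, curvMatrix D (connMatrix Γ) a c a b := by
  simp only [ricciOf, Matrix.of_apply, curvMatrix, connMatrix, mder, Matrix.sub_apply,
    Matrix.add_apply, Matrix.map_apply, Matrix.mul_apply]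
  refine Finset.sum_congr rfl fun a _ => ?_
  rw [Finset.sum_sub_distrib, hΓ a b c, hΓ a b a]
  simp_rw [hΓ _ b c, hΓ _ b a]
  ring

lemma inv_mul_ricciOf (hΓ : ∀ a b c, Γ a b c = Γ a c b) (kT : k.transpose = k) (b c : Fin 3) :
    (k * ricciOf D Γ) b c = ∑ a, (curvMatrix D (connMatrix Γ) a c * k) a b := by
  simp only [Matrix.mul_apply, ricciOf_eq hΓ, Finset.mul_sum]
  rw [Finset.sum_comm]
  refine Finset.sum_congr rfl fun a _ => Finset.sum_congr rfl fun d _ => ?_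
  rw [mul_comm, ← kT, Matrix.transpose_apply, kT]

/-- The contracted Bianchi identity. -/
theorem divTrace_ricciOf (hD : ∀ a b u, D a (D b u) = D b (D a u)) (hk : h * k = 1)
    (kT : k.transpose = k) (hΓ : ∀ a b c, Γ a b c = Γ a c b)
    (compat : ∀ c, mder D c h = h * connMatrix Γ c + (connMatrix Γ c).transpose * h)
    (h2 : IsLeftRegular (2 : K)) (e : Fin 3) : divTrace D Γ (k * ricciOf D Γ) e = 0 := by
  set W : Fin 3 → Fin 3 → Matrix (Fin 3) (Fin 3) K :=
    fun c d => curvMatrix D (connMatrix Γ) c d * k with hW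
  have hsw : ∀ c d a b, W d c a b = -W c d a b := fun c d a b => by
    simp only [hW]; rw [curvMatrix_swap, neg_mul, Matrix.neg_apply]
  have has : ∀ c d a b, W c d b a = -W c d a b := fun c d a b => by
    have := congrFun (congrFun (curvMatrix_mul_inv_antisymm hD hk kT compat c d) a) b
    simpa using this
  have hB : ∀ c d a b, D e (W c d a b) + D c (W d e a b) + D d (W e c a b)
      + ∑ f, (Γ a e f * W c d f b + Γ b e f * W c d a f
        + (Γ a c f * W d e f b + Γ b c f * W d e a f)
        + (Γ a d f * W e c f b + Γ b d f * W e c a f)) = 0 := fun c d a b => by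
    have := congrFun (congrFun (curvMatrix_mul_inv_bianchi hD hk compat e c d) a) b
    simp only [Matrix.add_apply, Matrix.mul_apply, mder, Matrix.map_apply, Matrix.transpose_apply,
      Matrix.zero_apply, connMatrix, Matrix.of_apply] at this
    rw [← this]
    simp only [hW, Matrix.mul_apply, Finset.sum_add_distrib]
    simp only [mul_comm]
    abel
  have hR : ∀ b c, (k * ricciOf D Γ) b c = ∑ a, W a c a b := inv_mul_ricciOf hΓ kT
  -- Antisymmetry only gives 2W = 0, which is why 2 has to be cancellable.
  have hself : ∀ c a b, W c c a b = 0 := fun c a b => by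
    have := hsw c c a b
    apply h2
    simp only [mul_zero]
    linear_combination this
  have hself' : ∀ c d a, W c d a a = 0 := fun c d a => by
    have := has c d a a
    apply h2
    simp only [mul_zero]
    linear_combination this
  -- The double contraction a = c, b = d of the second Bianchi identity.
  have sum : ∑ c, ∑ d, (D e (W c d c d) + D c (W d e c d) + D d (W e c c d)
      + ∑ f, (Γ c e f * W c d f d + Γ d e f * W c d c f
        + (Γ c c f * W d e f d + Γ d c f * W d e c f)
        + (Γ c d f * W e c f d + Γ d d f * W e c c f))) = 0 := by
    simp only [hB, Finset.sum_const_zero]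
  unfold divTrace
  simp only [hR]
  -- In components, the antisymmetries and the symmetry of Γ reduce both sides to independent
  -- entries; what remains is a linear consequence of `sum`.
  simp only [Fin.sum_univ_three, map_add] at sum ⊢
  simp only [hself, hself', hsw 0 1, hsw 0 2, hsw 1 2, has _ _ 0 1, has _ _ 0 2, has _ _ 1 2,
    map_neg, map_zero] at sum ⊢
  simp only [hΓ _ 1 0, hΓ _ 2 0, hΓ _ 2 1] at sum ⊢
  fin_cases e
  all_goals
    simp only [hself, hsw 0 1, hsw 0 2, hsw 1 2, map_neg, map_zero, hΓ _ 1 0, hΓ _ 2 0, hΓ _ 2 1,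
      Fin.zero_eta, Fin.mk_one, Fin.reduceFinMk] at sum ⊢
    linear_combination -sum

/-- The Hessian `∂_a ∂_b p - Γ^c_{ab} ∂_c p`. -/
def hessOf (D : Fin 3 → Derivation ℤ K K) (Γ : Fin 3 → Fin 3 → Fin 3 → K) (p : K)
    (a b : Fin 3) : K := D a (D b p) - ∑ c, Γ c a b * D c p

/-- The Laplacian of a scalar. -/
def lapOf (D : Fin 3 → Derivation ℤ K K) (k : Matrix (Fin 3) (Fin 3) K)
    (Γ : Fin 3 → Fin 3 → Fin 3 → K) (p : K) : K := ∑ a, ∑ b, k a b * hessOf D Γ p a b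

/-- The inner product of two gradients. -/
def gradOf (D : Fin 3 → Derivation ℤ K K) (k : Matrix (Fin 3) (Fin 3) K) (p q : K) : K :=
  ∑ a, ∑ b, k a b * (D a p * D b q)

lemma der_inv_apply (dk : ∀ c, mder D c k = -(connMatrix Γ c * k + k * (connMatrix Γ c).transpose))
    (c a b : Fin 3) : D c (k a b) = -∑ d, (Γ a c d * k d b + k a d * Γ b c d) := by
  have := congrFun (congrFun (dk c) a) b
  simp only [mder, Matrix.map_apply, Matrix.neg_apply, Matrix.add_apply, Matrix.mul_apply,
    Matrix.transpose_apply, connMatrix, Matrix.of_apply, ← Finset.sum_add_distrib] at this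
  exact this

/-- The Leibniz rule for the divergence of w dp ⊗ dq. The inverse metric is parallel, so the
derivative falls on dp, on w or on dq, giving the three terms. -/
lemma div_grad_mul_grad
    (dk : ∀ c, mder D c k = -(connMatrix Γ c * k + k * (connMatrix Γ c).transpose))
    (hΓ : ∀ a b c, Γ a b c = Γ a c b) (w p q : K) (M : Matrix (Fin 3) (Fin 3) K)
    (hM : ∀ a e, M a e = ∑ b, k a b * (w * (D b p * D e q))) (e : Fin 3) :
    ∑ a, (D a (M a e) + ∑ f, (Γ a a f * M f e - Γ a e f * M f a))
      = w * lapOf D k Γ p * D e q + gradOf D k w p * D e q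
        + w * ∑ a, ∑ b, k a b * D b p * hessOf D Γ q a e := by
  simp only [hM, lapOf, gradOf, hessOf, map_sum, Derivation.leibniz, smul_eq_mul,
    der_inv_apply dk, hΓ _ e]
  simp only [Fin.sum_univ_three]
  simp only [hΓ _ 1 0, hΓ _ 2 0, hΓ _ 2 1]
  ring

/-- In the trace-adjusted divergence these Hessian terms cancel those produced by
`div_grad_mul_grad`. -/
lemma der_gradOf
    (dk : ∀ c, mder D c k = -(connMatrix Γ c * k + k * (connMatrix Γ c).transpose))
    (hD : ∀ a b u, D a (D b u) = D b (D a u))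
    (hΓ : ∀ a b c, Γ a b c = Γ a c b) (kT : k.transpose = k) (p : K) (e : Fin 3) :
    D e (gradOf D k p p) = 2 * ∑ a, ∑ b, k a b * D b p * hessOf D Γ p a e := by
  have ks : ∀ a b, k a b = k b a := fun a b => congrFun (congrFun kT b) a
  simp only [gradOf, hessOf, map_sum, Derivation.leibniz, smul_eq_mul, der_inv_apply dk, hΓ _ e,
    hD e]
  simp only [Fin.sum_univ_three]
  simp only [ks 1 0, ks 2 0, ks 2 1]
  ring

/-- The divergence of the energy-momentum tensor of the Ernst potential `p + i q`. -/
theorem divTrace_ernst (hD : ∀ a b u, D a (D b u) = D b (D a u)) (hk : h * k = 1)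
    (kT : k.transpose = k) (hΓ : ∀ a b c, Γ a b c = Γ a c b)
    (compat : ∀ c, mder D c h = h * connMatrix Γ c + (connMatrix Γ c).transpose * h)
    {p q v : K} (hv : p * v = 1) (e : Fin 3) :
    divTrace D Γ (k * Matrix.of fun b e => v ^ 2 * (D b p * D e p + D b q * D e q)) e
      = 2 * v ^ 3 * ((p * lapOf D k Γ p - gradOf D k p p + gradOf D k q q) * D e p
        + (p * lapOf D k Γ q - 2 * gradOf D k p q) * D e q) := by
  have dk := fun c => mder_inv hk compat c
  have dv : ∀ a, D a v = -(v ^ 2 * D a p) := fun a => by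
    have h1 : D a (p * v) = 0 := by rw [hv]; simp
    rw [Derivation.leibniz, smul_eq_mul, smul_eq_mul] at h1
    linear_combination v * h1 - D a v * hv
  have dw : ∀ a, D a (v ^ 2) = -2 * v ^ 3 * D a p := fun a => by
    rw [pow_two, Derivation.leibniz, smul_eq_mul, dv]; ring
  set Mp : Matrix (Fin 3) (Fin 3) K := k * Matrix.of fun b e => v ^ 2 * (D b p * D e p) with hMp
  set Mq : Matrix (Fin 3) (Fin 3) K := k * Matrix.of fun b e => v ^ 2 * (D b q * D e q) with hMq
  have hMp' : ∀ a e, Mp a e = ∑ b, k a b * (v ^ 2 * (D b p * D e p)) := fun a e => by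
    simp [hMp, Matrix.mul_apply]
  have hMq' : ∀ a e, Mq a e = ∑ b, k a b * (v ^ 2 * (D b q * D e q)) := fun a e => by
    simp [hMq, Matrix.mul_apply]
  have hsum : (k * Matrix.of fun b e => v ^ 2 * (D b p * D e p + D b q * D e q)) = Mp + Mq := by
    rw [hMp, hMq, ← Matrix.mul_add]
    congr 1
    ext b e
    simp only [Matrix.of_apply, Matrix.add_apply]
    ring
  have e1 := div_grad_mul_grad dk hΓ (v ^ 2) p p Mp hMp' e
  have e2 := div_grad_mul_grad dk hΓ (v ^ 2) q q Mq hMq' e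
  have tr1 : ∑ a, Mp a a = v ^ 2 * gradOf D k p p := by
    simp only [hMp', gradOf, Finset.mul_sum]
    refine Finset.sum_congr rfl fun a _ => Finset.sum_congr rfl fun b _ => ?_
    ring
  have tr2 : ∑ a, Mq a a = v ^ 2 * gradOf D k q q := by
    simp only [hMq', gradOf, Finset.mul_sum]
    refine Finset.sum_congr rfl fun a _ => Finset.sum_congr rfl fun b _ => ?_
    ring
  have g : ∀ r, gradOf D k (v ^ 2) r = -2 * v ^ 3 * gradOf D k p r := fun r => by
    simp only [gradOf, dw, Finset.mul_sum]
    refine Finset.sum_congr rfl fun a _ => Finset.sum_congr rfl fun b _ => ?_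
    ring
  have d1 := der_gradOf dk hD hΓ kT p e
  have d2 := der_gradOf dk hD hΓ kT q e
  have split : divTrace D Γ (Mp + Mq) e
      = 2 * ∑ a, (D a (Mp a e) + ∑ f, (Γ a a f * Mp f e - Γ a e f * Mp f a))
        + 2 * ∑ a, (D a (Mq a e) + ∑ f, (Γ a a f * Mq f e - Γ a e f * Mq f a))
        - (D e (∑ a, Mp a a) + D e (∑ a, Mq a a)) := by
    simp only [divTrace, Matrix.add_apply, map_add, Fin.sum_univ_three]
    ring
  rw [hsum, split, e1, e2, tr1, tr2, Derivation.leibniz, Derivation.leibniz, smul_eq_mul,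
    smul_eq_mul, smul_eq_mul, smul_eq_mul, dw, d1, d2, g, g]
  -- The Hessian terms have cancelled. The relation p v = 1 turns v² into v³ p in front of the
  -- Laplacians, as the Ernst equation requires.
  linear_combination (-2 * v ^ 2 * (lapOf D k Γ p * D e p + lapOf D k Γ q * D e q)) * hv

end Bianchi

end KillingHorizon

end

noncomputable section

namespace KillingHorizon

open scoped Shortcuts

/-! ### A calculus of jets

Near `y = 0` all quantities are homogeneous to leading order, if a quantity with an odd number of
angular indices is given one additional power of `y`. A calculus of jets keeps track of a leading
coefficient and of a variation of order `ν` relative to it; it is used both for the first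
correction to the leading order of a single series (`ν = 1`) and for the leading difference of two
series which agree up to a certain order (`ν ≥ 2`). -/

/-- The parity of an index: angular indices are odd. -/
def par : Fin 3 → Bool := ![false, true, true]

/-- The angular derivatives; the radial derivative does not act on coefficients. -/
def dAng : Fin 3 → Derivation ℝ Ang Ang := ![0, dθ, dφ]

/-- Leading coefficient of a product. -/
def mulB (p q : Bool) (a a' : Ang) : Ang := bif p && q then 0 else a * a'

/-- Variation of a product. -/
def mulD (p q : Bool) (a d a' d' : Ang) : Ang :=
  (bif p && !q then 0 else a * d') + (bif q && !p then 0 else d * a')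

/-- Leading coefficient of a derivative. -/
def pdB (c : Fin 3) (p : Bool) (m : ℤ) (a : Ang) : Ang :=
  if c = 0 then ((m : ℝ) + bif p then 1 else 0) • a else bif p then 0 else dAng c a

/-- Variation of a derivative. -/
def pdD (ν : ℤ) (c : Fin 3) (p : Bool) (m : ℤ) (d : Ang) : Ang :=
  if c = 0 then ((m : ℝ) + ν - bif p then 1 else 0) • d else bif p then dAng c d else 0

/-- A calculus of jets: `J p m u v a d` says that `u` (or the pair `u`, `v`) is of parity `p` and
weight `m`, with leading coefficient `a` and variation `d`. -/
structure JetCalc where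
  ν : ℤ
  J : Bool → ℤ → Ser → Ser → Ang → Ang → Prop
  add : ∀ {p m u v u' v' a d a' d'}, J p m u v a d → J p m u' v' a' d' →
    J p m (u + u') (v + v') (a + a') (d + d')
  smul : ∀ {p m u v a d} (c : ℝ), J p m u v a d → J p m (c • u) (c • v) (c • a) (c • d)
  mul : ∀ {p q m k u v u' v' a d a' d'}, J p m u v a d → J q k u' v' a' d' →
    J (p ^^ q) (m + k) (u * u') (v * v') (mulB p q a a') (mulD p q a d a' d')
  pd : ∀ {p m u v a d} (c : Fin 3), J p m u v a d →
    J (p ^^ par c) (m - 1) (pd c u) (pd c v) (pdB c p m a) (pdD ν c p m d)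
  lower : ∀ {p m u v a d}, J p m u v a d → J p (m - 2) u v 0 0
  zero : ∀ p m, J p m 0 0 0 0
  inv : ∀ {m u v u' v' a d a'}, J false m u v a d → u * u' = 1 → v * v' = 1 → a * a' = 1 →
    J false (-m) u' v' a' (-(a' ^ 2 * d))

lemma two_coeff_mean (u v : Ser) (k : ℤ) :
    ((1 / 2 : ℝ) • (u + v)).coeff k = (1 / 2 : ℝ) • (u.coeff k + v.coeff k) := rfl

/-- An exact product rule for differences, in which the other factor enters through its mean. This
is why pair jets record the leading coefficient of the mean: for n = 2 the two odd series may
already differ at leading order. -/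
lemma sub_mul_eq_mean (u v u' v' : Ser) : v * v' - u * u'
    = ((1 / 2 : ℝ) • (u + v)) * (v' - u') + (v - u) * ((1 / 2 : ℝ) • (u' + v')) := by
  have : ((1 / 2 : ℝ) • (u + v)) * (v' - u') + (v - u) * ((1 / 2 : ℝ) • (u' + v'))
      = (1 / 2 : ℝ) • ((u + v) * (v' - u') + (v - u) * (u' + v')) := by
    rw [smul_mul_assoc, mul_smul_comm, smul_add]
  rw [this, show (u + v) * (v' - u') + (v - u) * (u' + v') = (v * v' - u * u') + (v * v' - u * u')
    by ring, ← two_smul ℝ (v * v' - u * u'), smul_smul]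
  norm_num

lemma ord_of_mul_eq_one {m : ℤ} {u u' : Ser} {a a' : Ang} (hu : Ord m u) (ha : u.coeff m = a)
    (h : u * u' = 1) (haa : a * a' = 1) : Ord (-m) u' ∧ u'.coeff (-m) = a' := by
  subst ha
  obtain ⟨w, hw, hw1, hw2⟩ := hu.exists_inverse haa
  have : u' = w := by rw [← ringInverse_eq h, ringInverse_eq hw]
  subst this
  exact ⟨hw1, hw2⟩

/-! ### Jets of pairs of series. -/

section Pair

/-- Jets of pairs of series which agree up to a relative order `n`; `o` is the parity as a
number. -/
def PairJet (n : ℤ) (p : Bool) (m : ℤ) (u v : Ser) (a d : Ang) : Prop :=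
  let o : ℤ := bif p then 1 else 0
  Ord (m + o) u ∧ Ord (m + o) v ∧ ((1 / 2 : ℝ) • (u + v)).coeff (m + o) = a ∧
    Ord (m + n - o) (v - u) ∧ (v - u).coeff (m + n - o) = d

lemma PairJet.mean {n m : ℤ} {p : Bool} {u v : Ser} {a d : Ang} (h : PairJet n p m u v a d) :
    Ord (m + bif p then 1 else 0) ((1 / 2 : ℝ) • (u + v)) := (h.1.add h.2.1).smul _

/-- An odd factor has its leading term one order higher and its variation one order lower than an
even one; counting orders decides which products survive. The mean of the products differs from the
product of the means by a quarter of the product of the differences. That term is negligible because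
n ≥ 2. -/
lemma PairJet.mul {n : ℤ} (hn : 2 ≤ n) {p q : Bool} {m k : ℤ} {u v u' v' : Ser}
    {a d a' d' : Ang} (h : PairJet n p m u v a d) (h' : PairJet n q k u' v' a' d') :
    PairJet n (p ^^ q) (m + k) (u * u') (v * v') (mulB p q a a') (mulD p q a d a' d') := by
  have hM := h.mean
  have hM' := h'.mean
  obtain ⟨hu, hv, ha, hd, hd'⟩ := h
  obtain ⟨hu', hv', ha', he, he'⟩ := h'
  have mm : (1 / 2 : ℝ) • (u * u' + v * v')
      = ((1 / 2 : ℝ) • (u + v)) * ((1 / 2 : ℝ) • (u' + v'))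
        + (1 / 4 : ℝ) • ((v - u) * (v' - u')) := by
    rw [smul_mul_smul_comm, show ((1 : ℝ) / 2 * (1 / 2)) = 1 / 4 by norm_num, ← smul_add,
      show (u + v) * (u' + v') + (v - u) * (v' - u')
        = (u * u' + v * v') + (u * u' + v * v') by ring,
      ← two_smul ℝ (u * u' + v * v'), smul_smul]
    norm_num
  have dd := sub_mul_eq_mean u v u' v'
  have c1 := hM.coeff_mul hM'
  have c2 := hM.coeff_mul he
  have c3 := hd.coeff_mul hM'
  rw [ha, ha'] at c1
  rw [ha, he'] at c2
  rw [hd', ha'] at c3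
  have o1 := hM.mul hM'
  have o2 := hM.mul he
  have o3 := hd.mul hM'
  have o4 := hd.mul he
  refine ⟨(hu.mul hu').mono ?_, (hv.mul hv').mono ?_, ?_, ?_, ?_⟩
  · cases p <;> cases q <;> simp; omega
  · cases p <;> cases q <;> simp; omega
  · rw [mm, HahnSeries.coeff_add, HahnSeries.coeff_smul]
    cases p <;> cases q <;>
      simp only [cond_true, cond_false, add_zero, sub_zero, Bool.xor_false,
        Bool.xor_true, Bool.not_true, Bool.not_false, mulB, Bool.and_true, Bool.and_false] at *
    · rw [c1, o4 _ (by omega), smul_zero, add_zero]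
    · rw [o4 _ (by omega), smul_zero, add_zero, ← c1]
      congr 1; ring
    · rw [o4 _ (by omega), smul_zero, add_zero, ← c1]
      congr 1; ring
    · rw [o4 _ (by omega), smul_zero, add_zero, o1 _ (by omega)]
  · rw [dd]
    refine (o2.mono ?_).add (o3.mono ?_)
    · cases p <;> cases q <;> simp <;> omega
    · cases p <;> cases q <;> simp <;> omega
  · rw [dd, HahnSeries.coeff_add]
    cases p <;> cases q <;>
      simp only [cond_true, cond_false, add_zero, sub_zero, Bool.xor_false,
        Bool.xor_true, Bool.not_true, Bool.not_false, mulD, Bool.and_true, Bool.and_false,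
        zero_add] at *
    · rw [← c2, ← c3, ← add_assoc, show m + n + k = m + k + n by ring]
    · rw [← c2, o3 _ (by omega), add_zero, show m + (k + n - 1) = m + k + n - 1 by ring]
    · rw [← c3, o2 _ (by omega), zero_add]; congr 2; ring
    · rw [← c2, ← c3, show m + 1 + (k + n - 1) = m + k + n by ring,
        show m + n - 1 + (k + 1) = m + k + n by ring]

/-- An angular derivative flips the parity. On an even pair it keeps the leading coefficient and
pushes the variation beyond the recorded order; on an odd pair it does the opposite. -/
lemma PairJet.pd {n : ℤ} {p : Bool} {m : ℤ} {u v : Ser} {a d : Ang} (c : Fin 3)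
    (h : PairJet n p m u v a d) : PairJet n (p ^^ par c) (m - 1) (pd c u) (pd c v)
      (pdB c p m a) (pdD n c p m d) := by
  obtain ⟨hu, hv, ha, hd, hd'⟩ := h
  have ang : ∀ c : Fin 3, c ≠ 0 → par c = true →
      (∀ (w : Ser) k, (KillingHorizon.pd c w).coeff k = dAng c (w.coeff k)) →
      PairJet n (p ^^ par c) (m - 1) (KillingHorizon.pd c u) (KillingHorizon.pd c v)
      (pdB c p m a) (pdD n c p m d) := by
    intro c hc hp hco
    have hmean : (1 / 2 : ℝ) • (KillingHorizon.pd c u + KillingHorizon.pd c v)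
        = KillingHorizon.pd c ((1 / 2 : ℝ) • (u + v)) := by rw [pd_smul, pd_add]
    rw [PairJet, hmean, ← pd_sub, hp, hco, hco]
    have o1 := (hu.add hv).smul (1 / 2)
    cases p <;> simp only [Bool.false_xor, Bool.true_xor, Bool.not_true, cond_true, cond_false,
      pdB, pdD, if_neg hc, add_zero, sub_zero] at *
    · exact ⟨(hu.pd_ang hc).mono (by omega), (hv.pd_ang hc).mono (by omega),
        by rw [show m - 1 + 1 = m by ring, ha], (hd.pd_ang hc).mono (by omega),
        by rw [hd _ (by omega), map_zero]⟩
    · refine ⟨(hu.pd_ang hc).mono (by omega), (hv.pd_ang hc).mono (by omega), ?_,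
        (hd.pd_ang hc).mono (by omega), by rw [show m - 1 + n = m + n - 1 by ring, hd']⟩
      rw [o1 _ (by omega), map_zero]
  have h0 : PairJet n p (m - 1) (KillingHorizon.pd 0 u) (KillingHorizon.pd 0 v)
      (pdB 0 p m a) (pdD n 0 p m d) := by
    have hmean : (1 / 2 : ℝ) • (KillingHorizon.pd 0 u + KillingHorizon.pd 0 v)
        = KillingHorizon.pd 0 ((1 / 2 : ℝ) • (u + v)) := by rw [pd_smul, pd_add]
    rw [PairJet, hmean, ← pd_sub, pd_zero_coeff, pd_zero_coeff, ← ha, ← hd']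
    simp only [pdB, pdD, if_true]
    refine ⟨hu.pd_zero.mono ?_, hv.pd_zero.mono ?_, ?_, hd.pd_zero.mono ?_, ?_⟩
    · omega
    · omega
    · rw [show m - 1 + (bif p then (1 : ℤ) else 0) + 1 = m + bif p then (1 : ℤ) else 0 by ring]
      congr 1
      cases p <;> push_cast <;> simp
    · omega
    · rw [show m - 1 + n - (bif p then (1 : ℤ) else 0) + 1 = m + n - bif p then (1 : ℤ) else 0
        by ring]
      congr 1
      cases p <;> push_cast <;> simp <;> ring
  fin_cases c
  · change PairJet n (p ^^ false) _ _ _ _ _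
    rw [Bool.xor_false]; exact h0
  · exact ang 1 (by simp) rfl (fun _ _ => rfl)
  · exact ang 2 (by simp) rfl (fun _ _ => rfl)

/-- The calculus of jets of pairs of series agreeing up to a relative order `n ≥ 2`. -/
def pairCalc (n : ℤ) (hn : 2 ≤ n) : JetCalc where
  ν := n
  J := PairJet n
  add := by
    rintro p m u v u' v' a d a' d' ⟨h1, h2, h3, h4, h5⟩ ⟨h1', h2', h3', h4', h5'⟩
    refine ⟨h1.add h1', h2.add h2', ?_, ?_, ?_⟩
    · rw [show u + u' + (v + v') = (u + v) + (u' + v') by abel, smul_add, HahnSeries.coeff_add,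
        h3, h3']
    · rw [show v + v' - (u + u') = (v - u) + (v' - u') by abel]; exact h4.add h4'
    · rw [show v + v' - (u + u') = (v - u) + (v' - u') by abel, HahnSeries.coeff_add, h5, h5']
  smul := by
    rintro p m u v a d c ⟨h1, h2, h3, h4, h5⟩
    refine ⟨h1.smul c, h2.smul c, ?_, ?_, ?_⟩
    · rw [← smul_add, smul_comm, HahnSeries.coeff_smul, h3]
    · rw [← smul_sub]; exact h4.smul c
    · rw [← smul_sub, HahnSeries.coeff_smul, h5]
  mul := PairJet.mul hn
  pd := fun c h => h.pd c
  lower := by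
    rintro p m u v a d ⟨h1, h2, h3, h4, h5⟩
    refine ⟨h1.mono (by omega), h2.mono (by omega), ?_, h4.mono (by omega), h4 _ (by omega)⟩
    exact ((h1.add h2).smul _) _ (by omega)
  zero := fun p m => by
    refine ⟨Ord.zero _, Ord.zero _, ?_, ?_, ?_⟩
    · rw [add_zero, smul_zero]; rfl
    · rw [sub_zero]; exact Ord.zero _
    · rw [sub_zero]; rfl
  inv := by
    rintro m u v u' v' a d a' ⟨h1, h2, h3, h4, h5⟩ hu hv haa
    simp only [cond_false, add_zero, sub_zero] at *
    have e : v.coeff m = u.coeff m := by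
      have := h4 m (by omega)
      rwa [HahnSeries.coeff_sub, sub_eq_zero] at this
    have hau : u.coeff m = a := by
      rw [two_coeff_mean, e, ← two_smul ℝ, smul_smul] at h3
      norm_num at h3; exact h3
    obtain ⟨i1, i2⟩ := ord_of_mul_eq_one h1 hau hu haa
    obtain ⟨j1, j2⟩ := ord_of_mul_eq_one h2 (e.trans hau) hv haa
    have hd : v' - u' = -((u' * v') * (v - u)) := by
      linear_combination u' * hv - v' * hu
    have o := (i1.mul j1).mul h4
    have c := (i1.mul j1).coeff_mul h4
    rw [i1.coeff_mul j1, i2, j2, h5] at c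
    refine ⟨by simpa using i1, by simpa using j1, ?_, ?_, ?_⟩
    · simp only [cond_false, add_zero]
      rw [two_coeff_mean, i2, j2, ← two_smul ℝ, smul_smul]
      norm_num
    · rw [hd]; refine (o.mono ?_).neg; simp only [cond_false]; omega
    · rw [hd, HahnSeries.coeff_neg, pow_two, ← c]
      simp only [cond_false]
      congr 2; ring

end Pair

/-- Jets of a single series: the two leading coefficients of an even series, and the leading
coefficient of an odd one. -/
def SingleJet (p : Bool) (m : ℤ) (u _v : Ser) (a d : Ang) : Prop :=
  Ord (m + bif p then 1 else 0) u ∧ u.coeff (m + bif p then 1 else 0) = a ∧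
    (bif p then 0 else u.coeff (m + 1)) = d

/-- The calculus of jets of single series. -/
def singleCalc : JetCalc where
  ν := 1
  J := SingleJet
  add := by
    rintro p m u v u' v' a d a' d' ⟨h1, h2, h3⟩ ⟨h1', h2', h3'⟩
    refine ⟨h1.add h1', by rw [HahnSeries.coeff_add, h2, h2'], ?_⟩
    rw [← h3, ← h3', HahnSeries.coeff_add]
    cases p <;> simp
  smul := by
    rintro p m u v a d c ⟨h1, h2, h3⟩
    refine ⟨h1.smul c, by rw [HahnSeries.coeff_smul, h2], ?_⟩
    rw [← h3, HahnSeries.coeff_smul]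
    cases p <;> simp
  mul := by
    rintro p q m k u v u' v' a d a' d' ⟨h1, h2, h3⟩ ⟨h1', h2', h3'⟩
    have o := h1.mul h1'
    have c := h1.coeff_mul h1'
    have c' := h1.coeff_mul_succ h1'
    rw [h2, h2'] at c c'
    cases p <;> cases q <;> refine ⟨o.mono ?_, ?_, ?_⟩ <;>
      simp only [cond_true, cond_false, add_zero, Bool.xor_false,
        Bool.xor_true, Bool.not_true, Bool.not_false, mulD, mulB, Bool.and_true, Bool.and_false,
        zero_add] at *
    · exact le_rfl
    · exact c
    · rw [c', h3, h3']
    · omega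
    · rw [← c]; congr 1; ring
    · rw [← h3', mul_zero]
    · omega
    · rw [← c]; congr 1; ring
    · rw [← h3, zero_mul]
    · omega
    · exact o _ (by omega)
    · rw [← h3, ← h3', mul_zero, zero_mul, add_zero, o _ (by omega)]
  pd := by
    rintro p m u v a d c ⟨h1, h2, h3⟩
    have ang : ∀ c : Fin 3, c ≠ 0 → par c = true →
        (∀ (w : Ser) k, (pd c w).coeff k = dAng c (w.coeff k)) →
        SingleJet (p ^^ par c) (m - 1) (pd c u) (pd c v) (pdB c p m a) (pdD 1 c p m d) := by
      intro c hc hp hco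
      rw [SingleJet, hp, hco, hco]
      cases p <;> simp only [Bool.false_xor, Bool.true_xor, Bool.not_true, cond_true, cond_false,
        pdB, pdD, if_neg hc, add_zero] at *
      · exact ⟨(h1.pd_ang hc).mono (by omega), by rw [show m - 1 + 1 = m by ring, h2], trivial⟩
      · exact ⟨(h1.pd_ang hc).mono (by omega), by rw [h1 _ (by omega), map_zero],
          by rw [← h3, h1 _ (by omega), map_zero]⟩
    fin_cases c
    · change SingleJet (p ^^ false) (m - 1) (pd 0 u) (pd 0 v) (pdB 0 p m a) (pdD 1 0 p m d)
      rw [Bool.xor_false, SingleJet, pd_zero_coeff, pd_zero_coeff]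
      refine ⟨h1.pd_zero.mono (by omega), ?_, ?_⟩
      · rw [show m - 1 + (bif p then (1 : ℤ) else 0) + 1 = m + bif p then (1 : ℤ) else 0 by ring,
          h2]
        simp only [pdB, if_true]
        congr 1
        cases p <;> push_cast <;> simp
      · rw [show m - 1 + 1 + 1 = m + 1 by ring]
        simp only [pdD, if_true]
        cases p <;> simp only [cond_true, cond_false] at *
        · rw [h3]; congr 1; push_cast; ring
        · rw [← h3, smul_zero]
    · exact ang 1 (by simp) rfl (fun _ _ => rfl)
    · exact ang 2 (by simp) rfl (fun _ _ => rfl)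
  lower := by
    rintro p m u v a d ⟨h1, h2, h3⟩
    refine ⟨h1.mono (by omega), h1 _ (by omega), ?_⟩
    cases p <;> simp only [cond_true, cond_false, add_zero] at *
    exact h1 _ (by omega)
  zero := fun p m => ⟨Ord.zero _, rfl, by cases p <;> rfl⟩
  inv := by
    rintro m u v u' v' a d a' ⟨h1, h2, h3⟩ hu hv haa
    simp only [cond_false, add_zero] at *
    obtain ⟨i1, i2⟩ := ord_of_mul_eq_one h1 h2 hu haa
    refine ⟨by simpa using i1, by simpa using i2, ?_⟩
    -- The coefficient of y in u u' = 1 vanishes, which determines the second coefficient of the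
    -- inverse.
    have c := h1.coeff_mul_succ i1
    rw [hu, h2, i2, h3, show m + -m + 1 = 1 by ring] at c
    have c1 : (1 : Ser).coeff 1 = 0 := HahnSeries.coeff_single_of_ne (by omega)
    rw [c1] at c
    simp only [cond_false]
    linear_combination (-a') * c - u'.coeff (-m + 1) * haa

end KillingHorizon

end

noncomputable section

namespace KillingHorizon

open scoped Shortcuts

/-! ### Jets of the geometry -/

/-- The constituents of a metric in the form used in the ansatz: the squared lapse `N`, the
components `s`, `q` of the angular metric, the covariant shift `B`, `C`, and inverses. -/
structure Geom where
  (N s q B C n i j : Ser)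
  hn : N * n = 1
  hi : s * i = 1
  hj : q * j = 1

/-- The metric. -/
def Geom.metric (g : Geom) : Matrix (Fin 3) (Fin 3) Ser :=
  !![g.N + g.B ^ 2 * g.i + g.C ^ 2 * g.j, g.B, g.C; g.B, g.s, 0; g.C, 0, g.q]

/-- The inverse metric. -/
def Geom.inv (g : Geom) : Matrix (Fin 3) (Fin 3) Ser :=
  !![g.n, (-1 : ℝ) • (g.B * g.i * g.n), (-1 : ℝ) • (g.C * g.j * g.n);
     (-1 : ℝ) • (g.B * g.i * g.n), g.i + g.B ^ 2 * g.i ^ 2 * g.n, g.B * g.C * g.i * g.j * g.n;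
     (-1 : ℝ) • (g.C * g.j * g.n), g.B * g.C * g.i * g.j * g.n, g.j + g.C ^ 2 * g.j ^ 2 * g.n]

lemma neg_one_smul' (u : Ser) : (-1 : ℝ) • u = -u := by
  rw [smul_eq_cst_mul, map_neg, map_one, neg_one_mul]

lemma Geom.metric_mul_inv (g : Geom) : g.metric * g.inv = 1 := by
  obtain ⟨N, s, q, B, C, n, i, j, hn, hi, hj⟩ := g
  refine Matrix.ext fun a b => ?_
  fin_cases a <;> fin_cases b <;>
    simp only [Geom.metric, Geom.inv, Matrix.mul_apply, Fin.sum_univ_three, neg_one_smul',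
      Matrix.of_apply, Matrix.cons_val', Matrix.cons_val_fin_one,
      Fin.zero_eta, Fin.mk_one, Fin.reduceFinMk, Matrix.cons_val, Matrix.one_apply_eq]
  · linear_combination hn
  · rw [Matrix.one_apply_ne (by decide)]
    linear_combination (-B * i) * hn
  · rw [Matrix.one_apply_ne (by decide)]
    linear_combination (-C * j) * hn
  · rw [Matrix.one_apply_ne (by decide)]
    linear_combination (-B * n) * hi
  · linear_combination (1 + B ^ 2 * i * n) * hi
  · rw [Matrix.one_apply_ne (by decide)]
    linear_combination (B * C * j * n) * hi
  · rw [Matrix.one_apply_ne (by decide)]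
    linear_combination (-C * n) * hj
  · rw [Matrix.one_apply_ne (by decide)]
    linear_combination (B * C * i * n) * hj
  · linear_combination (1 + C ^ 2 * j * n) * hj

lemma Geom.metric_inv (g : Geom) : g.metric⁻¹ = g.inv :=
  Matrix.inv_eq_right_inv g.metric_mul_inv

/-- Values of the jets of the constituents of a metric. -/
structure GVal where
  (N s q n i j T P dN ds dq τ π : Ang)
  hn : N * n = 1
  hi : s * i = 1
  hj : q * j = 1

/-- The constituents of a metric have the jets `v`. -/
structure GeomJet (𝒞 : JetCalc) (g g' : Geom) (v : GVal) : Prop where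
  N : 𝒞.J false 2 g.N g'.N v.N v.dN
  s : 𝒞.J false 2 g.s g'.s v.s v.ds
  q : 𝒞.J false 2 g.q g'.q v.q v.dq
  B : 𝒞.J true 2 g.B g'.B v.T v.τ
  C : 𝒞.J true 2 g.C g'.C v.P v.π

namespace GVal

variable (v : GVal)

/-- Leading coefficients of the metric. -/
def hB : Matrix (Fin 3) (Fin 3) Ang := !![v.N, v.T, v.P; v.T, v.s, 0; v.P, 0, v.q]

/-- Variations of the metric. -/
def hD : Matrix (Fin 3) (Fin 3) Ang :=
  !![v.dN + (2 : ℝ) • (v.T * v.τ * v.i) + (2 : ℝ) • (v.P * v.π * v.j), v.τ, v.π;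
     v.τ, v.ds, 0; v.π, 0, v.dq]

/-- Leading coefficients of the inverse metric. -/
def kB : Matrix (Fin 3) (Fin 3) Ang :=
  !![v.n, -(v.T * v.i * v.n), -(v.P * v.j * v.n);
     -(v.T * v.i * v.n), v.i, 0; -(v.P * v.j * v.n), 0, v.j]

/-- Variations of the inverse metric. -/
def kD : Matrix (Fin 3) (Fin 3) Ang :=
  !![-(v.n ^ 2 * v.dN), -(v.τ * v.i * v.n), -(v.π * v.j * v.n);
     -(v.τ * v.i * v.n), -(v.i ^ 2 * v.ds) + (2 : ℝ) • (v.T * v.τ * v.i ^ 2 * v.n),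
       (v.T * v.π + v.P * v.τ) * v.i * v.j * v.n;
     -(v.π * v.j * v.n), (v.T * v.π + v.P * v.τ) * v.i * v.j * v.n,
       -(v.j ^ 2 * v.dq) + (2 : ℝ) • (v.P * v.π * v.j ^ 2 * v.n)]

end GVal

lemma JetCalc.congr (𝒞 : JetCalc) {p m u v a d p' m' u' v' a' d'} (h : 𝒞.J p m u v a d)
    (hp : p = p') (hm : m = m') (hu : u = u') (hv : v = v') (ha : a = a') (hd : d = d') :
    𝒞.J p' m' u' v' a' d' := by
  subst hp hm hu hv ha hd; exact h

lemma JetCalc.sub (𝒞 : JetCalc) {p m u v u' v' a d a' d'} (h : 𝒞.J p m u v a d)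
    (h' : 𝒞.J p m u' v' a' d') : 𝒞.J p m (u - u') (v - v') (a - a') (d - d') := by
  refine 𝒞.congr (𝒞.add h (𝒞.smul (-1) h')) rfl rfl ?_ ?_ ?_ ?_
  · rw [neg_one_smul']; ring
  · rw [neg_one_smul']; ring
  · rw [neg_one_smul, sub_eq_add_neg]
  · rw [neg_one_smul, sub_eq_add_neg]

lemma JetCalc.sum (𝒞 : JetCalc) {p m} {u v : Fin 3 → Ser} {a d : Fin 3 → Ang}
    (h : ∀ k, 𝒞.J p m (u k) (v k) (a k) (d k)) :
    𝒞.J p m (∑ k, u k) (∑ k, v k) (∑ k, a k) (∑ k, d k) := by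
  simp only [Fin.sum_univ_three]
  exact 𝒞.add (𝒞.add (h 0) (h 1)) (h 2)

variable {𝒞 : JetCalc} {g g' : Geom} {v : GVal}

lemma GeomJet.n (G : GeomJet 𝒞 g g' v) : 𝒞.J false (-2) g.n g'.n v.n (-(v.n ^ 2 * v.dN)) :=
  𝒞.inv G.N g.hn g'.hn v.hn

lemma GeomJet.i (G : GeomJet 𝒞 g g' v) : 𝒞.J false (-2) g.i g'.i v.i (-(v.i ^ 2 * v.ds)) :=
  𝒞.inv G.s g.hi g'.hi v.hi

lemma GeomJet.j (G : GeomJet 𝒞 g g' v) : 𝒞.J false (-2) g.j g'.j v.j (-(v.j ^ 2 * v.dq)) :=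
  𝒞.inv G.q g.hj g'.hj v.hj

/-- The quadratic shift terms of the rr-component are products of two odd quantities. They are too
small for the leading coefficient but contribute to the variation. -/
lemma GeomJet.metric (G : GeomJet 𝒞 g g' v) (a b : Fin 3) :
    𝒞.J (par a ^^ par b) 2 (g.metric a b) (g'.metric a b) (v.hB a b) (v.hD a b) := by
  have h00 := 𝒞.add (𝒞.add G.N (𝒞.mul (𝒞.mul G.B G.B) G.i)) (𝒞.mul (𝒞.mul G.C G.C) G.j)
  fin_cases a <;> fin_cases b
  · refine 𝒞.congr h00 rfl rfl ?_ ?_ ?_ ?_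
    · simp [Geom.metric]; ring
    · simp [Geom.metric]; ring
    · simp [GVal.hB, mulB]
    · simp [GVal.hD, mulB, mulD, two_smul]; ring
  · exact G.B
  · exact G.C
  · exact G.B
  · exact G.s
  · exact 𝒞.zero _ _
  · exact G.C
  · exact 𝒞.zero _ _
  · exact G.q

lemma GeomJet.inv (G : GeomJet 𝒞 g g' v) (a b : Fin 3) :
    𝒞.J (par a ^^ par b) (-2) (g.inv a b) (g'.inv a b) (v.kB a b) (v.kD a b) := by
  have h01 := 𝒞.smul (-1) (𝒞.mul (𝒞.mul G.B G.i) G.n)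
  have h02 := 𝒞.smul (-1) (𝒞.mul (𝒞.mul G.C G.j) G.n)
  have h11 := 𝒞.add G.i (𝒞.mul (𝒞.mul (𝒞.mul G.B G.B) (𝒞.mul G.i G.i)) G.n)
  have h22 := 𝒞.add G.j (𝒞.mul (𝒞.mul (𝒞.mul G.C G.C) (𝒞.mul G.j G.j)) G.n)
  have h12 := 𝒞.mul (𝒞.mul (𝒞.mul (𝒞.mul G.B G.C) G.i) G.j) G.n
  have e01 := 𝒞.congr (p' := true) (m' := -2) (u' := g.inv 0 1) (v' := g'.inv 0 1)
    (a' := v.kB 0 1) (d' := v.kD 0 1) h01 rfl rfl rfl rfl (by simp [GVal.kB, mulB])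
    (by simp [GVal.kD, mulD])
  have e02 := 𝒞.congr (p' := true) (m' := -2) (u' := g.inv 0 2) (v' := g'.inv 0 2)
    (a' := v.kB 0 2) (d' := v.kD 0 2) h02 rfl rfl rfl rfl (by simp [GVal.kB, mulB])
    (by simp [GVal.kD, mulD])
  have e12 := 𝒞.congr (p' := false) (m' := -2) (u' := g.inv 1 2) (v' := g'.inv 1 2)
    (a' := v.kB 1 2) (d' := v.kD 1 2) h12 rfl rfl rfl rfl (by simp [GVal.kB, mulB])
    (by simp [GVal.kD, mulB, mulD]; ring)
  fin_cases a <;> fin_cases b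
  · exact G.n
  · exact e01
  · exact e02
  · exact e01
  · refine 𝒞.congr h11 rfl rfl ?_ ?_ ?_ ?_
    · simp [Geom.inv]; ring
    · simp [Geom.inv]; ring
    · simp [GVal.kB, mulB]
    · simp [GVal.kD, mulB, mulD, two_smul]; ring
  · exact e12
  · exact e02
  · exact e12
  · refine 𝒞.congr h22 rfl rfl ?_ ?_ ?_ ?_
    · simp [Geom.inv]; ring
    · simp [Geom.inv]; ring
    · simp [GVal.kB, mulB]
    · simp [GVal.kD, mulB, mulD, two_smul]; ring

/-! ### Jets of the Christoffel symbols -/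

section Values

variable (ν : ℤ) (v : GVal)

/-- Leading coefficients of twice the Christoffel symbols with lower indices. -/
def lowB (d b c : Fin 3) : Ang :=
  pdB b (par d ^^ par c) 2 (v.hB d c) + pdB c (par d ^^ par b) 2 (v.hB d b)
    - pdB d (par b ^^ par c) 2 (v.hB b c)

/-- Variations of twice the Christoffel symbols with lower indices. -/
def lowD (d b c : Fin 3) : Ang :=
  pdD ν b (par d ^^ par c) 2 (v.hD d c) + pdD ν c (par d ^^ par b) 2 (v.hD d b)
    - pdD ν d (par b ^^ par c) 2 (v.hD b c)

/-- Leading coefficients of the Christoffel symbols. -/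
def gamB (a b c : Fin 3) : Ang :=
  ∑ d, (1 / 2 : ℝ) • mulB (par a ^^ par d) (par d ^^ (par b ^^ par c)) (v.kB a d) (lowB v d b c)

/-- Variations of the Christoffel symbols. -/
def gamD (a b c : Fin 3) : Ang :=
  ∑ d, (1 / 2 : ℝ) • mulD (par a ^^ par d) (par d ^^ (par b ^^ par c)) (v.kB a d) (v.kD a d)
    (lowB v d b c) (lowD ν v d b c)

end Values

lemma christoffel_geom (g : Geom) (a b c : Fin 3) : christoffel g.metric a b c
    = ∑ d, (1 / 2 : ℝ) • (g.inv a d * (pd b (g.metric d c) + pd c (g.metric d b)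
      - pd d (g.metric b c))) := by
  rw [christoffel, g.metric_inv]

lemma GeomJet.christoffel (G : GeomJet 𝒞 g g' v) (a b c : Fin 3) :
    𝒞.J (par a ^^ (par b ^^ par c)) (-1) (christoffel g.metric a b c)
      (christoffel g'.metric a b c) (gamB v a b c) (gamD 𝒞.ν v a b c) := by
  rw [christoffel_geom, christoffel_geom]
  refine 𝒞.sum fun d => 𝒞.smul _ ?_
  have l1 := 𝒞.pd b (G.metric d c)
  have l2 := 𝒞.pd c (G.metric d b)
  have l3 := 𝒞.pd d (G.metric b c)
  have e2 : (par d ^^ par c ^^ par b) = (par d ^^ (par b ^^ par c)) := by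
    cases par d <;> cases par c <;> cases par b <;> rfl
  have e1 : (par d ^^ par b ^^ par c) = (par d ^^ (par b ^^ par c)) := by
    cases par d <;> cases par c <;> cases par b <;> rfl
  have e3 : (par b ^^ par c ^^ par d) = (par d ^^ (par b ^^ par c)) := by
    cases par d <;> cases par c <;> cases par b <;> rfl
  rw [e1] at l2
  rw [e2] at l1
  rw [e3] at l3
  have l := 𝒞.mul (G.inv a d) (𝒞.sub (𝒞.add l1 l2) l3)
  refine 𝒞.congr l ?_ (by norm_num) rfl rfl rfl rfl
  cases par a <;> cases par b <;> cases par c <;> cases par d <;> rfl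

end KillingHorizon

end

noncomputable section

namespace KillingHorizon

open scoped Shortcuts

/-! ### Closed formulas for the jets of the Christoffel symbols. -/

section Values

variable (ν : ℤ) (v : GVal)

lemma eval_inv {a b : Ang} (h : a * b = 1) (x : Angles) : a.1 x ≠ 0 ∧ b.1 x = (a.1 x)⁻¹ := by
  have h1 : a.1 x * b.1 x = 1 := congrFun (congrArg Subtype.val h) x
  have h2 : a.1 x ≠ 0 := left_ne_zero_of_mul_eq_one h1
  exact ⟨h2, eq_inv_of_mul_eq_one_right h1⟩

/-- Table of the leading coefficients of the Christoffel symbols. -/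
def chrB : Fin 3 → Matrix (Fin 3) (Fin 3) Ang :=
  let N₁ := (1 / 2 : ℝ) • dθ v.N
  let N₂ := (1 / 2 : ℝ) • dφ v.N
  let s₁ := (1 / 2 : ℝ) • dθ v.s
  let s₂ := (1 / 2 : ℝ) • dφ v.s
  let q₁ := (1 / 2 : ℝ) • dθ v.q
  let q₂ := (1 / 2 : ℝ) • dφ v.q
  ![!![1, v.n * (N₁ - v.T), v.n * (N₂ - v.P);
       v.n * (N₁ - v.T), -(v.n * v.s), 0;
       v.n * (N₂ - v.P), 0, -(v.n * v.q)],
    !![v.i * ((2 : ℝ) • v.T - N₁), 1, 0;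
       1, v.n * v.T + v.i * s₁, v.i * s₂;
       0, v.i * s₂, v.i * (v.n * v.T * v.q - q₁)],
    !![v.j * ((2 : ℝ) • v.P - N₂), 0, 1;
       0, v.j * (v.n * v.P * v.s - s₂), v.j * q₁;
       1, v.j * q₁, v.n * v.P + v.j * q₂]]

/-- Table of the variations of the Christoffel symbols. -/
def chrD : Fin 3 → Matrix (Fin 3) (Fin 3) Ang :=
  let N₁ := (1 / 2 : ℝ) • dθ v.N
  let N₂ := (1 / 2 : ℝ) • dφ v.N
  let s₁ := (1 / 2 : ℝ) • dθ v.s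
  let s₂ := (1 / 2 : ℝ) • dφ v.s
  let q₁ := (1 / 2 : ℝ) • dθ v.q
  let q₂ := (1 / 2 : ℝ) • dφ v.q
  let k : ℝ := (ν + 2) / 2
  let w := v.n * ((1 / 2 : ℝ) • (dθ v.π + dφ v.τ) - v.τ * v.i * s₂ - v.π * v.j * q₁)
  let r := (1 / 2 : ℝ) • (dφ v.τ - dθ v.π)
  let m := v.n * (v.T * v.π + v.P * v.τ)
  ![!![v.n * (((ν : ℝ) / 2) • v.dN - (2 : ℝ) • (v.T * v.τ * v.i) - (2 : ℝ) • (v.P * v.π * v.j)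
          + v.τ * v.i * N₁ + v.π * v.j * N₂), -(v.n * v.τ), -(v.n * v.π);
       -(v.n * v.τ),
        v.n * (dθ v.τ - k • v.ds + v.n * v.s * v.dN - v.τ * v.i * s₁ + v.π * v.j * s₂), w;
       -(v.n * v.π), w,
        v.n * (dφ v.π - k • v.dq + v.n * v.q * v.dN - v.π * v.j * q₂ + v.τ * v.i * q₁)],
    !![(ν : ℝ) • (v.τ * v.i),
        v.i * (((ν : ℝ) / 2) • v.ds - v.n * v.τ * N₁ + (2 : ℝ) • (v.n * v.T * v.τ)),
        v.i * (r - v.n * v.τ * N₂ + m);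
       v.i * (((ν : ℝ) / 2) • v.ds - v.n * v.τ * N₁ + (2 : ℝ) • (v.n * v.T * v.τ)),
        v.n * v.τ, 0;
       v.i * (r - v.n * v.τ * N₂ + m), 0, v.n * v.τ * v.q * v.i],
    !![(ν : ℝ) • (v.π * v.j), v.j * (-r - v.n * v.π * N₁ + m),
        v.j * (((ν : ℝ) / 2) • v.dq - v.n * v.π * N₂ + (2 : ℝ) • (v.n * v.P * v.π));
       v.j * (-r - v.n * v.π * N₁ + m), v.n * v.π * v.s * v.j, 0;
       v.j * (((ν : ℝ) / 2) • v.dq - v.n * v.π * N₂ + (2 : ℝ) • (v.n * v.P * v.π)), 0,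
        v.n * v.π]]

set_option maxHeartbeats 4000000 in
-- Evaluation at a point turns `n`, `i`, `j` into reciprocals of real numbers, so that each entry
-- becomes an identity of rational expressions. The later formulas for jets are checked in the same
-- way.
lemma gamB_eq (a b c : Fin 3) : gamB v a b c = chrB v a b c := by
  apply Subtype.ext; funext x
  obtain ⟨hN, hn⟩ := eval_inv v.hn x
  obtain ⟨hs, hi⟩ := eval_inv v.hi x
  obtain ⟨hq, hj⟩ := eval_inv v.hj x
  fin_cases a <;> fin_cases b <;> fin_cases c <;>
    simp [gamB, chrB, lowB, Fin.sum_univ_three, par, mulB, pdB, dAng, GVal.hB, GVal.kB,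
      hn, hi, hj] <;> field_simp <;> ring

set_option maxHeartbeats 4000000 in
lemma gamD_eq (a b c : Fin 3) : gamD ν v a b c = chrD ν v a b c := by
  apply Subtype.ext; funext x
  obtain ⟨hN, hn⟩ := eval_inv v.hn x
  obtain ⟨hs, hi⟩ := eval_inv v.hi x
  obtain ⟨hq, hj⟩ := eval_inv v.hj x
  fin_cases a <;> fin_cases b <;> fin_cases c <;>
    simp [gamD, chrD, lowB, lowD, Fin.sum_univ_three, par, mulD, pdB, pdD, dAng, GVal.hB, GVal.kB,
      GVal.hD, GVal.kD, hn, hi, hj] <;> field_simp <;> ring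

end Values

end KillingHorizon

end

noncomputable section

namespace KillingHorizon

open scoped Shortcuts

/-! ### Jets of the Ricci tensor -/

/-- The parity of a Christoffel symbol. -/
def chrPar (a b c : Fin 3) : Bool := par a ^^ (par b ^^ par c)

section Values

variable (ν : ℤ) (v : GVal)

/-- Leading coefficients of the Ricci tensor. -/
def ricB (b c : Fin 3) : Ang :=
  ∑ a, (pdB a (chrPar a b c) (-1) (chrB v a b c) - pdB c (chrPar a b a) (-1) (chrB v a b a)
    + ∑ d, (mulB (chrPar a a d) (chrPar d b c) (chrB v a a d) (chrB v d b c)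
      - mulB (chrPar a c d) (chrPar d b a) (chrB v a c d) (chrB v d b a)))

/-- Variations of the Ricci tensor. -/
def ricD (b c : Fin 3) : Ang :=
  ∑ a, (pdD ν a (chrPar a b c) (-1) (chrD ν v a b c)
    - pdD ν c (chrPar a b a) (-1) (chrD ν v a b a)
    + ∑ d, (mulD (chrPar a a d) (chrPar d b c) (chrB v a a d) (chrD ν v a a d)
        (chrB v d b c) (chrD ν v d b c)
      - mulD (chrPar a c d) (chrPar d b a) (chrB v a c d) (chrD ν v a c d)
        (chrB v d b a) (chrD ν v d b a)))

end Values

variable {𝒞 : JetCalc} {g g' : Geom} {v : GVal}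

lemma GeomJet.chr (G : GeomJet 𝒞 g g' v) (a b c : Fin 3) :
    𝒞.J (chrPar a b c) (-1) (KillingHorizon.christoffel g.metric a b c)
      (KillingHorizon.christoffel g'.metric a b c) (chrB v a b c) (chrD 𝒞.ν v a b c) :=
  𝒞.congr (G.christoffel a b c) rfl rfl rfl rfl (gamB_eq v a b c) (gamD_eq 𝒞.ν v a b c)

lemma GeomJet.ricci (G : GeomJet 𝒞 g g' v) (b c : Fin 3) :
    𝒞.J (par b ^^ par c) (-2) (KillingHorizon.ricci g.metric b c)
      (KillingHorizon.ricci g'.metric b c)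
      (ricB v b c) (ricD 𝒞.ν v b c) := by
  refine 𝒞.sum fun a => 𝒞.add (𝒞.sub ?_ ?_) (𝒞.sum fun d => 𝒞.sub ?_ ?_)
  · refine 𝒞.congr (𝒞.pd a (G.chr a b c)) ?_ (by norm_num) rfl rfl rfl rfl
    unfold chrPar; cases par a <;> cases par b <;> cases par c <;> rfl
  · refine 𝒞.congr (𝒞.pd c (G.chr a b a)) ?_ (by norm_num) rfl rfl rfl rfl
    unfold chrPar; cases par a <;> cases par b <;> cases par c <;> rfl
  · refine 𝒞.congr (𝒞.mul (G.chr a a d) (G.chr d b c)) ?_ (by norm_num) rfl rfl rfl rfl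
    unfold chrPar; cases par a <;> cases par b <;> cases par c <;> cases par d <;> rfl
  · refine 𝒞.congr (𝒞.mul (G.chr a c d) (G.chr d b a)) ?_ (by norm_num) rfl rfl rfl rfl
    unfold chrPar; cases par a <;> cases par b <;> cases par c <;> cases par d <;> rfl

lemma der_of_mul_eq_one (D : Derivation ℝ Ang Ang) {a b : Ang} (h : a * b = 1) :
    D b = -(b ^ 2 * D a) := by
  have h1 : D (a * b) = 0 := by rw [h]; simp
  rw [Derivation.leibniz, smul_eq_mul, smul_eq_mul] at h1
  linear_combination b * h1 - D b * h

namespace GVal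

variable (ν : ℤ) (v : GVal)

/-- Relative variation of the lapse. -/
def al : Ang := (1 / 2 : ℝ) • (v.n * v.dN)

/-- Variation of the divergence of the shift, `θθ`-part. -/
def X : Ang :=
  v.i * (dθ v.τ - (1 / 2 : ℝ) • (v.τ * v.i * dθ v.s) + (1 / 2 : ℝ) • (v.π * v.j * dφ v.s))

/-- Variation of the divergence of the shift, `φφ`-part. -/
def Z : Ang :=
  v.j * (dφ v.π - (1 / 2 : ℝ) • (v.π * v.j * dφ v.q) + (1 / 2 : ℝ) • (v.τ * v.i * dθ v.q))

/-- Variation of the symmetrized derivative of the shift, `θφ`-part. -/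
def W : Ang := (1 / 2 : ℝ) • (dθ v.π + dφ v.τ - v.τ * v.i * dφ v.s - v.π * v.j * dθ v.q)

/-- The derivative along the variation of the shift. -/
def adv (a : Ang) : Ang := v.τ * v.i * dθ a + v.π * v.j * dφ a

/-- The derivative of the logarithm of the lapse along the variation of the shift. -/
def ell : Ang := (1 / 2 : ℝ) • (v.n * v.adv v.N)

/-- Variation of the extrinsic curvature, `θθ`-part. -/
def PP : Ang := ((ν : ℝ) / 2) • (v.i * v.ds) - v.al - v.X

/-- Variation of the extrinsic curvature, `φφ`-part. -/
def QQ : Ang := ((ν : ℝ) / 2) • (v.j * v.dq) - v.al - v.Z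

end GVal

variable (ν : ℤ) (v : GVal)

set_option maxHeartbeats 4000000 in
-- The leading shift drops out, and the angular block vanishes, so the θθ-, θφ- and φφ-equations
-- start only at the order of the variation.
lemma ricB_eq : ricB v = !![(2 : ℝ) • 1, (1 / 2 : ℝ) • (v.n * dθ v.N), (1 / 2 : ℝ) • (v.n * dφ v.N);
    (1 / 2 : ℝ) • (v.n * dθ v.N), 0, 0; (1 / 2 : ℝ) • (v.n * dφ v.N), 0, 0] := by
  funext b c
  apply Subtype.ext; funext x
  obtain ⟨hN, hn⟩ := eval_inv v.hn x
  obtain ⟨hs, hi⟩ := eval_inv v.hi x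
  obtain ⟨hq, hj⟩ := eval_inv v.hj x
  fin_cases b <;> fin_cases c <;>
    simp [ricB, chrB, chrPar, Fin.sum_univ_three, par, mulB, pdB, dAng, hn, hi, hj] <;>
    field_simp <;> ring

set_option maxHeartbeats 4000000 in
-- The intrinsic curvature of the angular metric is of higher order, and `T`, `P` cancel. Only the
-- variations of extrinsic curvature and lapse and the advection of the lapse remain. Hence the
-- problem at order n = 2 is linear although the leading shift itself varies there.
lemma ricD_one_one : ricD ν v 1 1 = v.n * v.s * (-(((ν : ℝ) + 1) • v.PP ν) - v.QQ ν
    - (2 : ℝ) • v.al - v.ell) := by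
  apply Subtype.ext; funext x
  obtain ⟨hN, hn⟩ := eval_inv v.hn x
  obtain ⟨hs, hi⟩ := eval_inv v.hi x
  obtain ⟨hq, hj⟩ := eval_inv v.hj x
  simp [ricD, chrB, chrD, chrPar, Fin.sum_univ_three, par, mulD, pdD, dAng, GVal.PP, GVal.QQ,
    GVal.al, GVal.X, GVal.Z, GVal.ell, GVal.adv, Derivation.leibniz, der_of_mul_eq_one _ v.hn,
    der_of_mul_eq_one _ v.hj, hn, hi, hj]
  field_simp
  ring

set_option maxHeartbeats 4000000 in
lemma ricD_two_two : ricD ν v 2 2 = v.n * v.q * (-(((ν : ℝ) + 1) • v.QQ ν) - v.PP ν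
    - (2 : ℝ) • v.al - v.ell) := by
  apply Subtype.ext; funext x
  obtain ⟨hN, hn⟩ := eval_inv v.hn x
  obtain ⟨hs, hi⟩ := eval_inv v.hi x
  obtain ⟨hq, hj⟩ := eval_inv v.hj x
  simp [ricD, chrB, chrD, chrPar, Fin.sum_univ_three, par, mulD, pdD, dAng, GVal.PP, GVal.QQ,
    GVal.al, GVal.X, GVal.Z, GVal.ell, GVal.adv, Derivation.leibniz, der_of_mul_eq_one _ v.hn,
    der_of_mul_eq_one _ v.hi, hn, hi, hj]
  field_simp
  ring

set_option maxHeartbeats 4000000 in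
-- The variation of the lapse does not occur here: this is the second equation of the shift system.
lemma ricD_one_two : ricD ν v 1 2 = (ν : ℝ) • (v.n * v.W) := by
  apply Subtype.ext; funext x
  obtain ⟨hN, hn⟩ := eval_inv v.hn x
  obtain ⟨hs, hi⟩ := eval_inv v.hi x
  obtain ⟨hq, hj⟩ := eval_inv v.hj x
  simp [ricD, chrB, chrD, chrPar, Fin.sum_univ_three, par, mulD, pdD, dAng, GVal.W,
    Derivation.leibniz, der_of_mul_eq_one _ v.hn, hn, hi, hj]
  field_simp
  ring

end KillingHorizon

end

noncomputable section

namespace KillingHorizon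

open scoped Shortcuts

/-! ### Jets of the Ernst equation -/

/-- The Laplacian of a real series. -/
def lapS (h : Matrix (Fin 3) (Fin 3) Ser) (p : Ser) : Ser :=
  ∑ a, ∑ b, h⁻¹ a b * (pd a (pd b p) - ∑ c, christoffel h c a b * pd c p)

/-- The inner product of the gradients of two real series. -/
def gradS (h : Matrix (Fin 3) (Fin 3) Ser) (p q : Ser) : Ser :=
  ∑ a, ∑ b, h⁻¹ a b * (pd a p * pd b q)

/-- The real part of the Ernst equation. -/
def ernstRe (h : Matrix (Fin 3) (Fin 3) Ser) (f b : Ser) : Ser :=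
  f * lapS h f - gradS h f f + gradS h b b

/-- The imaginary part of the Ernst equation. -/
def ernstIm (h : Matrix (Fin 3) (Fin 3) Ser) (f b : Ser) : Ser :=
  f * lapS h b - (gradS h f b + gradS h b f)

section Values

variable (ν : ℤ) (v : GVal)

/-- Leading coefficients of a Hessian. -/
def hesB (m : ℤ) (p : Ang) (a b : Fin 3) : Ang :=
  pdB a (par b) (m - 1) (pdB b false m p)
    - ∑ c, mulB (chrPar c a b) (par c) (chrB v c a b) (pdB c false m p)

/-- Variations of a Hessian. -/
def hesD (m : ℤ) (p d : Ang) (a b : Fin 3) : Ang :=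
  pdD ν a (par b) (m - 1) (pdD ν b false m d)
    - ∑ c, mulD (chrPar c a b) (par c) (chrB v c a b) (chrD ν v c a b) (pdB c false m p)
        (pdD ν c false m d)

/-- Leading coefficient of a Laplacian. -/
def lapB (m : ℤ) (p : Ang) : Ang :=
  ∑ a, ∑ b, mulB (par a ^^ par b) (par a ^^ par b) (v.kB a b) (hesB v m p a b)

/-- Variation of a Laplacian. -/
def lapD (m : ℤ) (p d : Ang) : Ang :=
  ∑ a, ∑ b, mulD (par a ^^ par b) (par a ^^ par b) (v.kB a b) (v.kD a b) (hesB v m p a b)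
    (hesD ν v m p d a b)

/-- Leading coefficient of a product of gradients. -/
def grdB (m k : ℤ) (p q : Ang) : Ang :=
  ∑ a, ∑ b, mulB (par a ^^ par b) (par a ^^ par b) (v.kB a b)
    (mulB (par a) (par b) (pdB a false m p) (pdB b false k q))

/-- Variation of a product of gradients. -/
def grdD (m k : ℤ) (p d q e : Ang) : Ang :=
  ∑ a, ∑ b, mulD (par a ^^ par b) (par a ^^ par b) (v.kB a b) (v.kD a b)
    (mulB (par a) (par b) (pdB a false m p) (pdB b false k q))
    (mulD (par a) (par b) (pdB a false m p) (pdD ν a false m d) (pdB b false k q)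
      (pdD ν b false k e))

end Values

variable {𝒞 : JetCalc} {g g' : Geom} {v : GVal}

lemma JetCalc.pdEven (𝒞 : JetCalc) {m u v a d} (c : Fin 3) (h : 𝒞.J false m u v a d) :
    𝒞.J (par c) (m - 1) (KillingHorizon.pd c u) (KillingHorizon.pd c v) (pdB c false m a)
      (pdD 𝒞.ν c false m d) :=
  𝒞.congr (𝒞.pd c h) (Bool.false_xor _) rfl rfl rfl rfl rfl

lemma GeomJet.hess (G : GeomJet 𝒞 g g' v) {m : ℤ} {p p' : Ser} {a₀ d₀ : Ang}
    (hp : 𝒞.J false m p p' a₀ d₀) (a b : Fin 3) :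
    𝒞.J (par a ^^ par b) (m - 2)
      (pd a (pd b p) - ∑ c, KillingHorizon.christoffel g.metric c a b * pd c p)
      (pd a (pd b p') - ∑ c, KillingHorizon.christoffel g'.metric c a b * pd c p')
      (hesB v m a₀ a b) (hesD 𝒞.ν v m a₀ d₀ a b) := by
  refine 𝒞.sub ?_ (𝒞.sum fun c => ?_)
  · exact 𝒞.congr (𝒞.pd a (𝒞.pdEven b hp)) (Bool.xor_comm _ _) (by ring) rfl rfl rfl rfl
  · refine 𝒞.congr (𝒞.mul (G.chr c a b) (𝒞.pdEven c hp)) ?_ (by ring) rfl rfl rfl rfl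
    unfold chrPar; cases par a <;> cases par b <;> cases par c <;> rfl

lemma GeomJet.lap (G : GeomJet 𝒞 g g' v) {m : ℤ} {p p' : Ser} {a₀ d₀ : Ang}
    (hp : 𝒞.J false m p p' a₀ d₀) :
    𝒞.J false (m - 4) (lapS g.metric p) (lapS g'.metric p') (lapB v m a₀)
      (lapD 𝒞.ν v m a₀ d₀) := by
  unfold lapS
  rw [g.metric_inv, g'.metric_inv]
  refine 𝒞.sum fun a => 𝒞.sum fun b => ?_
  exact 𝒞.congr (𝒞.mul (G.inv a b) (G.hess hp a b)) (Bool.xor_self _) (by ring) rfl rfl rfl rfl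

lemma GeomJet.grad (G : GeomJet 𝒞 g g' v) {m k : ℤ} {p p' q q' : Ser} {a₀ d₀ b₀ e₀ : Ang}
    (hp : 𝒞.J false m p p' a₀ d₀) (hq : 𝒞.J false k q q' b₀ e₀) :
    𝒞.J false (m + k - 4) (gradS g.metric p q) (gradS g'.metric p' q') (grdB v m k a₀ b₀)
      (grdD 𝒞.ν v m k a₀ d₀ b₀ e₀) := by
  unfold gradS
  rw [g.metric_inv, g'.metric_inv]
  refine 𝒞.sum fun a => 𝒞.sum fun b => ?_
  exact 𝒞.congr (𝒞.mul (G.inv a b) (𝒞.mul (𝒞.pdEven a hp) (𝒞.pdEven b hq))) (Bool.xor_self _)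
    (by ring) rfl rfl rfl rfl

variable (ν : ℤ) (v : GVal)

set_option maxHeartbeats 1000000 in
-- To leading order the Laplacian is a multiple of (y ∂_y)², because the angular second derivatives
-- carry two more powers of y. This is the origin of the nonzero factors in front of δf and δb.
lemma lapB_eq (m : ℤ) (p : Ang) : lapB v m p = ((m : ℝ) ^ 2) • (v.n * p) := by
  apply Subtype.ext; funext x
  obtain ⟨hN, hn⟩ := eval_inv v.hn x
  obtain ⟨hs, hi⟩ := eval_inv v.hi x
  obtain ⟨hq, hj⟩ := eval_inv v.hj x
  simp [lapB, hesB, chrB, chrPar, Fin.sum_univ_three, par, mulB, pdB, dAng, GVal.kB, hn, hi, hj]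
  field_simp
  ring

set_option maxHeartbeats 1000000 in
lemma lapD_eq (m : ℤ) (p d : Ang) : lapD ν v m p d
    = v.n * (((m + ν : ℝ) ^ 2) • d - ((2 * m + ν : ℝ)) • v.adv p
      + (m : ℝ) • (p * (v.PP ν + v.QQ ν + (2 - ν : ℝ) • v.al + v.ell)))
      - (2 * (m : ℝ) ^ 2) • (v.n * p * v.al) := by
  apply Subtype.ext; funext x
  obtain ⟨hN, hn⟩ := eval_inv v.hn x
  obtain ⟨hs, hi⟩ := eval_inv v.hi x
  obtain ⟨hq, hj⟩ := eval_inv v.hj x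
  simp [lapD, hesB, hesD, chrB, chrD, chrPar, Fin.sum_univ_three, par, mulD, mulB, pdB, pdD, dAng,
    GVal.kB, GVal.kD, hn, hi, hj, GVal.PP, GVal.QQ, GVal.al, GVal.X, GVal.Z, GVal.ell, GVal.adv]
  field_simp
  ring

lemma grdB_eq (m k : ℤ) (p q : Ang) : grdB v m k p q = ((m : ℝ) * k) • (v.n * p * q) := by
  apply Subtype.ext; funext x
  simp [grdB, Fin.sum_univ_three, par, mulB, pdB, dAng, GVal.kB]
  ring

lemma grdD_eq (m k : ℤ) (p d q e : Ang) : grdD ν v m k p d q e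
    = v.n * ((k : ℝ) • (q * ((m + ν : ℝ) • d - v.adv p)) + (m : ℝ) • (p * ((k + ν : ℝ) • e
      - v.adv q))) - (2 * (m : ℝ) * k) • (v.n * p * q * v.al) := by
  apply Subtype.ext; funext x
  obtain ⟨hN, hn⟩ := eval_inv v.hn x
  obtain ⟨hs, hi⟩ := eval_inv v.hi x
  obtain ⟨hq, hj⟩ := eval_inv v.hj x
  simp [grdD, Fin.sum_univ_three, par, mulB, mulD, pdB, pdD, dAng, GVal.kB, GVal.kD, hn, hi, hj,
    GVal.al, GVal.adv]
  field_simp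
  ring

/-- The jet of the real part of the Ernst equation. -/
lemma GeomJet.ernstRe {v : GVal} (G : GeomJet 𝒞 g g' v) {f f' b b' : Ser} {f₀ df b₀ db : Ang}
    (hf : 𝒞.J false 2 f f' f₀ df) (hb : 𝒞.J false 4 b b' b₀ db) :
    𝒞.J false 0 (ernstRe g.metric f b) (ernstRe g'.metric f' b') 0
      (v.n * f₀ * ((𝒞.ν : ℝ) • ((𝒞.ν : ℝ) • df - v.adv f₀)
        + (2 : ℝ) • (f₀ * (v.PP 𝒞.ν + v.QQ 𝒞.ν + (2 - 𝒞.ν : ℝ) • v.al + v.ell)))) := by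
  have h1 := 𝒞.mul hf (G.lap hf)
  have h2 := G.grad hf hf
  -- The twist potential starts at y⁴. Regarded as a series of weight 2 it has zero jet, so its
  -- squared gradient does not contribute.
  have h3 := G.grad (𝒞.lower hb) (𝒞.lower hb)
  refine 𝒞.congr (𝒞.add (𝒞.sub h1 h2) h3) rfl rfl rfl rfl ?_ ?_
  · rw [lapB_eq, grdB_eq, grdB_eq]
    apply Subtype.ext; funext x
    simp [mulB]
    ring
  · rw [lapB_eq, lapD_eq, grdD_eq, grdD_eq]
    apply Subtype.ext; funext x
    simp [mulD]
    ring

/-- The jet of the imaginary part of the Ernst equation. -/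
lemma GeomJet.ernstIm {v : GVal} (G : GeomJet 𝒞 g g' v) {f f' b b' : Ser} {f₀ df b₀ db : Ang}
    (hf : 𝒞.J false 2 f f' f₀ df) (hb : 𝒞.J false 4 b b' b₀ db) :
    𝒞.J false 2 (ernstIm g.metric f b) (ernstIm g'.metric f' b') 0
      (v.n * (f₀ * ((𝒞.ν : ℝ) • ((4 + 𝒞.ν : ℝ) • db - v.adv b₀) - (4 : ℝ) • v.adv b₀
        + (4 : ℝ) • (b₀ * (v.PP 𝒞.ν + v.QQ 𝒞.ν + (2 - 𝒞.ν : ℝ) • v.al + v.ell)))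
        - (8 : ℝ) • (b₀ * ((𝒞.ν : ℝ) • df - v.adv f₀)))) := by
  have h1 := 𝒞.mul hf (G.lap hb)
  have h2 := G.grad hf hb
  have h3 := G.grad hb hf
  refine 𝒞.congr (𝒞.sub h1 (𝒞.add h2 h3)) rfl rfl rfl rfl ?_ ?_
  · rw [lapB_eq, grdB_eq, grdB_eq]
    apply Subtype.ext; funext x
    simp [mulB]
    ring
  · rw [lapB_eq, lapD_eq, grdD_eq, grdD_eq]
    apply Subtype.ext; funext x
    simp [mulD]
    ring

end KillingHorizon

end

noncomputable section

namespace KillingHorizon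

open scoped Shortcuts

/-! ### Invertible angular functions -/

lemma ang_ext {a b : Ang} (h : ∀ x, a.1 x = b.1 x) : a = b := Subtype.ext (funext h)

/-- A nowhere vanishing angular function is invertible. -/
lemma exists_ang_inverse (a : Ang) (ha : ∀ x, a.1 x ≠ 0) : ∃ b : Ang, a * b = 1 := by
  have e : ext (fun x => (a.1 x)⁻¹) = fun x => (ext a.1 x)⁻¹ := by
    funext x
    by_cases hx : x ∈ Angles
    · simp [ext_of_mem _ hx]
    · simp [ext_of_notMem _ hx]
  refine ⟨⟨fun x => (a.1 x)⁻¹, ?_, fun x => ?_⟩, ang_ext fun x => ?_⟩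
  · rw [e]
    exact a.2.1.inv fun x hx => by rw [ext_of_mem _ hx]; exact ha _
  · rw [e]; simp only [a.2.2]
  · exact mul_inv_cancel₀ (ha x)

/-- The inverse of a nowhere vanishing angular function. -/
def angInv (a : Ang) (ha : ∀ x, a.1 x ≠ 0) : Ang := (exists_ang_inverse a ha).choose

lemma mul_angInv (a : Ang) (ha : ∀ x, a.1 x ≠ 0) : a * angInv a ha = 1 :=
  (exists_ang_inverse a ha).choose_spec

lemma sinTheta_pos (x : Angles) : 0 < sinTheta.1 x := Real.sin_pos_of_mem_Ioo x.2.1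

/-! ### Jets of the constituents of the ansatz -/

lemma single_jet_even {m : ℤ} {u : Ser} (w : Ser) (h : Ord m u) :
    singleCalc.J false m u w (u.coeff m) (u.coeff (m + 1)) := by
  refine ⟨by simpa using h, by simp, by simp⟩

lemma single_jet_odd {m : ℤ} {u : Ser} (w : Ser) (h : Ord (m + 1) u) :
    singleCalc.J true m u w (u.coeff (m + 1)) 0 := ⟨h, rfl, rfl⟩

lemma pair_jet_self {n : ℤ} (hn : 2 ≤ n) {m : ℤ} {u : Ser} (h : Ord m u) :
    (pairCalc n hn).J false m u u (u.coeff m) 0 := by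
  refine ⟨by simpa using h, by simpa using h, ?_, ?_, ?_⟩
  · rw [two_coeff_mean, ← two_smul ℝ, smul_smul]; norm_num
  · rw [sub_self]; exact Ord.zero _
  · rw [sub_self]; rfl

lemma smul_one_mul_smul_one {a b : ℝ} (h : a * b = 1) : (a • (1 : Ang)) * (b • (1 : Ang)) = 1 := by
  rw [smul_mul_smul_comm, h, one_mul, one_smul]

section Radius

variable {R : ℝ}

lemma radius_eq (R : ℝ) : radius R = cst R + HahnSeries.single 1 1 := rfl

lemma radius_ord (R : ℝ) : Ord 0 (radius R) :=
  (ord_single 0 _).add ((ord_single 1 1).mono (by norm_num))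

lemma radius_coeff_zero (R : ℝ) : (radius R).coeff 0 = R • (1 : Ang) := by
  rw [radius, HahnSeries.coeff_add, HahnSeries.coeff_single_of_ne (by norm_num), add_zero,
    ← Algebra.algebraMap_eq_smul_one]
  exact HahnSeries.coeff_single_same _ _

lemma radius_coeff_one (R : ℝ) : (radius R).coeff 1 = 1 := by
  rw [radius, HahnSeries.coeff_add, HahnSeries.coeff_single_same]
  have : (HahnSeries.C (algebraMap ℝ Ang R) : Ser).coeff 1 = 0 :=
    HahnSeries.coeff_single_of_ne (by norm_num)
  rw [this, zero_add]

lemma radius_jet (R : ℝ) : singleCalc.J false 0 (radius R) (radius R) (R • 1) 1 :=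
  singleCalc.congr (single_jet_even _ (radius_ord R)) rfl rfl rfl rfl (radius_coeff_zero R)
    (radius_coeff_one R)

lemma radius_sq_jet (R : ℝ) :
    singleCalc.J false 0 (radius R ^ 2) (radius R ^ 2) (R ^ 2 • 1) ((2 * R) • 1) := by
  refine singleCalc.congr (singleCalc.mul (radius_jet R) (radius_jet R)) rfl rfl (by ring)
    (by ring) ?_ ?_
  · apply ang_ext; intro x; simp [mulB]; ring
  · apply ang_ext; intro x; simp [mulD]; ring

lemma radius_sq_isUnit (hR : 0 < R) : radius R ^ 2 * Ring.inverse (radius R ^ 2) = 1 := by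
  have h := radius_sq_jet R
  obtain ⟨v, hv, -⟩ := Ord.exists_inverse (m := 0) (a := ((R ^ 2)⁻¹) • (1 : Ang)) (h.1)
    (by
      have h2 := h.2.1
      simp only [cond_false, add_zero] at h2
      rw [h2]
      exact smul_one_mul_smul_one (by field_simp))
  rw [ringInverse_eq hv, hv]

/-- The factor equals (2Ry + y²) / r²; expanding to second order gives (2/R) y - (3/R²) y². -/
lemma horizonFactor_jet (hR : 0 < R) :
    singleCalc.J false 1 (1 - R ^ 2 • Ring.inverse (radius R ^ 2))
      (1 - R ^ 2 • Ring.inverse (radius R ^ 2)) ((2 / R) • 1) (-(3 / R ^ 2) • 1) := by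
  have hu := radius_sq_isUnit hR
  have e : (1 : Ser) - R ^ 2 • Ring.inverse (radius R ^ 2)
      = (radius R ^ 2 - cst (R ^ 2)) * Ring.inverse (radius R ^ 2) := by
    rw [sub_mul, hu, smul_eq_cst_mul]
  have e2 : radius R ^ 2 - cst (R ^ 2)
      = (2 * R) • HahnSeries.single 1 1 + HahnSeries.single 2 1 := by
    rw [radius_eq, smul_eq_cst_mul, map_mul, map_pow, map_ofNat]
    have : (HahnSeries.single 2 (1 : Ang) : Ser)
        = HahnSeries.single 1 1 * HahnSeries.single 1 1 := by
      rw [HahnSeries.single_mul_single, mul_one]; norm_num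
    rw [this]; ring
  have o : Ord 1 (radius R ^ 2 - cst (R ^ 2)) := by
    rw [e2]
    exact ((ord_single 1 1).smul _).add ((ord_single 2 1).mono (by norm_num))
  have c1 : (radius R ^ 2 - cst (R ^ 2)).coeff 1 = (2 * R) • 1 := by
    rw [e2, HahnSeries.coeff_add, HahnSeries.coeff_smul, HahnSeries.coeff_single_same,
      HahnSeries.coeff_single_of_ne (by norm_num), add_zero]
  have c2 : (radius R ^ 2 - cst (R ^ 2)).coeff (1 + 1) = 1 := by
    rw [e2, HahnSeries.coeff_add, HahnSeries.coeff_smul, show (1 : ℤ) + 1 = 2 by norm_num,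
      HahnSeries.coeff_single_same, HahnSeries.coeff_single_of_ne (by norm_num), smul_zero,
      zero_add]
  have j1 := single_jet_even (radius R ^ 2 - cst (R ^ 2)) o
  rw [c1, c2] at j1
  have j2 := singleCalc.inv (radius_sq_jet R) hu hu (a' := ((R ^ 2)⁻¹) • (1 : Ang))
    (smul_one_mul_smul_one (by field_simp))
  refine singleCalc.congr (singleCalc.mul j1 j2) rfl rfl e.symm e.symm ?_ ?_
  · apply ang_ext; intro x; simp [mulB]; field_simp
  · apply ang_ext; intro x; simp [mulD]; field_simp; ring

lemma sPhi_jet (hR : 0 < R) :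
    singleCalc.J false 2 (sPhi R) (sPhi R) ((4 : ℝ) • sinTheta ^ 2)
      (-(4 / R) • sinTheta ^ 2) := by
  have j1 := single_jet_even (HahnSeries.C sinTheta : Ser) (ord_single 0 sinTheta)
  rw [HahnSeries.coeff_single_same, HahnSeries.coeff_single_of_ne (by norm_num)] at j1
  have j2 := horizonFactor_jet hR
  have j3 := singleCalc.mul (singleCalc.mul (radius_sq_jet R) (singleCalc.mul j1 j1))
    (singleCalc.mul j2 j2)
  have e : sPhi R = radius R ^ 2 * (HahnSeries.single 0 sinTheta * HahnSeries.single 0 sinTheta)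
      * ((1 - R ^ 2 • Ring.inverse (radius R ^ 2)) * (1 - R ^ 2 • Ring.inverse (radius R ^ 2))) := by
    rw [← pow_two, ← pow_two]; rfl
  refine singleCalc.congr j3 rfl rfl e.symm (e.trans (by rfl)).symm ?_ ?_
  · apply ang_ext; intro x; simp [mulB]; field_simp; ring
  · apply ang_ext; intro x; simp [mulB, mulD]; field_simp; ring

end Radius

lemma Ord.mul_ringInverse {m : ℤ} {u : Ser} {a : Ang} (h : Ord m u) (ha : u.coeff m * a = 1) :
    u * Ring.inverse u = 1 := by
  obtain ⟨v, hv, -⟩ := h.exists_inverse ha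
  rw [ringInverse_eq hv, hv]

lemma ser_coeff_zero (m : ℤ) (F : ℕ → Ang) : (ser m F).coeff m = F 0 := by
  have := ser_coeff m F 0
  rwa [Nat.cast_zero, add_zero] at this

lemma ser_coeff_one (m : ℤ) (F : ℕ → Ang) : (ser m F).coeff (m + 1) = F 1 := by
  have := ser_coeff m F 1
  rwa [Nat.cast_one] at this

lemma ser_sub_ord {m : ℤ} {F F' : ℕ → Ang} {n : ℕ} (h : ∀ k < n, F k = F' k) :
    Ord (m + n) (ser m F' - ser m F) := by
  intro l hl
  rw [HahnSeries.coeff_sub]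
  by_cases hm : l < m
  · rw [ser_ord m F' l hm, ser_ord m F l hm, sub_zero]
  · obtain ⟨k, hk⟩ := Int.eq_ofNat_of_zero_le (show 0 ≤ l - m by omega)
    have : l = m + k := by omega
    rw [this, ser_coeff, ser_coeff, h k (by omega), sub_self]

lemma pair_jet_ser {n : ℕ} (hn : 2 ≤ (n : ℤ)) (m : ℤ) {F F' : ℕ → Ang}
    (h : ∀ k < n, F k = F' k) :
    (pairCalc n hn).J false m (ser m F) (ser m F') (F 0) (F' n - F n) := by
  refine ⟨by simpa using ser_ord m F, by simpa using ser_ord m F', ?_,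
    by simpa using ser_sub_ord h, ?_⟩
  · simp only [cond_false, add_zero]
    rw [two_coeff_mean, ser_coeff_zero, ser_coeff_zero, ← h 0 (by omega), ← two_smul ℝ, smul_smul]
    norm_num
  · simp only [cond_false, sub_zero]
    rw [HahnSeries.coeff_sub, ser_coeff, ser_coeff]

/-- An odd pair has its variation at y^{m+n-1}, whereas the series starts at y^{m+1}. The
coefficient concerned therefore has index n - 2, and this fixes the offset between the shift and the
other functions. -/
lemma pair_jet_ser_odd {n : ℕ} (hn : 2 ≤ (n : ℤ)) (m : ℤ) {F F' : ℕ → Ang}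
    (h : ∀ k, k + 2 < n → F k = F' k) :
    (pairCalc n hn).J true m (ser (m + 1) F) (ser (m + 1) F') ((1 / 2 : ℝ) • (F 0 + F' 0))
      (F' (n - 2) - F (n - 2)) := by
  have e : m + n - 1 = m + 1 + (n - 2 : ℕ) := by omega
  refine ⟨ser_ord _ F, ser_ord _ F', ?_, ?_, ?_⟩
  · simp only [cond_true]
    rw [two_coeff_mean, ser_coeff_zero, ser_coeff_zero]
  · simp only [cond_true]
    rw [e]
    exact ser_sub_ord fun k hk => h k (by omega)
  · simp only [cond_true]
    rw [HahnSeries.coeff_sub, e, ser_coeff, ser_coeff]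

/-! ### The geometry of an expansion -/

lemma pow_two_ne {a : Ang} (ha : ∀ x, 0 < a.1 x) (x : Angles) : (a ^ 2).1 x ≠ 0 :=
  (pow_pos (ha x) 2).ne'

lemma four_sin_sq_ne (x : Angles) : ((4 : ℝ) • sinTheta ^ 2).1 x ≠ 0 :=
  (mul_pos (by norm_num) (pow_pos (sinTheta_pos x) 2) : (0 : ℝ) < 4 * sinTheta.1 x ^ 2).ne'

/-- The values of the jets of the geometry of an expansion. -/
def baseVal (R : ℝ) (hR : 0 < R) (A₀ : Ang) (hA : ∀ x, 0 < A₀.1 x) (T P dA ρ dq τ π : Ang) :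
    GVal where
  N := A₀ ^ 2
  s := R ^ 2 • A₀ ^ 2
  q := (4 : ℝ) • sinTheta ^ 2
  n := angInv (A₀ ^ 2) (pow_two_ne hA)
  i := (R ^ 2)⁻¹ • angInv (A₀ ^ 2) (pow_two_ne hA)
  j := angInv ((4 : ℝ) • sinTheta ^ 2) four_sin_sq_ne
  T := T
  P := P
  dN := (2 : ℝ) • (A₀ * dA)
  ds := ρ * A₀ ^ 2 + R ^ 2 • (2 : ℝ) • (A₀ * dA)
  dq := dq
  τ := τ
  π := π
  hn := mul_angInv _ _
  hi := by
    rw [smul_mul_smul_comm, mul_angInv, mul_inv_cancel₀ (by positivity), one_smul]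
  hj := mul_angInv _ _

lemma lapse_sq_ord (E : Expansion) : Ord 2 (E.lapse ^ 2) := by
  rw [pow_two]; exact (ser_ord 1 E.A).mul (ser_ord 1 E.A)

lemma lapse_sq_coeff (E : Expansion) : (E.lapse ^ 2).coeff 2 = E.A 0 ^ 2 := by
  rw [pow_two, pow_two]
  have := (ser_ord 1 E.A).coeff_mul (ser_ord 1 E.A)
  rw [ser_coeff_zero] at this
  exact this

lemma sTheta_jet (R : ℝ) (E : Expansion) :
    singleCalc.J false 2 (E.sTheta R) (E.sTheta R) (R ^ 2 • E.A 0 ^ 2)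
      ((2 * R) • (1 : Ang) * E.A 0 ^ 2 + R ^ 2 • (2 : ℝ) • (E.A 0 * E.A 1)) := by
  have j1 := single_jet_even E.lapse (ser_ord 1 E.A)
  rw [ser_coeff_zero, ser_coeff_one] at j1
  refine singleCalc.congr (singleCalc.mul (radius_sq_jet R) (singleCalc.mul j1 j1)) rfl rfl
    (by rw [← pow_two]; rfl) (by rw [← pow_two]; rfl) ?_ ?_
  · apply ang_ext; intro x; simp [mulB]; left; ring
  · apply ang_ext; intro x; simp [mulB, mulD]; ring

lemma sTheta_ord (R : ℝ) (E : Expansion) : Ord 2 (E.sTheta R) := by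
  simpa using (sTheta_jet R E).1

lemma sTheta_coeff (R : ℝ) (E : Expansion) : (E.sTheta R).coeff 2 = R ^ 2 • E.A 0 ^ 2 := by
  simpa using (sTheta_jet R E).2.1

lemma sPhi_ord {R : ℝ} (hR : 0 < R) : Ord 2 (sPhi R) := by simpa using (sPhi_jet hR).1

lemma sPhi_coeff {R : ℝ} (hR : 0 < R) : (sPhi R).coeff 2 = (4 : ℝ) • sinTheta ^ 2 := by
  simpa using (sPhi_jet hR).2.1

namespace Expansion

variable {R : ℝ}

/-- The geometry of an expansion with positive leading coefficient of the lapse. -/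
def geom (hR : 0 < R) (E : Expansion) (hA : ∀ x, 0 < (E.A 0).1 x) : Geom where
  N := E.lapse ^ 2
  s := E.sTheta R
  q := sPhi R
  B := E.shiftTheta
  C := E.shiftPhi
  n := Ring.inverse (E.lapse ^ 2)
  i := Ring.inverse (E.sTheta R)
  j := Ring.inverse (sPhi R)
  hn := (lapse_sq_ord E).mul_ringInverse (by rw [lapse_sq_coeff]; exact mul_angInv _ (pow_two_ne hA))
  hi := (sTheta_ord R E).mul_ringInverse (by
    rw [sTheta_coeff]; exact (baseVal R hR (E.A 0) hA 0 0 0 0 0 0 0).hi)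
  hj := (sPhi_ord hR).mul_ringInverse (by
    rw [sPhi_coeff hR]; exact mul_angInv _ four_sin_sq_ne)

lemma geom_metric (hR : 0 < R) (E : Expansion) (hA : ∀ x, 0 < (E.A 0).1 x) :
    (E.geom hR hA).metric = E.metric R := rfl

/-- The first two orders of the geometry. -/
lemma geom_single (hR : 0 < R) (E : Expansion) (hA : ∀ x, 0 < (E.A 0).1 x) :
    GeomJet singleCalc (E.geom hR hA) (E.geom hR hA)
      (baseVal R hR (E.A 0) hA (E.Θ 0) (E.Φ 0) (E.A 1) ((2 * R) • 1) (-(4 / R) • sinTheta ^ 2)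
        0 0) where
  N := by
    have j1 := single_jet_even E.lapse (ser_ord 1 E.A)
    rw [ser_coeff_zero, ser_coeff_one] at j1
    refine singleCalc.congr (singleCalc.mul j1 j1) rfl rfl (by rw [← pow_two]; rfl)
      (by rw [← pow_two]; rfl) ?_ ?_
    · simp [mulB, baseVal, pow_two]
    · simp [mulD, baseVal, two_smul]; ring
  s := sTheta_jet R E
  q := sPhi_jet hR
  B := singleCalc.congr (single_jet_odd (m := 2) E.shiftTheta (ser_ord 3 E.Θ)) rfl rfl rfl rfl
    (ser_coeff_zero 3 E.Θ) rfl
  C := singleCalc.congr (single_jet_odd (m := 2) E.shiftPhi (ser_ord 3 E.Φ)) rfl rfl rfl rfl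
    (ser_coeff_zero 3 E.Φ) rfl

/-- Two expansions agree up to the order `n`. -/
structure Agree (n : ℕ) (E E' : Expansion) : Prop where
  f : ∀ k < n, E.f k = E'.f k
  b : ∀ k < n, E.b k = E'.b k
  A : ∀ k < n, E.A k = E'.A k
  Θ : ∀ k, k + 2 < n → E.Θ k = E'.Θ k
  Φ : ∀ k, k + 2 < n → E.Φ k = E'.Φ k

/-- The values of the jets of a pair of expansions which agree up to the order `n`. -/
def pairVal (hR : 0 < R) (E E' : Expansion) (hA : ∀ x, 0 < (E.A 0).1 x) (n : ℕ) : GVal :=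
  baseVal R hR (E.A 0) hA ((1 / 2 : ℝ) • (E.Θ 0 + E'.Θ 0)) ((1 / 2 : ℝ) • (E.Φ 0 + E'.Φ 0))
    (E'.A n - E.A n) 0 0 (E'.Θ (n - 2) - E.Θ (n - 2)) (E'.Φ (n - 2) - E.Φ (n - 2))

lemma geom_pair (hR : 0 < R) {n : ℕ} (hn : 2 ≤ (n : ℤ)) {E E' : Expansion} (h : Agree n E E')
    (hA : ∀ x, 0 < (E.A 0).1 x) (hA' : ∀ x, 0 < (E'.A 0).1 x) :
    GeomJet (pairCalc n hn) (E.geom hR hA) (E'.geom hR hA') (pairVal hR E E' hA n) where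
  N := by
    have j1 := pair_jet_ser hn 1 h.A
    refine (pairCalc n hn).congr ((pairCalc n hn).mul j1 j1) rfl rfl (by rw [← pow_two]; rfl)
      (by rw [← pow_two]; rfl) ?_ ?_
    · simp [mulB, baseVal, pairVal, pow_two]
    · simp [mulD, baseVal, pairVal, two_smul]; ring
  s := by
    have j1 := pair_jet_ser hn 1 h.A
    have j2 := pair_jet_self hn (u := radius R ^ 2) (m := 0) (by simpa using (radius_sq_jet R).1)
    have e : (radius R ^ 2).coeff 0 = R ^ 2 • 1 := by simpa using (radius_sq_jet R).2.1
    rw [e] at j2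
    refine (pairCalc n hn).congr ((pairCalc n hn).mul j2 ((pairCalc n hn).mul j1 j1)) rfl rfl
      (by rw [← pow_two]; rfl) (by rw [← pow_two]; rfl) ?_ ?_
    · apply ang_ext; intro x; simp [mulB, baseVal, pairVal]; left; ring
    · apply ang_ext; intro x; simp [mulB, mulD, baseVal, pairVal]; ring
  q := by
    have j := pair_jet_self hn (sPhi_ord hR)
    rw [sPhi_coeff hR] at j
    exact j
  B := pair_jet_ser_odd hn 2 h.Θ
  C := pair_jet_ser_odd hn 2 h.Φ

/-! ### The field equations -/

/-- The norm of the Killing vector as a series. -/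
abbrev fS (E : Expansion) : Ser := ser 2 E.f

/-- The twist potential as a series. -/
abbrev bS (E : Expansion) : Ser := ser 4 E.b

/-- The right-hand side of the Ricci equations. -/
def source (E : Expansion) (a b : Fin 3) : Ser :=
  (1 / 2 : ℝ) • (Ring.inverse (E.fS ^ 2) * (pd a E.fS * pd b E.fS + pd a E.bS * pd b E.bS))

/-- The residual of the Ricci equations. -/
def resid (R : ℝ) (E : Expansion) (a b : Fin 3) : Ser := ricci (E.metric R) a b - E.source a b

lemma ricciEquations_iff (E : Expansion) :
    RicciEquations (E.metric R) E.ernst ↔ ∀ a b, E.resid R a b = 0 := by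
  refine forall_congr' fun a => forall_congr' fun b => ?_
  rw [resid, sub_eq_zero, source]
  have : (cpd a E.ernst * star (cpd b E.ernst)).re
      = pd a E.fS * pd b E.fS + pd a E.bS * pd b E.bS := by
    simp [cpd, ernst]
  rw [this]
  rfl

lemma ernstEquation_iff (E : Expansion) : ErnstEquation (E.metric R) E.ernst ↔
    ernstRe (E.metric R) E.fS E.bS = 0 ∧ ernstIm (E.metric R) E.fS E.bS = 0 := by
  have sre : ∀ s : Fin 3 → CSer, (∑ a, s a).re = ∑ a, (s a).re := fun s => by
    simp [Fin.sum_univ_three]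
  have sim : ∀ s : Fin 3 → CSer, (∑ a, s a).im = ∑ a, (s a).im := fun s => by
    simp [Fin.sum_univ_three]
  have l1 : (laplacian (E.metric R) E.ernst).re = lapS (E.metric R) E.fS := by
    simp only [laplacian, sre, lapS, QuadraticAlgebra.re_smul, QuadraticAlgebra.re_sub, smul_eq_mul]
    rfl
  have l2 : (laplacian (E.metric R) E.ernst).im = lapS (E.metric R) E.bS := by
    simp only [laplacian, sim, lapS, QuadraticAlgebra.im_smul, QuadraticAlgebra.im_sub, smul_eq_mul]
    rfl
  have g1 : (gradSq (E.metric R) E.ernst).re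
      = gradS (E.metric R) E.fS E.fS - gradS (E.metric R) E.bS E.bS := by
    simp only [gradSq, sre, gradS, QuadraticAlgebra.re_smul, QuadraticAlgebra.re_mul, smul_eq_mul,
      ← Finset.sum_sub_distrib]
    refine Finset.sum_congr rfl fun a _ => Finset.sum_congr rfl fun b _ => ?_
    simp only [cpd, ernst]
    ring
  have g2 : (gradSq (E.metric R) E.ernst).im
      = gradS (E.metric R) E.fS E.bS + gradS (E.metric R) E.bS E.fS := by
    simp only [gradSq, sim, gradS, QuadraticAlgebra.im_smul, QuadraticAlgebra.im_mul, smul_eq_mul,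
      ← Finset.sum_add_distrib]
    refine Finset.sum_congr rfl fun a _ => Finset.sum_congr rfl fun b _ => ?_
    simp only [cpd, ernst]
    ring
  rw [ErnstEquation, QuadraticAlgebra.ext_iff, QuadraticAlgebra.re_smul, QuadraticAlgebra.im_smul,
    l1, l2, g1, g2, ernstRe, ernstIm, smul_eq_mul, smul_eq_mul]
  change E.fS * _ = _ ∧ E.fS * _ = _ ↔ _
  rw [← sub_eq_zero, ← sub_eq_zero (a := E.fS * lapS (E.metric R) E.bS), ← sub_add]

end Expansion

end KillingHorizon

end

noncomputable section

namespace KillingHorizon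

open scoped Shortcuts

/-! ### Jets of the field equations -/

/-- Leading coefficients of the source. -/
def srcB (f₀ F : Ang) (a b : Fin 3) : Ang :=
  (1 / 2 : ℝ) • (F * mulB (par a) (par b) (pdB a false 2 f₀) (pdB b false 2 f₀))

/-- With two angular indices both gradients are odd and without variation, so the source is
invisible to the angular equations at this order: the metric decouples from f and b. For the other
components the variation is not needed and stays unspecified. -/
lemma source_jet (𝒞 : JetCalc) {E E' : Expansion} {f₀ df b₀ db F : Ang}
    (hf : 𝒞.J false 2 E.fS E'.fS f₀ df) (hb : 𝒞.J false 4 E.bS E'.bS b₀ db)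
    (h : E.fS ^ 2 * Ring.inverse (E.fS ^ 2) = 1) (h' : E'.fS ^ 2 * Ring.inverse (E'.fS ^ 2) = 1)
    (hF : f₀ ^ 2 * F = 1) (a b : Fin 3) : ∃ d, 𝒞.J (par a ^^ par b) (-2) (E.source a b)
      (E'.source a b) (bif par a ^^ par b then F * srcB f₀ 1 a b else srcB f₀ F a b) d ∧
      (a ≠ 0 → b ≠ 0 → d = 0) := by
  have j1 := 𝒞.inv (𝒞.mul hf hf) (u' := Ring.inverse (E.fS ^ 2)) (v' := Ring.inverse (E'.fS ^ 2))
    (by rw [← pow_two, h]) (by rw [← pow_two, h']) (a' := F)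
    (by simp only [mulB, Bool.and_self, cond_false]; rw [← pow_two, hF])
  have j2 := 𝒞.mul (𝒞.pdEven a hf) (𝒞.pdEven b hf)
  have hb' := 𝒞.lower hb
  have j3 := 𝒞.mul (𝒞.pdEven a hb') (𝒞.pdEven b hb')
  refine ⟨_, 𝒞.congr (𝒞.smul (1 / 2 : ℝ) (𝒞.mul j1 (𝒞.add j2 j3))) (Bool.false_xor _)
    (by norm_num) rfl rfl ?_ rfl, ?_⟩
  · fin_cases a <;> fin_cases b <;>
      simp [par, mulB, pdB, srcB, dAng]
  · intro ha hb
    fin_cases a <;> fin_cases b <;> first | exact absurd rfl ha | exact absurd rfl hb |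
      simp [par, mulB, mulD, pdB, pdD, dAng]

namespace Expansion

variable {R : ℝ}

lemma fS_sq_inverse {E : Expansion} (hf : ∀ x, 0 < (E.f 0).1 x) :
    E.fS ^ 2 * Ring.inverse (E.fS ^ 2) = 1 := by
  have o : Ord (2 + 2) (E.fS ^ 2) := by rw [pow_two]; exact (ser_ord 2 E.f).mul (ser_ord 2 E.f)
  refine o.mul_ringInverse (a := angInv (E.f 0 ^ 2) (pow_two_ne hf)) ?_
  rw [pow_two, (ser_ord 2 E.f).coeff_mul (ser_ord 2 E.f), ser_coeff_zero, ← pow_two, mul_angInv]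

lemma single_f (E : Expansion) : singleCalc.J false 2 E.fS E.fS (E.f 0) (E.f 1) :=
  singleCalc.congr (single_jet_even E.fS (ser_ord 2 E.f)) rfl rfl rfl rfl (ser_coeff_zero _ _)
    (ser_coeff_one _ _)

lemma single_b (E : Expansion) : singleCalc.J false 4 E.bS E.bS (E.b 0) (E.b 1) :=
  singleCalc.congr (single_jet_even E.bS (ser_ord 4 E.b)) rfl rfl rfl rfl (ser_coeff_zero _ _)
    (ser_coeff_one _ _)

/-- The values of the jets of a single expansion. -/
abbrev singleVal (hR : 0 < R) (E : Expansion) (hA : ∀ x, 0 < (E.A 0).1 x) : GVal :=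
  baseVal R hR (E.A 0) hA (E.Θ 0) (E.Φ 0) (E.A 1) ((2 * R) • 1) (-(4 / R) • sinTheta ^ 2) 0 0

/-- The equations at the first two orders. -/
lemma resid_single (hR : 0 < R) {E : Expansion} (hA : ∀ x, 0 < (E.A 0).1 x)
    (hf : ∀ x, 0 < (E.f 0).1 x) (a b : Fin 3) : ∃ d,
    singleCalc.J (par a ^^ par b) (-2) (E.resid R a b) (E.resid R a b)
      (ricB (singleVal hR E hA) a b - (bif par a ^^ par b then
        angInv (E.f 0 ^ 2) (pow_two_ne hf) * srcB (E.f 0) 1 a b else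
        srcB (E.f 0) (angInv (E.f 0 ^ 2) (pow_two_ne hf)) a b)) d ∧
      (a ≠ 0 → b ≠ 0 → d = ricD 1 (singleVal hR E hA) a b) := by
  obtain ⟨d, hd, hd0⟩ := source_jet singleCalc (single_f E) (single_b E) (fS_sq_inverse hf)
    (fS_sq_inverse hf) (mul_angInv (E.f 0 ^ 2) (pow_two_ne hf)) a b
  refine ⟨_, singleCalc.sub ((geom_single hR E hA).ricci a b) hd, fun ha hb => ?_⟩
  rw [hd0 ha hb, sub_zero]
  rfl

lemma resid_pair (hR : 0 < R) {n : ℕ} (hn : 2 ≤ (n : ℤ)) {E E' : Expansion} (h : Agree n E E')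
    (hA : ∀ x, 0 < (E.A 0).1 x) (hA' : ∀ x, 0 < (E'.A 0).1 x)
    (hf : ∀ x, 0 < (E.f 0).1 x) (hf' : ∀ x, 0 < (E'.f 0).1 x) (a b : Fin 3) : ∃ c d,
    (pairCalc n hn).J (par a ^^ par b) (-2) (E.resid R a b) (E'.resid R a b) c d ∧
      (a ≠ 0 → b ≠ 0 → d = ricD n (pairVal hR E E' hA n) a b) := by
  obtain ⟨d, hd, hd0⟩ := source_jet (pairCalc n hn) (pair_jet_ser hn 2 h.f) (pair_jet_ser hn 4 h.b)
    (fS_sq_inverse hf) (fS_sq_inverse hf') (mul_angInv (E.f 0 ^ 2) (pow_two_ne hf)) a b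
  refine ⟨_, _, (pairCalc n hn).sub ((geom_pair hR hn h hA hA').ricci a b) hd, fun ha hb => ?_⟩
  rw [hd0 ha hb, sub_zero]
  rfl

/-- An expansion solves the evolution equations up to the order `n`. -/
structure SolUpTo (R : ℝ) (n : ℕ) (E : Expansion) : Prop where
  r11 : Ord (n - 2) (E.resid R 1 1)
  r12 : Ord (n - 2) (E.resid R 1 2)
  r22 : Ord (n - 2) (E.resid R 2 2)
  re : Ord n (ernstRe (E.metric R) E.fS E.bS)
  im : Ord (n + 2) (ernstIm (E.metric R) E.fS E.bS)

lemma pair_even_coeff {n : ℕ} (hn : 2 ≤ (n : ℤ)) {m : ℤ} {u v : Ser} {a d : Ang}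
    (h : (pairCalc n hn).J false m u v a d) :
    Ord (m + n) (v - u) ∧ v.coeff (m + n) = u.coeff (m + n) + d := by
  obtain ⟨-, -, -, h4, h5⟩ := h
  simp only [cond_false, sub_zero] at h4 h5
  refine ⟨h4, ?_⟩
  rw [← h5, HahnSeries.coeff_sub, add_sub_cancel]

/-- The changes of the evolution equations at the order `n` if an expansion is changed from this
order on. -/
structure LevelChange (R : ℝ) (n : ℕ) (E E' : Expansion) (v : GVal) : Prop where
  r11 : (E'.resid R 1 1).coeff (n - 2) = (E.resid R 1 1).coeff (n - 2)
    + v.n * v.s * (-(((n : ℝ) + 1) • v.PP n) - v.QQ n - (2 : ℝ) • v.al - v.ell)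
  r22 : (E'.resid R 2 2).coeff (n - 2) = (E.resid R 2 2).coeff (n - 2)
    + v.n * v.q * (-(((n : ℝ) + 1) • v.QQ n) - v.PP n - (2 : ℝ) • v.al - v.ell)
  r12 : (E'.resid R 1 2).coeff (n - 2) = (E.resid R 1 2).coeff (n - 2)
    + (n : ℝ) • (v.n * v.W)
  re : (ernstRe (E'.metric R) E'.fS E'.bS).coeff n = (ernstRe (E.metric R) E.fS E.bS).coeff n
    + v.n * E.f 0 * ((n : ℝ) • ((n : ℝ) • (E'.f n - E.f n) - v.adv (E.f 0))
        + (2 : ℝ) • (E.f 0 * (v.PP n + v.QQ n + (2 - n : ℝ) • v.al + v.ell)))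
  im : (ernstIm (E'.metric R) E'.fS E'.bS).coeff (n + 2)
    = (ernstIm (E.metric R) E.fS E.bS).coeff (n + 2)
    + v.n * (E.f 0 * ((n : ℝ) • ((4 + n : ℝ) • (E'.b n - E.b n) - v.adv (E.b 0))
        - (4 : ℝ) • v.adv (E.b 0)
        + (4 : ℝ) • (E.b 0 * (v.PP n + v.QQ n + (2 - n : ℝ) • v.al + v.ell)))
        - (8 : ℝ) • (E.b 0 * ((n : ℝ) • (E'.f n - E.f n) - v.adv (E.f 0))))

/-- These are the variations computed by the pair calculus. The differences start only at the order
displayed, so everything achieved at lower orders persists. -/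
lemma levelChange (hR : 0 < R) {n : ℕ} (hn : 2 ≤ (n : ℤ)) {E E' : Expansion} (h : Agree n E E')
    (hA : ∀ x, 0 < (E.A 0).1 x) (hA' : ∀ x, 0 < (E'.A 0).1 x)
    (hf : ∀ x, 0 < (E.f 0).1 x) (hf' : ∀ x, 0 < (E'.f 0).1 x) :
    LevelChange R n E E' (pairVal hR E E' hA n) ∧ (SolUpTo R n E → SolUpTo R n E') := by
  have key : ∀ {m : ℤ} {u v : Ser}, Ord m (v - u) → Ord m u → Ord m v := fun h1 h2 => by
    have := h1.add h2
    rwa [sub_add_cancel] at this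
  obtain ⟨_, d11, h11, e11⟩ := resid_pair hR hn h hA hA' hf hf' 1 1
  obtain ⟨_, d22, h22, e22⟩ := resid_pair hR hn h hA hA' hf hf' 2 2
  obtain ⟨_, d12, h12, e12⟩ := resid_pair hR hn h hA hA' hf hf' 1 2
  have hre := (geom_pair hR hn h hA hA').ernstRe (pair_jet_ser hn 2 h.f) (pair_jet_ser hn 4 h.b)
  have him := (geom_pair hR hn h hA hA').ernstIm (pair_jet_ser hn 2 h.f) (pair_jet_ser hn 4 h.b)
  rw [geom_metric, geom_metric] at hre him
  have a11 := pair_even_coeff hn h11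
  have a22 := pair_even_coeff hn h22
  have a12 := pair_even_coeff hn h12
  have are := pair_even_coeff hn hre
  have aim := pair_even_coeff hn him
  rw [e11 (by decide) (by decide), ricD_one_one, show (-2 : ℤ) + n = n - 2 by ring] at a11
  rw [e22 (by decide) (by decide), ricD_two_two, show (-2 : ℤ) + n = n - 2 by ring] at a22
  rw [e12 (by decide) (by decide), ricD_one_two, show (-2 : ℤ) + n = n - 2 by ring] at a12
  rw [zero_add] at are
  rw [add_comm] at aim
  exact ⟨⟨a11.2, a22.2, a12.2, are.2, aim.2⟩, fun s => ⟨key a11.1 s.r11, key a12.1 s.r12,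
    key a22.1 s.r22, key are.1 s.re, key aim.1 s.im⟩⟩

lemma SolUpTo.succ {n : ℕ} {E : Expansion} (h : SolUpTo R n E)
    (r11 : (E.resid R 1 1).coeff (n - 2) = 0) (r12 : (E.resid R 1 2).coeff (n - 2) = 0)
    (r22 : (E.resid R 2 2).coeff (n - 2) = 0)
    (re : (ernstRe (E.metric R) E.fS E.bS).coeff n = 0)
    (im : (ernstIm (E.metric R) E.fS E.bS).coeff (n + 2) = 0) : SolUpTo R (n + 1) E where
  r11 := (h.r11.succ r11).mono (by push_cast; omega)
  r12 := (h.r12.succ r12).mono (by push_cast; omega)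
  r22 := (h.r22.succ r22).mono (by push_cast; omega)
  re := (h.re.succ re).mono (by push_cast; omega)
  im := (h.im.succ im).mono (by push_cast; omega)

end Expansion

end KillingHorizon

end

noncomputable section

namespace KillingHorizon

open scoped Shortcuts

/-! ### The constraints follow from the evolution equations -/

section Generic

variable {K : Type*} [CommRing K]

/-- A derivation over the integers, from an additive map satisfying the Leibniz rule. -/
def intDer (δ : K →+ K) (h : ∀ u v, δ (u * v) = u * δ v + v * δ u) : Derivation ℤ K K :=
  Derivation.mk' δ.toIntLinearMap h

/-- The antisymmetric part of the Ricci tensor of a symmetric connection is, up to sign, the trace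
of the curvature matrix. Metric compatibility makes this trace vanish. -/
lemma ricciOf_symm {D : Fin 3 → Derivation ℤ K K} {h k : Matrix (Fin 3) (Fin 3) K}
    {Γ : Fin 3 → Fin 3 → Fin 3 → K} (hD : ∀ a b u, D a (D b u) = D b (D a u)) (hk : h * k = 1)
    (hΓ : ∀ a b c, Γ a b c = Γ a c b)
    (compat : ∀ c, mder D c h = h * connMatrix Γ c + (connMatrix Γ c).transpose * h)
    (h2 : IsLeftRegular (2 : K)) (b c : Fin 3) : ricciOf D Γ b c = ricciOf D Γ c b := by
  have h1 := curvMatrix_antisymm hD compat b c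
  have kh : k * h = 1 := mul_eq_one_comm.1 hk
  have h3 : (curvMatrix D (connMatrix Γ) b c).trace = 0 := by
    have h4 := congrArg (fun M => (k * M).trace) h1
    simp only [Matrix.mul_add, Matrix.trace_add, Matrix.mul_zero, Matrix.trace_zero] at h4
    rw [← Matrix.mul_assoc, kh, Matrix.one_mul, ← Matrix.mul_assoc, Matrix.trace_mul_comm,
      ← Matrix.mul_assoc, hk, Matrix.one_mul, Matrix.trace_transpose] at h4
    apply h2
    simp only [mul_zero]
    rw [two_mul, h4]
  simp only [curvMatrix, Matrix.trace_add, Matrix.trace_sub, Matrix.trace_mul_comm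
    (connMatrix Γ c)] at h3
  simp only [Matrix.trace, Matrix.diag, mder, connMatrix, Matrix.map_apply, Matrix.of_apply,
    Fin.sum_univ_three, Matrix.mul_apply] at h3
  simp only [ricciOf, Matrix.of_apply, Fin.sum_univ_three]
  rw [hΓ 0 c b, hΓ 1 c b, hΓ 2 c b]
  linear_combination h3

end Generic

/-- The partial derivatives as derivations of the ring of formal series. -/
def serDer (a : Fin 3) := intDer (K := Ser) (pdHom a) fun u v => by
    change pd a (u * v) = u * pd a v + v * pd a u
    rw [pd_mul, mul_comm v]

lemma serDer_apply (a : Fin 3) (u : Ser) : serDer a u = pd a u := rfl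

lemma isLeftRegular_two : IsLeftRegular (2 : Ser) := by
  intro u v h
  simp only at h
  have e : ∀ w : Ser, (1 / 2 : ℝ) • (2 * w) = w := fun w => by
    rw [two_mul, ← two_smul ℝ w, smul_smul]; norm_num
  rw [← e u, ← e v, h]

namespace Geom

variable (g : Geom)

lemma metric_symm (a b : Fin 3) : g.metric a b = g.metric b a := by
  fin_cases a <;> fin_cases b <;> rfl

lemma inv_transpose : g.inv.transpose = g.inv := by
  refine Matrix.ext fun a b => ?_
  fin_cases a <;> fin_cases b <;> rfl

lemma christoffel_symm (a b c : Fin 3) :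
    christoffel g.metric a b c = christoffel g.metric a c b := by
  unfold christoffel
  refine Finset.sum_congr rfl fun d _ => ?_
  rw [g.metric_symm b c, add_comm (pd b _)]

/-- Lowering the index cancels the inverse metric and leaves the Christoffel symbols of the first
kind, from which compatibility follows by adding two of them. -/
lemma metric_mul_christoffel (a b c : Fin 3) : ∑ d, g.metric a d * christoffel g.metric d b c
    = (1 / 2 : ℝ) • (pd b (g.metric a c) + pd c (g.metric a b) - pd a (g.metric b c)) := by
  set L : Fin 3 → Ser :=
    fun e => (1 / 2 : ℝ) • (pd b (g.metric e c) + pd c (g.metric e b) - pd e (g.metric b c))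
  have h1 : ∀ d, christoffel g.metric d b c = ∑ e, g.inv d e * L e := fun d => by
    rw [christoffel_geom]
    refine Finset.sum_congr rfl fun e _ => ?_
    rw [mul_smul_comm]
  have h2 : ∀ e, ∑ d, g.metric a d * g.inv d e = (1 : Matrix (Fin 3) (Fin 3) Ser) a e := fun e => by
    rw [← g.metric_mul_inv, Matrix.mul_apply]
  calc ∑ d, g.metric a d * christoffel g.metric d b c
      = ∑ d, ∑ e, g.metric a d * g.inv d e * L e := by
        refine Finset.sum_congr rfl fun d _ => ?_
        rw [h1, Finset.mul_sum]
        exact Finset.sum_congr rfl fun e _ => (mul_assoc _ _ _).symm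
    _ = ∑ e, (∑ d, g.metric a d * g.inv d e) * L e := by
        rw [Finset.sum_comm]
        exact Finset.sum_congr rfl fun e _ => (Finset.sum_mul _ _ _).symm
    _ = L a := by
        simp only [h2, Matrix.one_apply, ite_mul, one_mul, zero_mul]
        rw [Finset.sum_ite_eq]
        simp

lemma compat (c : Fin 3) : mder serDer c g.metric
    = g.metric * connMatrix (christoffel g.metric) c
      + (connMatrix (christoffel g.metric) c).transpose * g.metric := by
  refine Matrix.ext fun a b => ?_
  simp only [mder, Matrix.map_apply, serDer_apply, Matrix.add_apply, Matrix.mul_apply,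
    Matrix.transpose_apply, connMatrix, Matrix.of_apply]
  rw [metric_mul_christoffel]
  have : ∑ d, christoffel g.metric d c a * g.metric d b
      = ∑ d, g.metric b d * christoffel g.metric d c a := by
    refine Finset.sum_congr rfl fun d _ => ?_
    rw [mul_comm, g.metric_symm]
  rw [this, metric_mul_christoffel, g.metric_symm b a, g.metric_symm c a, g.metric_symm c b,
    ← smul_add]
  rw [show pd c (g.metric a b) + pd b (g.metric a c) - pd a (g.metric b c)
    + (pd c (g.metric a b) + pd a (g.metric b c) - pd b (g.metric a c))
    = 2 * pd c (g.metric a b) by ring, two_mul, ← two_smul ℝ (pd c (g.metric a b)), smul_smul]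
  norm_num

end Geom

lemma divTrace_add (Γ : Fin 3 → Fin 3 → Fin 3 → Ser) (M M' : Matrix (Fin 3) (Fin 3) Ser)
    (e : Fin 3) : divTrace serDer Γ (M + M') e = divTrace serDer Γ M e + divTrace serDer Γ M' e := by
  simp only [divTrace, Matrix.add_apply, map_add, Fin.sum_univ_three]
  ring

namespace Expansion

variable {R : ℝ}

/-- The residual of the Ricci equations as a matrix. -/
def residM (R : ℝ) (E : Expansion) : Matrix (Fin 3) (Fin 3) Ser := Matrix.of (E.resid R)

/-- The residual satisfies a conservation law if the Ernst equation holds. -/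
lemma divTrace_resid (hR : 0 < R) {E : Expansion} (hA : ∀ x, 0 < (E.A 0).1 x)
    (hf : ∀ x, 0 < (E.f 0).1 x) (hre : ernstRe (E.metric R) E.fS E.bS = 0)
    (him : ernstIm (E.metric R) E.fS E.bS = 0) (e : Fin 3) :
    divTrace serDer (christoffel (E.metric R)) ((E.geom hR hA).inv * E.residM R) e = 0 := by
  set g := E.geom hR hA with hg
  have hgm : g.metric = E.metric R := rfl
  rw [← hgm] at hre him ⊢
  have hD : ∀ a b u, serDer a (serDer b u) = serDer b (serDer a u) := pd_comm
  have hv : E.fS * Ring.inverse E.fS = 1 :=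
    (ser_ord 2 E.f).mul_ringInverse (a := angInv (E.f 0) fun x => (hf x).ne')
      (by rw [ser_coeff_zero]; exact mul_angInv _ _)
  have hv2 : Ring.inverse (E.fS ^ 2) = Ring.inverse E.fS ^ 2 :=
    ringInverse_eq (by rw [← mul_pow, hv, one_pow])
  have h1 := divTrace_ricciOf hD g.metric_mul_inv g.inv_transpose g.christoffel_symm g.compat
    isLeftRegular_two e
  have h2 := divTrace_ernst hD g.metric_mul_inv g.inv_transpose g.christoffel_symm g.compat
    (p := E.fS) (q := E.bS) hv e
  have l : ∀ p, lapOf serDer g.inv (christoffel g.metric) p = lapS g.metric p := fun p => by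
    rw [lapS, g.metric_inv]; rfl
  have k : ∀ p q, gradOf serDer g.inv p q = gradS g.metric p q := fun p q => by
    rw [gradS, g.metric_inv]; rfl
  have ks : gradS g.metric E.bS E.fS = gradS g.metric E.fS E.bS := by
    simp only [gradS, g.metric_inv]
    rw [Finset.sum_comm]
    refine Finset.sum_congr rfl fun a _ => Finset.sum_congr rfl fun b _ => ?_
    have : g.inv b a = g.inv a b := congrFun (congrFun g.inv_transpose a) b
    rw [this, mul_comm (pd b _)]
  rw [ernstRe] at hre
  rw [ernstIm, ks, ← two_mul] at him
  rw [l, l, k, k, k, hre, him, zero_mul, zero_mul, add_zero, mul_zero] at h2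
  -- The source carries a factor 1/2 that the tensor in `divTrace_ernst` lacks; hence everything is
  -- doubled, and 2 is cancelled at the end.
  have e1 : g.inv * E.residM R + g.inv * E.residM R
      + g.inv * Matrix.of (fun b e => Ring.inverse E.fS ^ 2
        * (serDer b E.fS * serDer e E.fS + serDer b E.bS * serDer e E.bS))
      = g.inv * ricciOf serDer (christoffel g.metric)
        + g.inv * ricciOf serDer (christoffel g.metric) := by
    rw [← Matrix.mul_add, ← Matrix.mul_add, ← Matrix.mul_add]
    congr 1
    refine Matrix.ext fun a b => ?_
    have hr : ricciOf serDer (christoffel g.metric) a b = ricci g.metric a b := rfl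
    have hs : E.source a b + E.source a b = Ring.inverse E.fS ^ 2
        * (serDer a E.fS * serDer b E.fS + serDer a E.bS * serDer b E.bS) := by
      rw [source, hv2, ← two_smul ℝ, smul_smul]
      norm_num
      rfl
    simp only [Matrix.add_apply, residM, Matrix.of_apply, resid, ← hgm]
    rw [← hs, hr]
    ring
  have e2 := congrArg (fun M => divTrace serDer (christoffel g.metric) M e) e1
  simp only [divTrace_add, h1, h2, add_zero] at e2
  apply isLeftRegular_two
  simp only [mul_zero]
  rw [two_mul, e2]

end Expansion

/-! ### The conservation law to leading order. -/

section Values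

variable (v : GVal) (m : ℤ) (V : Matrix (Fin 3) (Fin 3) Ang)

/-- Leading coefficients of a tensor with one index raised. -/
def mixB (a e : Fin 3) : Ang :=
  ∑ b, mulB (par a ^^ par b) (par b ^^ par e) (v.kB a b) (V b e)

/-- Leading coefficients of the conservation law. -/
def divB (e : Fin 3) : Ang :=
  (2 : ℝ) • ∑ a, (pdB a (par a ^^ par e) m (mixB v V a e)
    + ∑ f, (mulB (chrPar a a f) (par f ^^ par e) (chrB v a a f) (mixB v V f e)
      - mulB (chrPar a e f) (par f ^^ par a) (chrB v a e f) (mixB v V f a)))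
    - pdB e false m (∑ a, mixB v V a a)

set_option maxHeartbeats 1000000 in
-- The weight is shifted so that m = 0 is the lowest order of the Ricci residual. The factor m
-- vanishes only there, so the constraints must be imposed at that order and propagate to all
-- others. The components 1 and 2 behave alike once `V₀` is known to vanish.
lemma divB_zero (V₀ V₁ V₂ : Ang) :
    divB v (m - 4) !![V₀, V₁, V₂; V₁, 0, 0; V₂, 0, 0] 0 = (m : ℝ) • (v.n * V₀) := by
  apply ang_ext; intro x
  obtain ⟨hN, hn⟩ := eval_inv v.hn x
  simp [divB, mixB, chrB, chrPar, Fin.sum_univ_three, par, mulB, pdB, GVal.kB, hn]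
  field_simp
  ring

set_option maxHeartbeats 1000000 in
lemma divB_one (V₁ V₂ : Ang) :
    divB v (m - 4) !![0, V₁, V₂; V₁, 0, 0; V₂, 0, 0] 1 = (2 * m : ℝ) • (v.n * V₁) := by
  apply ang_ext; intro x
  obtain ⟨hN, hn⟩ := eval_inv v.hn x
  obtain ⟨hs, hi⟩ := eval_inv v.hi x
  simp [divB, mixB, chrB, chrPar, Fin.sum_univ_three, par, mulB, pdB, dAng, GVal.kB, hn, hi]
  field_simp
  ring

set_option maxHeartbeats 1000000 in
lemma divB_two (V₁ V₂ : Ang) :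
    divB v (m - 4) !![0, V₁, V₂; V₁, 0, 0; V₂, 0, 0] 2 = (2 * m : ℝ) • (v.n * V₂) := by
  apply ang_ext; intro x
  obtain ⟨hN, hn⟩ := eval_inv v.hn x
  obtain ⟨hq, hj⟩ := eval_inv v.hj x
  simp [divB, mixB, chrB, chrPar, Fin.sum_univ_three, par, mulB, pdB, dAng, GVal.kB, hn, hj]
  field_simp
  ring

end Values

/-- A single series has a jet with the given leading coefficient. -/
def HasLead (p : Bool) (m : ℤ) (u : Ser) (a : Ang) : Prop := ∃ d, singleCalc.J p m u u a d

lemma HasLead.sum {p m} {u : Fin 3 → Ser} {a : Fin 3 → Ang} (h : ∀ k, HasLead p m (u k) (a k)) :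
    HasLead p m (∑ k, u k) (∑ k, a k) := by
  choose d hd using h
  exact ⟨_, singleCalc.sum hd⟩

lemma HasLead.eq_zero {p m a} (h : HasLead p m 0 a) : a = 0 := by
  obtain ⟨d, h⟩ := h
  exact h.2.1.symm

/-- Only leading coefficients matter here, so the second entry of each jet is kept existentially and
need not be computed. -/
lemma GeomJet.divTrace_lead {g : Geom} {v : GVal} (G : GeomJet singleCalc g g v) {m : ℤ}
    {M : Matrix (Fin 3) (Fin 3) Ser} {V : Matrix (Fin 3) (Fin 3) Ang}
    (hM : ∀ a b, HasLead (par a ^^ par b) (m + 2) (M a b) (V a b)) (e : Fin 3) :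
    HasLead (par e) (m - 1) (divTrace serDer (KillingHorizon.christoffel g.metric) (g.inv * M) e)
      (divB v m V e) := by
  have hmix : ∀ a e, HasLead (par a ^^ par e) m ((g.inv * M) a e) (mixB v V a e) := by
    intro a e
    rw [Matrix.mul_apply]
    refine HasLead.sum fun b => ?_
    obtain ⟨d, hd⟩ := hM b e
    refine ⟨_, singleCalc.congr (singleCalc.mul (G.inv a b) hd) ?_ (by ring) rfl rfl rfl rfl⟩
    cases par a <;> cases par b <;> cases par e <;> rfl
  have htr : HasLead false m (∑ a, (g.inv * M) a a) (∑ a, mixB v V a a) := by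
    refine HasLead.sum fun a => ?_
    have := hmix a a
    rwa [Bool.xor_self] at this
  have hdiv : HasLead (par e) (m - 1) (∑ a, (serDer a ((g.inv * M) a e)
      + ∑ f, (KillingHorizon.christoffel g.metric a a f * (g.inv * M) f e
        - KillingHorizon.christoffel g.metric a e f * (g.inv * M) f a)))
      (∑ a, (pdB a (par a ^^ par e) m (mixB v V a e)
    + ∑ f, (mulB (chrPar a a f) (par f ^^ par e) (chrB v a a f) (mixB v V f e)
      - mulB (chrPar a e f) (par f ^^ par a) (chrB v a e f) (mixB v V f a)))) := by
    refine HasLead.sum fun a => ?_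
    have h2 : HasLead (par e) (m - 1) (∑ f, (KillingHorizon.christoffel g.metric a a f
        * (g.inv * M) f e - KillingHorizon.christoffel g.metric a e f * (g.inv * M) f a))
        (∑ f, (mulB (chrPar a a f) (par f ^^ par e) (chrB v a a f) (mixB v V f e)
          - mulB (chrPar a e f) (par f ^^ par a) (chrB v a e f) (mixB v V f a))) := by
      refine HasLead.sum fun f => ?_
      obtain ⟨d1, k1⟩ := hmix f e
      obtain ⟨d2, k2⟩ := hmix f a
      have l1 := singleCalc.mul (G.chr a a f) k1
      have l2 := singleCalc.mul (G.chr a e f) k2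
      have p1 : (chrPar a a f ^^ (par f ^^ par e)) = par e := by
        unfold chrPar; cases par a <;> cases par f <;> cases par e <;> rfl
      have p2 : (chrPar a e f ^^ (par f ^^ par a)) = par e := by
        unfold chrPar; cases par a <;> cases par f <;> cases par e <;> rfl
      rw [p1, show -1 + m = m - 1 by ring] at l1
      rw [p2, show -1 + m = m - 1 by ring] at l2
      exact ⟨_, singleCalc.sub l1 l2⟩
    obtain ⟨d1, k1⟩ := hmix a e
    obtain ⟨d2, k2⟩ := h2
    have l1 := singleCalc.pd a k1
    have p1 : ((par a ^^ par e) ^^ par a) = par e := by cases par a <;> cases par e <;> rfl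
    rw [p1] at l1
    exact ⟨_, singleCalc.add l1 k2⟩
  obtain ⟨d1, k1⟩ := hdiv
  obtain ⟨d2, k2⟩ := htr
  refine ⟨_, singleCalc.congr (singleCalc.sub (singleCalc.smul 2 k1) (singleCalc.pdEven e k2)) rfl
    rfl ?_ ?_ rfl rfl⟩
  · rw [divTrace, two_smul, two_mul]; rfl
  · rw [divTrace, two_smul, two_mul]; rfl

end KillingHorizon

end

noncomputable section

namespace KillingHorizon

open scoped Shortcuts

/-! ### Propagation of the constraints. -/

lemma hasLead_symm {m : ℤ} {M : Matrix (Fin 3) (Fin 3) Ser} {V₀ V₁ V₂ : Ang}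
    (hs : ∀ a b, M a b = M b a) (h0 : HasLead false m (M 0 0) V₀) (h1 : HasLead true m (M 0 1) V₁)
    (h2 : HasLead true m (M 0 2) V₂) (h11 : M 1 1 = 0) (h12 : M 1 2 = 0) (h22 : M 2 2 = 0)
    (a b : Fin 3) : HasLead (par a ^^ par b) m (M a b)
      ((!![V₀, V₁, V₂; V₁, 0, 0; V₂, 0, 0] : Matrix (Fin 3) (Fin 3) Ang) a b) := by
  have lz : ∀ {u : Ser}, u = 0 → HasLead false m u 0 := by
    rintro _ rfl
    exact ⟨_, singleCalc.zero _ _⟩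
  fin_cases a <;> fin_cases b
  · exact h0
  · exact h1
  · exact h2
  · change HasLead true _ (M 1 0) V₁
    rw [hs 1 0]; exact h1
  · exact lz h11
  · exact lz h12
  · change HasLead true _ (M 2 0) V₂
    rw [hs 2 0]; exact h2
  · exact lz ((hs 2 1).trans h12)
  · exact lz h22

namespace Expansion

variable {R : ℝ}

lemma resid_symm (hR : 0 < R) {E : Expansion} (hA : ∀ x, 0 < (E.A 0).1 x) (a b : Fin 3) :
    E.resid R a b = E.resid R b a := by
  set g := E.geom hR hA
  have hs : E.source a b = E.source b a := by
    rw [source, source, mul_comm (pd a E.fS), mul_comm (pd a E.bS)]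
  have hr : ricci g.metric a b = ricci g.metric b a :=
    ricciOf_symm (D := serDer) pd_comm g.metric_mul_inv g.christoffel_symm g.compat
      isLeftRegular_two a b
  rw [resid, resid, hs, ← geom_metric hR E hA, hr]

/-- The constraints hold if the evolution equations hold and the constraints hold to leading
order. -/
lemma resid_eq_zero (hR : 0 < R) {E : Expansion} (hA : ∀ x, 0 < (E.A 0).1 x)
    (hf : ∀ x, 0 < (E.f 0).1 x) (hre : ernstRe (E.metric R) E.fS E.bS = 0)
    (him : ernstIm (E.metric R) E.fS E.bS = 0) (h11 : E.resid R 1 1 = 0)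
    (h12 : E.resid R 1 2 = 0) (h22 : E.resid R 2 2 = 0) (h00 : Ord (-1) (E.resid R 0 0))
    (h01 : Ord 0 (E.resid R 0 1)) (h02 : Ord 0 (E.resid R 0 2)) (a b : Fin 3) :
    E.resid R a b = 0 := by
  have hs := resid_symm (E := E) hR hA
  set v := singleVal hR E hA
  have hcancel : ∀ {c : ℝ} {u : Ang}, c ≠ 0 → c • (v.n * u) = 0 → u = 0 := by
    intro c u hc hu
    have h1 : v.n * u = 0 := (smul_eq_zero.1 hu).resolve_left hc
    calc u = v.N * v.n * u := by rw [v.hn, one_mul]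
      _ = v.N * (v.n * u) := mul_assoc _ _ _
      _ = 0 := by rw [h1, mul_zero]
  -- The rθ- and rφ-components are odd and run one order ahead of the rr-component. The step from m
  -- uses the conservation law with factor m + 1, which is nonzero.
  have key : ∀ m : ℕ, Ord (m - 1) (E.resid R 0 0) ∧ Ord m (E.resid R 0 1)
      ∧ Ord m (E.resid R 0 2) := by
    intro m
    induction m with
    | zero => exact ⟨by simpa using h00, by simpa using h01, by simpa using h02⟩
    | succ m ih =>
      obtain ⟨i0, i1, i2⟩ := ih
      have hm : ((m : ℝ) + 1) ≠ 0 := by positivity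
      obtain ⟨V₀, hV₀⟩ : ∃ V, (E.resid R 0 0).coeff (m - 1) = V := ⟨_, rfl⟩
      obtain ⟨V₁, hV₁⟩ : ∃ V, (E.resid R 0 1).coeff m = V := ⟨_, rfl⟩
      obtain ⟨V₂, hV₂⟩ : ∃ V, (E.resid R 0 2).coeff m = V := ⟨_, rfl⟩
      have l0 : HasLead false (((m + 1 : ℕ) : ℤ) - 4 + 2) (E.residM R 0 0) V₀ := by
        refine ⟨_, singleCalc.congr (single_jet_even (m := m - 1) _ i0) rfl ?_ rfl rfl hV₀ rfl⟩
        push_cast; omega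
      have lα : ∀ {u : Ser} {V : Ang}, Ord m u → u.coeff m = V →
          HasLead true (((m + 1 : ℕ) : ℤ) - 4 + 2) u V := by
        intro u V hu hV
        refine ⟨_, singleCalc.congr (single_jet_odd (m := m - 1) u (by simpa using hu)) rfl ?_
          rfl rfl (by simpa using hV) rfl⟩
        push_cast; omega
      have lead := hasLead_symm (M := E.residM R) hs l0 (lα i1 hV₁) (lα i2 hV₂) h11 h12 h22
      have div : ∀ e, divB v (((m + 1 : ℕ) : ℤ) - 4) !![V₀, V₁, V₂; V₁, 0, 0; V₂, 0, 0] e = 0 := by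
        intro e
        have := (geom_single hR E hA).divTrace_lead lead e
        rw [geom_metric, divTrace_resid hR hA hf hre him e] at this
        exact this.eq_zero
      have e0 := div 0
      rw [divB_zero] at e0
      have z0 : V₀ = 0 := hcancel (by push_cast; exact hm) e0
      -- The rr-component has to be removed first, since the angular derivative of the trace brings
      -- it into the other two components.
      rw [z0] at div
      have e1 := div 1
      have e2 := div 2
      rw [divB_one] at e1
      rw [divB_two] at e2
      have z1 : V₁ = 0 := hcancel (by push_cast; positivity) e1
      have z2 : V₂ = 0 := hcancel (by push_cast; positivity) e2
      exact ⟨(i0.succ (hV₀.trans z0)).mono (by push_cast; omega), (i1.succ (hV₁.trans z1)).mono (by push_cast; omega),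
        (i2.succ (hV₂.trans z2)).mono (by push_cast; omega)⟩
  have h00' : E.resid R 0 0 = 0 := Ord.eq_zero fun m => (key (m + 1).toNat).1.mono (by omega)
  have h01' : E.resid R 0 1 = 0 := Ord.eq_zero fun m => (key m.toNat).2.1.mono (by omega)
  have h02' : E.resid R 0 2 = 0 := Ord.eq_zero fun m => (key m.toNat).2.2.mono (by omega)
  fin_cases a <;> fin_cases b
  · exact h00'
  · exact h01'
  · exact h02'
  · exact (hs 1 0).trans h01'
  · exact h11
  · exact h12
  · exact (hs 2 0).trans h02'
  · exact (hs 2 1).trans h12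
  · exact h22

end Expansion

/-! ### The first two orders -/

/-- The domain of the angles is convex, hence connected; periodicity plays no role. -/
lemma ang_eq_const {a : Ang} (h1 : dθ a = 0) (h2 : dφ a = 0) : ∃ c : ℝ, a = c • (1 : Ang) := by
  have hc : IsPreconnected Angles := ((convex_Ioo 0 Real.pi).prod convex_univ).isPreconnected
  have hz : Set.EqOn (fderiv ℝ (ext a.1)) 0 Angles := by
    intro x hx
    have e1 : fderiv ℝ (ext a.1) x (1, 0) = 0 := congrFun (congrArg Subtype.val h1) ⟨x, hx⟩
    have e2 : fderiv ℝ (ext a.1) x (0, 1) = 0 := congrFun (congrArg Subtype.val h2) ⟨x, hx⟩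
    refine ContinuousLinearMap.ext fun w => ?_
    have : w = w.1 • ((1 : ℝ), (0 : ℝ)) + w.2 • ((0 : ℝ), (1 : ℝ)) := by ext <;> simp
    rw [this, map_add, map_smul, map_smul, e1, e2]
    simp
  have x₀ : Angles := ⟨(Real.pi / 2, 0), ⟨by constructor <;> linarith [Real.pi_pos], trivial⟩⟩
  refine ⟨a.1 x₀, ang_ext fun x => ?_⟩
  have := isOpen_angles.is_const_of_fderiv_eq_zero hc (a.2.1.differentiableOn (by simp)) hz x.2 x₀.2
  rw [ext_apply, ext_apply] at this
  simpa using this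

lemma single_even_iff {m : ℤ} {u v : Ser} {d : Ang} (h : singleCalc.J false m u v 0 d) :
    Ord (m + 2) u ↔ d = 0 := by
  obtain ⟨h1, h2, h3⟩ := h
  simp only [cond_false, add_zero] at h1 h2 h3
  refine ⟨fun h => by rw [← h3]; exact h _ (by omega), fun hd => ?_⟩
  exact ((h1.succ h2).succ (h3.trans hd)).mono (by omega)

namespace Expansion

variable {R : ℝ}

/-- At y⁻² the Ricci tensor and the source both have the coefficient 2, whatever f_0 and 𝒜_0 are. -/
lemma resid_zero_zero (hR : 0 < R) {E : Expansion} (hA : ∀ x, 0 < (E.A 0).1 x)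
    (hf : ∀ x, 0 < (E.f 0).1 x) : Ord (-1) (E.resid R 0 0) := by
  obtain ⟨d, ⟨h1, h2, -⟩, -⟩ := resid_single hR hA hf 0 0
  refine ((show Ord (-2) (E.resid R 0 0) by simpa [par] using h1).succ ?_)
  simp only [par, Matrix.cons_val_zero, Bool.xor_self, cond_false, add_zero] at h2
  rw [h2, ricB_eq]
  apply ang_ext; intro x
  obtain ⟨h3, h4⟩ := eval_inv (mul_angInv (E.f 0 ^ 2) (pow_two_ne hf)) x
  have h5 := (hf x).ne'
  simp [srcB, par, mulB, pdB, h4]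
  field_simp
  norm_num

/-- The coefficient of 1/y is the difference of the logarithmic derivatives of 𝒜_0 and f_0. -/
lemma resid_zero_ang (hR : 0 < R) {E : Expansion} (hA : ∀ x, 0 < (E.A 0).1 x)
    (hf : ∀ x, 0 < (E.f 0).1 x) (a : Fin 3) (ha : a ≠ 0) : Ord 0 (E.resid R 0 a) ↔
      E.f 0 * dAng a (E.A 0) = E.A 0 * dAng a (E.f 0) := by
  obtain ⟨d, ⟨h1, h2, -⟩, -⟩ := resid_single hR hA hf 0 a
  have hp : par a = true := by fin_cases a <;> simp_all [par]
  have hB : ricB (singleVal hR E hA) 0 a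
      = angInv (E.A 0 ^ 2) (pow_two_ne hA) * (E.A 0 * dAng a (E.A 0)) := by
    rw [ricB_eq]
    fin_cases a
    · exact absurd rfl ha
    all_goals
      apply ang_ext; intro x
      simp [baseVal, dAng, pow_two]
      ring
  rw [hB] at h2
  have h0 : par 0 = false := rfl
  rw [h0, hp] at h1 h2
  simp only [Bool.xor_true, Bool.not_false, cond_true, srcB, h0, hp, mulB, Bool.and_true,
    cond_false, pdB, if_true, ha, if_false, Int.reduceNeg, Int.reduceAdd] at h1 h2
  have e : Ord 0 (E.resid R 0 a) ↔ (E.resid R 0 a).coeff (-1) = 0 :=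
    ⟨fun h => h _ (by omega), fun h => h1.succ h⟩
  rw [e, h2]
  constructor
  · intro h
    apply ang_ext; intro x
    have hx := congrFun (congrArg Subtype.val h) x
    obtain ⟨-, h4⟩ := eval_inv (mul_angInv (E.f 0 ^ 2) (pow_two_ne hf)) x
    obtain ⟨-, h6⟩ := eval_inv (mul_angInv (E.A 0 ^ 2) (pow_two_ne hA)) x
    have h5 := (hf x).ne'
    have h7 := (hA x).ne'
    simp [h4, h6] at hx ⊢
    field_simp at hx
    linarith
  · intro h
    apply ang_ext; intro x
    have hx := congrFun (congrArg Subtype.val h) x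
    obtain ⟨-, h4⟩ := eval_inv (mul_angInv (E.f 0 ^ 2) (pow_two_ne hf)) x
    obtain ⟨-, h6⟩ := eval_inv (mul_angInv (E.A 0 ^ 2) (pow_two_ne hA)) x
    have h5 := (hf x).ne'
    have h7 := (hA x).ne'
    simp [h4, h6] at hx ⊢
    field_simp
    linarith

/-- The constraints hold to leading order if and only if the leading coefficients of the lapse and
of the norm of the Killing vector are proportional. -/
lemma resid_zero_ang_iff (hR : 0 < R) {E : Expansion} (hA : ∀ x, 0 < (E.A 0).1 x)
    (hf : ∀ x, 0 < (E.f 0).1 x) :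
    (Ord 0 (E.resid R 0 1) ∧ Ord 0 (E.resid R 0 2)) ↔ ∃ κ : ℝ, E.A 0 = κ • E.f 0 := by
  rw [resid_zero_ang hR hA hf 1 (by decide), resid_zero_ang hR hA hf 2 (by decide)]
  constructor
  · rintro ⟨h1, h2⟩
    have hF := mul_angInv (E.f 0) fun x => (hf x).ne'
    set F := angInv (E.f 0) fun x => (hf x).ne'
    have key : ∀ D : Derivation ℝ Ang Ang, E.f 0 * D (E.A 0) = E.A 0 * D (E.f 0) →
        D (E.A 0 * F) = 0 := by
      intro D h
      rw [Derivation.leibniz, der_of_mul_eq_one D hF, smul_eq_mul, smul_eq_mul]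
      linear_combination F ^ 2 * h - F * D (E.A 0) * hF
    obtain ⟨c, hc⟩ := ang_eq_const (key dθ h1) (key dφ h2)
    refine ⟨c, ?_⟩
    calc E.A 0 = E.A 0 * F * E.f 0 := by rw [mul_assoc, mul_comm F, hF, mul_one]
      _ = _ := by rw [hc, smul_one_mul]
  · rintro ⟨κ, h⟩
    simp only [h, Derivation.map_smul, smul_mul_assoc, mul_smul_comm, and_self]

/-- The evolution equations at the first two orders. -/
lemma solUpTo_two_iff (hR : 0 < R) {E : Expansion} (hA : ∀ x, 0 < (E.A 0).1 x)
    (hf : ∀ x, 0 < (E.f 0).1 x) : SolUpTo R 2 E ↔ E.A 1 = -(3 / (2 * R)) • E.A 0 ∧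
      E.f 1 = -(1 / R) • E.f 0 ∧ E.b 1 = -(2 / R) • E.b 0 := by
  set v := singleVal hR E hA with hv
  -- The shift has no variation at the first order, so all terms with τ or π disappear; the
  -- inhomogeneity comes from the expansions of r² and of s_φφ.
  have hX : v.X = 0 := by simp [GVal.X, hv, baseVal]
  have hZ : v.Z = 0 := by simp [GVal.Z, hv, baseVal]
  have hW : v.W = 0 := by simp [GVal.W, hv, baseVal]
  have hadv : ∀ a, v.adv a = 0 := fun a => by simp [GVal.adv, hv, baseVal]
  have hell : v.ell = 0 := by simp [GVal.ell, hadv]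
  have hal : ∀ x, v.al.1 x = (E.A 1).1 x / (E.A 0).1 x := fun x => by
    obtain ⟨-, h6⟩ := eval_inv (mul_angInv (E.A 0 ^ 2) (pow_two_ne hA)) x
    have h7 := (hA x).ne'
    simp [GVal.al, hv, baseVal, h6]
    field_simp
  have hPP : v.PP 1 = (1 / R) • 1 := by
    rw [GVal.PP, hX]
    apply ang_ext; intro x
    obtain ⟨-, h6⟩ := eval_inv (mul_angInv (E.A 0 ^ 2) (pow_two_ne hA)) x
    have h7 := (hA x).ne'
    simp [hal]
    simp [hv, baseVal, h6]
    field_simp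
    ring
  have hQQ : v.QQ 1 = -(1 / (2 * R)) • 1 - v.al := by
    rw [GVal.QQ, hZ]
    apply ang_ext; intro x
    obtain ⟨-, h6⟩ := eval_inv (mul_angInv _ four_sin_sq_ne) x
    have h7 := (sinTheta_pos x).ne'
    simp [hal]
    simp [hv, baseVal, h6]
    field_simp
  have hj : ∀ a b : Fin 3, a ≠ 0 → b ≠ 0 → (Ord 0 (E.resid R a b) ↔ ricD 1 v a b = 0) := by
    intro a b ha hb
    obtain ⟨d, hd, hd'⟩ := resid_single hR hA hf a b
    have hz : ricB v a b - (bif par a ^^ par b then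
        angInv (E.f 0 ^ 2) (pow_two_ne hf) * srcB (E.f 0) 1 a b else
        srcB (E.f 0) (angInv (E.f 0 ^ 2) (pow_two_ne hf)) a b) = 0 := by
      rw [ricB_eq]
      fin_cases a <;> fin_cases b <;> first | exact absurd rfl ha | exact absurd rfl hb |
        simp [par, srcB, mulB]
    have hp : (par a ^^ par b) = false := by
      fin_cases a <;> fin_cases b <;> first | exact absurd rfl ha | exact absurd rfl hb | rfl
    rw [← hd' ha hb]
    have := single_even_iff (singleCalc.congr hd hp rfl rfl rfl hz rfl)
    simpa using this
  have r11 := hj 1 1 (by decide) (by decide)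
  have r12 := hj 1 2 (by decide) (by decide)
  have r22 := hj 2 2 (by decide) (by decide)
  rw [ricD_one_one] at r11
  rw [ricD_two_two] at r22
  rw [ricD_one_two, hW, mul_zero, smul_zero] at r12
  have re := single_even_iff ((geom_single hR E hA).ernstRe (single_f E) (single_b E))
  have im := single_even_iff ((geom_single hR E hA).ernstIm (single_f E) (single_b E))
  rw [geom_metric] at re im
  have hiff : SolUpTo R 2 E ↔ Ord 0 (E.resid R 1 1) ∧ Ord 0 (E.resid R 2 2) ∧
      Ord (0 + 2) (ernstRe (E.metric R) E.fS E.bS)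
      ∧ Ord (2 + 2) (ernstIm (E.metric R) E.fS E.bS) := by
    constructor
    · intro h; exact ⟨by simpa using h.r11, by simpa using h.r22, by simpa using h.re, h.im⟩
    · rintro ⟨h1, h2, h3, h4⟩
      exact ⟨by simpa using h1, by simpa using r12.2 rfl, by simpa using h2, by simpa using h3,
        by simpa using h4⟩
  rw [hiff, r11, r22, re, im]
  change _ ∧ _ ∧ v.n * E.f 0 * (((1 : ℤ) : ℝ) • (((1 : ℤ) : ℝ) • E.f 1 - v.adv (E.f 0))
        + (2 : ℝ) • (E.f 0 * (v.PP 1 + v.QQ 1 + (2 - ((1 : ℤ) : ℝ)) • v.al + v.ell))) = 0 ∧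
      v.n * (E.f 0 * (((1 : ℤ) : ℝ) • ((4 + ((1 : ℤ) : ℝ)) • E.b 1 - v.adv (E.b 0))
        - (4 : ℝ) • v.adv (E.b 0)
        + (4 : ℝ) • (E.b 0 * (v.PP 1 + v.QQ 1 + (2 - ((1 : ℤ) : ℝ)) • v.al + v.ell)))
        - (8 : ℝ) • (E.b 0 * (((1 : ℤ) : ℝ) • E.f 1 - v.adv (E.f 0)))) = 0 ↔ _
  simp only [hadv, hell, hPP, hQQ]
  have ext_iff : ∀ a b : Ang, a = b ↔ ∀ x, a.1 x = b.1 x := fun a b =>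
    ⟨fun h x => by rw [h], ang_ext⟩
  simp only [ext_iff, ← forall_and]
  refine forall_congr' fun x => ?_
  obtain ⟨-, h6⟩ := eval_inv v.hn x
  have hN : v.N.1 x = (E.A 0).1 x ^ 2 := rfl
  have hs : v.s.1 x = R ^ 2 * (E.A 0).1 x ^ 2 := rfl
  have h7 := (hA x).ne'
  have h8 := (hf x).ne'
  simp [h6, hN, hs, hal, hR.ne', h7, h8]
  field_simp
  generalize (E.A 0).1 x = A₀ at *
  generalize (E.A 1).1 x = A₁ at *
  generalize (E.f 0).1 x = f₀ at *
  generalize (E.f 1).1 x = f₁ at *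
  generalize (E.b 0).1 x = b₀ at *
  generalize (E.b 1).1 x = b₁ at *
  constructor
  -- The φφ-equation is an identity at this order and is discarded.
  · rintro ⟨e1, -, e2, e3⟩
    have e4 : R * f₁ = -f₀ := by
      apply mul_left_cancel₀ h7
      linear_combination e2
    refine ⟨by linear_combination -e1, e4, ?_⟩
    apply mul_left_cancel₀ (mul_ne_zero h7 h8)
    linear_combination e3 / 10 + 8 / 5 * A₀ * b₀ * e4
  · rintro ⟨e1, e2, e3⟩
    refine ⟨by linear_combination -e1, Or.inr (by ring), by linear_combination A₀ * e2, ?_⟩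
    linear_combination 10 * A₀ * f₀ * e3 - 16 * A₀ * b₀ * e2

end Expansion

end KillingHorizon

end

noncomputable section

namespace KillingHorizon

open scoped Shortcuts

/-! ### Regularity of the axis -/

open Filter Topology

/-- Extension by limits up to θ = 0, composed with a clamp of θ to [0, 1]. A positive function
continuous on the whole plane makes the parametric integrals continuous without further hypotheses.
-/
lemma exists_axis_extension {g : Ang} {a : ℝ → ℝ} (hg : HasAxisValues g a)
    (hpos : ∀ x, 0 < g.1 x) (ha : ∀ φ, 0 < a φ) : ∃ h : ℝ → ℝ → ℝ,
    Continuous (Function.uncurry h) ∧ (∀ θ ∈ Set.Ioc (0 : ℝ) 1, ∀ φ, h θ φ = ext g.1 (θ, φ)) ∧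
      (∀ φ, h 0 φ = a φ) ∧ ∀ θ φ, 0 < h θ φ := by
  have h1π : (1 : ℝ) < Real.pi := by linarith [Real.pi_gt_three]
  have hlim : ∀ z ∈ Angles, Tendsto (ext g.1) (𝓝[Angles] z) (𝓝 (ext g.1 z)) := fun z hz =>
    (g.2.1.continuousOn z hz)
  have hcl : Set.Ico (0 : ℝ) Real.pi ×ˢ (Set.univ : Set ℝ) ⊆ closure Angles := by
    rw [Angles, closure_prod_eq, closure_Ioo Real.pi_pos.ne, closure_univ]
    exact Set.prod_mono Set.Ico_subset_Icc_self le_rfl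
  have hax : ∀ φ, extendFrom Angles (ext g.1) (0, φ) = a φ := fun φ =>
    extendFrom_eq (hcl ⟨⟨le_rfl, Real.pi_pos⟩, trivial⟩) (hg φ)
  have hin : ∀ z ∈ Angles, extendFrom Angles (ext g.1) z = ext g.1 z := fun z hz =>
    extendFrom_eq (subset_closure hz) (hlim z hz)
  have hcont : ContinuousOn (extendFrom Angles (ext g.1))
      (Set.Ico (0 : ℝ) Real.pi ×ˢ (Set.univ : Set ℝ)) := by
    refine continuousOn_extendFrom hcl fun z hz => ?_
    rcases hz.1.1.eq_or_lt with h0 | h0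
    · refine ⟨a z.2, ?_⟩
      have : z = (0, z.2) := Prod.ext h0.symm rfl
      rw [this]; exact hg _
    · exact ⟨_, hlim z ⟨⟨h0, hz.1.2⟩, trivial⟩⟩
  refine ⟨fun θ φ => extendFrom Angles (ext g.1) (max 0 (min θ 1), φ), ?_, ?_, ?_, ?_⟩
  · refine hcont.comp_continuous (by fun_prop) fun z => ⟨⟨le_max_left _ _, ?_⟩, trivial⟩
    exact max_lt Real.pi_pos ((min_le_right _ _).trans_lt h1π)
  · intro θ hθ φ
    simp only
    rw [min_eq_left hθ.2, max_eq_right hθ.1.le]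
    exact hin _ ⟨⟨hθ.1, hθ.2.trans_lt h1π⟩, trivial⟩
  · intro φ
    simp only
    rw [min_eq_left zero_le_one, max_self, hax]
  · intro θ φ
    simp only
    rcases (le_max_left 0 (min θ 1)).eq_or_lt with h0 | h0
    · rw [← h0, hax]; exact ha φ
    · have : ((max 0 (min θ 1), φ) : ℝ × ℝ) ∈ Angles :=
        ⟨⟨h0, max_lt Real.pi_pos ((min_le_right _ _).trans_lt h1π)⟩, trivial⟩
      rw [hin _ this, ext_of_mem _ this]
      exact hpos _

namespace Expansion

variable {R : ℝ}

lemma horizonPhi_apply (hR : 0 < R) {E : Expansion} (hf : ∀ x, 0 < (E.f 0).1 x) (x : Angles) :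
    (E.horizonPhi R).1 x = 4 * Real.sin x.1.1 ^ 2 / (E.f 0).1 x := by
  obtain ⟨w, hw, hw1, hw2⟩ := (ser_ord 2 E.f).exists_inverse
    (a := angInv (E.f 0) fun x => (hf x).ne') (by rw [ser_coeff_zero]; exact mul_angInv _ _)
  obtain ⟨-, h4⟩ := eval_inv (mul_angInv (E.f 0) fun x => (hf x).ne') x
  have := (sPhi_ord hR).coeff_mul hw1
  rw [sPhi_coeff hR, hw2] at this
  rw [horizonPhi, ringInverse_eq hw, show (0 : ℤ) = 2 + -2 by norm_num, this]
  simp [h4, div_eq_mul_inv]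
  exact (mul_assoc _ _ _).symm

lemma horizonTheta_apply {E : Expansion} (hf : ∀ x, 0 < (E.f 0).1 x) (x : Angles) :
    (E.horizonTheta R).1 x = R ^ 2 * (E.A 0).1 x ^ 2 / (E.f 0).1 x := by
  obtain ⟨w, hw, hw1, hw2⟩ := (ser_ord 2 E.f).exists_inverse
    (a := angInv (E.f 0) fun x => (hf x).ne') (by rw [ser_coeff_zero]; exact mul_angInv _ _)
  obtain ⟨-, h4⟩ := eval_inv (mul_angInv (E.f 0) fun x => (hf x).ne') x
  have := (sTheta_ord R E).coeff_mul hw1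
  rw [sTheta_coeff, hw2] at this
  rw [horizonTheta, ringInverse_eq hw, show (0 : ℤ) = 2 + -2 by norm_num, this]
  simp [h4, div_eq_mul_inv, mul_assoc]

/-- The limit of the quotient of circumference and radius of small circles around the axis. -/
lemma tendsto_circumference (hR : 0 < R) {E : Expansion} (hf : ∀ x, 0 < (E.f 0).1 x) {κ : ℝ}
    (hκ : 0 < κ) (hA : E.A 0 = κ • E.f 0) {a : ℝ → ℝ} (ha : HasAxisValues (E.f 0) a)
    (hpos : ∀ φ, 0 < a φ) (φ : ℝ) : Tendsto
    (fun θ : ℝ => (∫ ψ in (0 : ℝ)..(2 * Real.pi), Real.sqrt (ext (E.horizonPhi R).1 (θ, ψ)))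
      / ∫ t in (0 : ℝ)..θ, Real.sqrt (ext (E.horizonTheta R).1 (t, φ))) (𝓝[>] 0)
    (𝓝 (2 * (∫ ψ in (0 : ℝ)..(2 * Real.pi), (Real.sqrt (a ψ))⁻¹) / (R * κ * Real.sqrt (a φ)))) := by
  obtain ⟨h, hc, h1, h0, hp⟩ := exists_axis_extension ha hf hpos
  have h1π : (1 : ℝ) < Real.pi := by linarith [Real.pi_gt_three]
  have hcs : Continuous (Function.uncurry fun θ ψ => (Real.sqrt (h θ ψ))⁻¹) :=
    (Real.continuous_sqrt.comp hc).inv₀ fun z => (Real.sqrt_pos.2 (hp z.1 z.2)).ne'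
  set I : ℝ → ℝ := fun θ => ∫ ψ in (0 : ℝ)..(2 * Real.pi), (Real.sqrt (h θ ψ))⁻¹ with hI
  have hIc : Continuous I :=
    intervalIntegral.continuous_parametric_intervalIntegral_of_continuous' hcs 0 (2 * Real.pi)
  set J : ℝ → ℝ := fun θ => ∫ t in (0 : ℝ)..θ, Real.sqrt (h t φ) with hJ
  have hcφ : Continuous fun t => Real.sqrt (h t φ) :=
    Real.continuous_sqrt.comp (hc.comp (Continuous.prodMk_left φ))
  have hJd : HasDerivAt J (Real.sqrt (a φ)) 0 := by
    have := intervalIntegral.integral_hasDerivAt_right (hcφ.intervalIntegrable 0 0)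
      (hcφ.stronglyMeasurableAtFilter _ _) hcφ.continuousAt
    rwa [h0] at this
  -- Circumference and radius both vanish linearly: the former through sin θ, the latter by the
  -- fundamental theorem of calculus. Each is divided by θ before passing to the limit.
  have hJt : Tendsto (fun θ => θ⁻¹ * J θ) (𝓝[>] 0) (𝓝 (Real.sqrt (a φ))) := by
    have := hJd.tendsto_slope_zero_right
    simpa [hJ] using this
  have hst : Tendsto (fun θ => θ⁻¹ * Real.sin θ) (𝓝[>] 0) (𝓝 1) := by
    have := (Real.hasDerivAt_sin 0).tendsto_slope_zero_right
    simpa using this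
  have hIt : Tendsto I (𝓝[>] 0) (𝓝 (I 0)) := hIc.continuousAt.tendsto.mono_left inf_le_left
  have hsa : Real.sqrt (a φ) ≠ 0 := (Real.sqrt_pos.2 (hpos φ)).ne'
  have hlim := (((hst.mul hIt).div hJt hsa).const_mul (2 / (R * κ)))
  have hI0 : I 0 = ∫ ψ in (0 : ℝ)..(2 * Real.pi), (Real.sqrt (a ψ))⁻¹ := by simp only [hI, h0]
  have hval : 2 / (R * κ) * (1 * I 0 / Real.sqrt (a φ))
      = 2 * (∫ ψ in (0 : ℝ)..(2 * Real.pi), (Real.sqrt (a ψ))⁻¹) / (R * κ * Real.sqrt (a φ)) := by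
    rw [hI0]; field_simp
  rw [hval] at hlim
  refine hlim.congr' ?_
  have hmem : Set.Ioc (0 : ℝ) 1 ∈ 𝓝[>] (0 : ℝ) := Ioc_mem_nhdsGT one_pos
  filter_upwards [hmem] with θ hθ
  have hsin : 0 < Real.sin θ := Real.sin_pos_of_pos_of_lt_pi hθ.1 (hθ.2.trans_lt h1π)
  have e1 : (∫ ψ in (0 : ℝ)..(2 * Real.pi), Real.sqrt (ext (E.horizonPhi R).1 (θ, ψ)))
      = 2 * Real.sin θ * I θ := by
    rw [hI]
    rw [← intervalIntegral.integral_const_mul]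
    refine intervalIntegral.integral_congr fun ψ _ => ?_
    have hm : ((θ, ψ) : ℝ × ℝ) ∈ Angles := ⟨⟨hθ.1, hθ.2.trans_lt h1π⟩, trivial⟩
    rw [ext_of_mem _ hm, horizonPhi_apply hR hf, h1 θ hθ, ext_of_mem _ hm, Real.sqrt_div' _ (hf _).le,
      show 4 * Real.sin θ ^ 2 = (2 * Real.sin θ) ^ 2 by ring, Real.sqrt_sq (by positivity),
      div_eq_mul_inv]
  have e2 : (∫ t in (0 : ℝ)..θ, Real.sqrt (ext (E.horizonTheta R).1 (t, φ))) = R * κ * J θ := by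
    rw [hJ]
    rw [← intervalIntegral.integral_const_mul, intervalIntegral.integral_of_le hθ.1.le,
      intervalIntegral.integral_of_le hθ.1.le]
    refine MeasureTheory.setIntegral_congr_fun measurableSet_Ioc fun t ht => ?_
    have ht1 : t ∈ Set.Ioc (0 : ℝ) 1 := ⟨ht.1, ht.2.trans hθ.2⟩
    have hm : ((t, φ) : ℝ × ℝ) ∈ Angles := ⟨⟨ht1.1, ht1.2.trans_lt h1π⟩, trivial⟩
    rw [ext_of_mem _ hm, horizonTheta_apply hf, h1 t ht1, ext_of_mem _ hm, hA]
    have hfx := hf ⟨(t, φ), hm⟩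
    have : R ^ 2 * (κ • E.f 0).1 ⟨(t, φ), hm⟩ ^ 2 / (E.f 0).1 ⟨(t, φ), hm⟩
        = (R * κ) ^ 2 * (E.f 0).1 ⟨(t, φ), hm⟩ := by
      simp; field_simp
    rw [this, Real.sqrt_mul (sq_nonneg _), Real.sqrt_sq (by positivity)]
  rw [e1, e2]
  have := hθ.1.ne'
  have hJθ : J θ ≠ 0 ∨ J θ = 0 := ne_or_eq _ _
  rcases hJθ with hJθ | hJθ
  · simp only [Pi.div_apply]
    field_simp
  · simp [hJθ]

/-- In the limit of the quotient, the circumference does not depend on φ whereas the radius along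
the meridian φ is proportional to the square root of a(φ). A common limit 2π forces `a` to be
constant, and evaluating the integral gives κ. -/
lemma RegularAxis.const (hR : 0 < R) {E : Expansion} (hf : ∀ x, 0 < (E.f 0).1 x) {κ : ℝ}
    (hκ : 0 < κ) (hA : E.A 0 = κ • E.f 0) {a : ℝ → ℝ} (h : E.RegularAxis R a) :
    (∀ φ, a φ = a 0) ∧ κ = 2 / (R * a 0) := by
  set I := ∫ ψ in (0 : ℝ)..(2 * Real.pi), (Real.sqrt (a ψ))⁻¹ with hI
  have key : ∀ φ, I = Real.pi * (R * κ * Real.sqrt (a φ)) := fun φ => by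
    have e := tendsto_nhds_unique (tendsto_circumference hR hf hκ hA h.axis h.pos φ) (h.flat φ)
    have hs := Real.sqrt_pos.2 (h.pos φ)
    rw [div_eq_iff (by positivity)] at e
    linarith
  have hc : ∀ φ, a φ = a 0 := fun φ => by
    have e := (key φ).symm.trans (key 0)
    have hs : Real.sqrt (a φ) = Real.sqrt (a 0) :=
      mul_left_cancel₀ (mul_pos hR hκ).ne' (mul_left_cancel₀ Real.pi_pos.ne' e)
    exact (Real.sqrt_inj (h.pos φ).le (h.pos 0).le).1 hs
  refine ⟨hc, ?_⟩
  have e := key 0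
  rw [hI] at e
  simp only [hc, intervalIntegral.integral_const, smul_eq_mul, sub_zero] at e
  have hs := Real.sqrt_pos.2 (h.pos 0)
  have hsq := Real.sq_sqrt (h.pos 0).le
  have hp := Real.pi_pos
  rw [eq_div_iff (by have := h.pos 0; positivity), ← hsq]
  field_simp at e
  linarith

lemma RegularAxis.of_const (hR : 0 < R) {E : Expansion} (hf : ∀ x, 0 < (E.f 0).1 x)
    {a : ℝ → ℝ} (ha : HasAxisValues (E.f 0) a) (hpos : ∀ φ, 0 < a φ) (hd : ∀ φ, HasDerivAt a 0 φ)
    (hA : E.A 0 = (2 / (R * a 0)) • E.f 0) : E.RegularAxis R a := by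
  refine ⟨ha, hpos, fun φ => ?_⟩
  have h0 := hpos 0
  have hc : ∀ φ, a φ = a 0 := fun φ =>
    is_const_of_deriv_eq_zero (fun φ => (hd φ).differentiableAt) (fun φ => (hd φ).deriv) φ 0
  have := tendsto_circumference hR hf (by positivity) hA ha hpos φ
  convert this using 2
  simp only [hc, intervalIntegral.integral_const, smul_eq_mul, sub_zero]
  have hs := Real.sqrt_pos.2 h0
  have hsq := Real.sq_sqrt h0.le
  field_simp
  rw [hsq]

end Expansion

end KillingHorizon

end

noncomputable section

namespace KillingHorizon

/-! ### Functions of two real variables -/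

open Filter Topology MeasureTheory

/-- `p` and `q` are the partial derivatives of `f`. -/
structure HasPartials (f p q : ℝ × ℝ → ℝ) : Prop where
  fst : ∀ x y, HasDerivAt (fun s => f (s, y)) (p (x, y)) x
  snd : ∀ x y, HasDerivAt (fun s => f (x, s)) (q (x, y)) y

/-- The partial derivative with respect to the first variable. -/
def pd₁ (f : ℝ × ℝ → ℝ) (z : ℝ × ℝ) : ℝ := fderiv ℝ f z (1, 0)

/-- The partial derivative with respect to the second variable. -/
def pd₂ (f : ℝ × ℝ → ℝ) (z : ℝ × ℝ) : ℝ := fderiv ℝ f z (0, 1)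

lemma fderiv_eq_pd (f : ℝ × ℝ → ℝ) (z w : ℝ × ℝ) :
    fderiv ℝ f z w = w.1 * pd₁ f z + w.2 * pd₂ f z := by
  have : w = w.1 • ((1 : ℝ), (0 : ℝ)) + w.2 • ((0 : ℝ), (1 : ℝ)) := by ext <;> simp
  conv_lhs => rw [this, map_add, map_smul, map_smul]
  rfl

lemma contDiff_pd₁ {f : ℝ × ℝ → ℝ} (h : ContDiff ℝ ∞ f) : ContDiff ℝ ∞ (pd₁ f) :=
  (h.fderiv_right (m := ∞) (by simp)).clm_apply contDiff_const

lemma contDiff_pd₂ {f : ℝ × ℝ → ℝ} (h : ContDiff ℝ ∞ f) : ContDiff ℝ ∞ (pd₂ f) :=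
  (h.fderiv_right (m := ∞) (by simp)).clm_apply contDiff_const

/-- The chain rule along a curve. -/
lemma hasDerivAt_comp_curve {f : ℝ × ℝ → ℝ} {a b : ℝ → ℝ} {a' b' t : ℝ}
    (hf : DifferentiableAt ℝ f (a t, b t)) (ha : HasDerivAt a a' t) (hb : HasDerivAt b b' t) :
    HasDerivAt (fun s => f (a s, b s)) (a' * pd₁ f (a t, b t) + b' * pd₂ f (a t, b t)) t := by
  have := HasFDerivAt.comp_hasDerivAt (f := fun s => (a s, b s)) t hf.hasFDerivAt (ha.prodMk hb)
  rwa [fderiv_eq_pd] at this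

lemma hasPartials_pd {f : ℝ × ℝ → ℝ} (h : Differentiable ℝ f) : HasPartials f (pd₁ f) (pd₂ f) where
  fst x y := by
    simpa using hasDerivAt_comp_curve (h (x, y)) (hasDerivAt_id x) (hasDerivAt_const x y)
  snd x y := by
    simpa using hasDerivAt_comp_curve (h (x, y)) (hasDerivAt_const y x) (hasDerivAt_id y)

namespace HasPartials

variable {f p q : ℝ × ℝ → ℝ}

lemma hasFDerivAt (h : HasPartials f p q) (hp : Continuous p) (hq : Continuous q) (z : ℝ × ℝ) :
    HasFDerivAt f (p z • ContinuousLinearMap.fst ℝ ℝ ℝ + q z • ContinuousLinearMap.snd ℝ ℝ ℝ)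
      z := by
  have h1 := hasStrictFDerivAt_uncurry_coprod (u := z) (f := fun x y => f (x, y))
    (f₁ := fun x y => p (x, y) • ContinuousLinearMap.id ℝ ℝ)
    (f₂ := fun x y => q (x, y) • ContinuousLinearMap.id ℝ ℝ)
    (Eventually.of_forall fun v => by
      refine (h.fst v.1 v.2).hasFDerivAt.congr_fderiv (ContinuousLinearMap.ext fun r => ?_)
      change r * p v = p v * r
      exact mul_comm _ _)
    (Eventually.of_forall fun v => by
      refine (h.snd v.1 v.2).hasFDerivAt.congr_fderiv (ContinuousLinearMap.ext fun r => ?_)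
      change r * q v = q v * r
      exact mul_comm _ _)
    (by exact (hp.smul continuous_const).continuousAt)
    (by exact (hq.smul continuous_const).continuousAt)
  refine h1.hasFDerivAt.congr_fderiv (ContinuousLinearMap.ext fun r => ?_)
  rfl

lemma contDiff_succ (h : HasPartials f p q) {k : ℕ} (hp : ContDiff ℝ k p) (hq : ContDiff ℝ k q) :
    ContDiff ℝ (k + 1) f :=
  contDiff_succ_iff_hasFDerivAt.2 ⟨_, (hp.smul contDiff_const).add (hq.smul contDiff_const),
    h.hasFDerivAt hp.continuous hq.continuous⟩

lemma pd_eq (h : HasPartials f p q) (hf : Differentiable ℝ f) : pd₁ f = p ∧ pd₂ f = q :=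
  ⟨funext fun z => ((hasPartials_pd hf).fst z.1 z.2).unique (h.fst z.1 z.2),
    funext fun z => ((hasPartials_pd hf).snd z.1 z.2).unique (h.snd z.1 z.2)⟩

end HasPartials

/-- The bootstrap for unknowns whose derivatives are expressed by the unknowns themselves; a family
is needed since the components of a system gain regularity together. -/
lemma contDiff_infty_of_succ {ι : Type*} {f : ι → ℝ × ℝ → ℝ} (h0 : ∀ i, Continuous (f i))
    (h : ∀ k : ℕ, (∀ i, ContDiff ℝ k (f i)) → ∀ i, ContDiff ℝ (k + 1) (f i)) (i : ι) :
    ContDiff ℝ ∞ (f i) := by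
  have : ∀ k : ℕ, ∀ i, ContDiff ℝ k (f i) := by
    intro k
    induction k with
    | zero => exact fun i => contDiff_zero.2 (h0 i)
    | succ k ih => exact_mod_cast h k ih
  exact contDiff_infty.2 fun k => this k i

/-- The primitive with respect to the second variable. -/
def prim (w : ℝ × ℝ → ℝ) (z : ℝ × ℝ) : ℝ := ∫ s in (0 : ℝ)..z.2, w (z.1, s)

lemma continuous_prim {w : ℝ × ℝ → ℝ} (hw : Continuous w) : Continuous (prim w) :=
  intervalIntegral.continuous_parametric_intervalIntegral_of_continuous
    (f := fun (z : ℝ × ℝ) s => w (z.1, s)) (by fun_prop) continuous_snd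

lemma hasPartials_prim {w w₁ : ℝ × ℝ → ℝ} (hw : Continuous w) (hw₁ : Continuous w₁)
    (h : ∀ x y, HasDerivAt (fun s => w (s, y)) (w₁ (x, y)) x) :
    HasPartials (prim w) (prim w₁) w where
  fst x y := by
    obtain ⟨B, hB⟩ := (isCompact_Icc.prod isCompact_uIcc).exists_bound_of_continuousOn
      (s := Set.Icc (x - 1) (x + 1) ×ˢ Set.uIcc 0 y) hw₁.continuousOn
    refine (intervalIntegral.hasDerivAt_integral_of_dominated_loc_of_deriv_le
      (F := fun x s => w (x, s)) (F' := fun x s => w₁ (x, s)) (bound := fun _ => B)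
      (Icc_mem_nhds (by linarith) (by linarith) : Set.Icc (x - 1) (x + 1) ∈ 𝓝 x)
      (Eventually.of_forall fun x => by
        exact (hw.comp (Continuous.prodMk_right x)).aestronglyMeasurable)
      ((hw.comp (Continuous.prodMk_right x)).intervalIntegrable _ _)
      (hw₁.comp (Continuous.prodMk_right x)).aestronglyMeasurable
      (Eventually.of_forall fun t ht x hx => hB (x, t) ⟨hx, Set.uIoc_subset_uIcc ht⟩)
      intervalIntegrable_const
      (Eventually.of_forall fun t _ x _ => h x t)).2
  snd x y := by
    have hc : Continuous fun s => w (x, s) := hw.comp (Continuous.prodMk_right x)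
    exact intervalIntegral.integral_hasDerivAt_right (hc.intervalIntegrable 0 y)
      (hc.stronglyMeasurableAtFilter _ _) hc.continuousAt

lemma contDiff_prim {k : ℕ} {w : ℝ × ℝ → ℝ} (hw : ContDiff ℝ k w) : ContDiff ℝ k (prim w) := by
  induction k generalizing w with
  | zero => exact contDiff_zero.2 (continuous_prim (contDiff_zero.1 hw))
  | succ k ih =>
    have hw' : ContDiff ℝ (k + 1) w := by exact_mod_cast hw
    have h1 : ContDiff ℝ k (pd₁ w) := (hw'.fderiv_right le_rfl).clm_apply contDiff_const
    have hd : Differentiable ℝ w := hw'.differentiable (by simp)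
    exact_mod_cast (hasPartials_prim hw.continuous h1.continuous (hasPartials_pd hd).fst).contDiff_succ
      (ih h1) (hw.of_le (by norm_cast; omega))

lemma contDiff_prim_infty {w : ℝ × ℝ → ℝ} (hw : ContDiff ℝ ∞ w) : ContDiff ℝ ∞ (prim w) :=
  contDiff_infty.2 fun k => contDiff_prim (hw.of_le (by exact_mod_cast le_top))

/-- Integration gains a derivative in the second variable only. In the first variable the gain comes
from `w₁`, which the differential equation supplies with the same regularity as `w`. -/
lemma contDiff_prim_succ {k : ℕ} {w w₁ : ℝ × ℝ → ℝ} (hw : ContDiff ℝ k w) (hw₁ : ContDiff ℝ k w₁)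
    (h : ∀ x y, HasDerivAt (fun s => w (s, y)) (w₁ (x, y)) x) : ContDiff ℝ (k + 1) (prim w) :=
  (hasPartials_prim hw.continuous hw₁.continuous h).contDiff_succ (contDiff_prim hw₁) hw

/-! ### Volterra equations -/

/-- Each integration raises the power by one and divides by it; iteration produces the factorials
that make Picard series converge. -/
lemma abs_integral_le_pow {f : ℝ → ℝ} {a b C : ℝ} {j : ℕ}
    (h : ∀ s ∈ Set.uIcc a b, |f s| ≤ C * |s - a| ^ j) :
    |∫ s in a..b, f s| ≤ C * |b - a| ^ (j + 1) / (j + 1) := by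
  rcases le_total a b with hab | hab
  · have e : ∫ s in a..b, C * (s - a) ^ j = C * |b - a| ^ (j + 1) / (j + 1) := by
      rw [intervalIntegral.integral_const_mul,
        intervalIntegral.integral_comp_sub_right (fun s => s ^ j), integral_pow,
        abs_of_nonneg (sub_nonneg.2 hab)]
      simp [mul_div_assoc]
    rw [← e]
    rw [← Real.norm_eq_abs]
    refine intervalIntegral.norm_integral_le_of_norm_le (μ := volume) hab
      (ae_of_all _ fun s hs => ?_)
      (Continuous.intervalIntegrable (u := fun s => C * (s - a) ^ j) (by fun_prop) _ _)
    have := h s (Set.Icc_subset_uIcc ⟨hs.1.le, hs.2⟩)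
    rwa [abs_of_nonneg (sub_nonneg.2 hs.1.le)] at this
  · have e : ∫ s in b..a, C * (a - s) ^ j = C * |b - a| ^ (j + 1) / (j + 1) := by
      rw [intervalIntegral.integral_const_mul,
        intervalIntegral.integral_comp_sub_left (fun s => s ^ j), integral_pow,
        abs_of_nonpos (sub_nonpos.2 hab)]
      simp [mul_div_assoc]
    rw [← e, intervalIntegral.integral_symm, abs_neg]
    rw [← Real.norm_eq_abs]
    refine intervalIntegral.norm_integral_le_of_norm_le (μ := volume) hab
      (ae_of_all _ fun s hs => ?_)
      (Continuous.intervalIntegrable (u := fun s => C * (a - s) ^ j) (by fun_prop) _ _)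
    have := h s (Set.Icc_subset_uIcc' ⟨hs.1.le, hs.2⟩)
    rwa [abs_of_nonpos (sub_nonpos.2 hs.2), neg_sub] at this

/-- Existence of continuous solutions of Volterra equations, by Picard iteration. -/
lemma exists_volterra {E : Type*} [NormedAddCommGroup E] [CompleteSpace E] {m : ℝ × ℝ → ℝ}
    (hm : Continuous m) (hm0 : ∀ z, 0 ≤ m z) {Φ : (ℝ × ℝ → E) → ℝ × ℝ → E}
    (hΦ : ∀ u, Continuous u → Continuous (Φ u))
    (hK : ∀ L : ℝ, ∃ K, 0 ≤ K ∧ ∀ u w, Continuous u → Continuous w → ∀ B, 0 ≤ B → ∀ j : ℕ,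
      (∀ z ∈ Metric.closedBall 0 L, ‖u z - w z‖ ≤ B * m z ^ j) →
      ∀ z ∈ Metric.closedBall 0 L, ‖Φ u z - Φ w z‖ ≤ K * B * m z ^ (j + 1) / (j + 1)) :
    ∃ u, Continuous u ∧ Φ u = u := by
  set S : ℕ → ℝ × ℝ → E := fun n => Φ^[n] 0 with hS
  have hSs : ∀ n, S (n + 1) = Φ (S n) := fun n => Function.iterate_succ_apply' Φ n 0
  have hSc : ∀ n, Continuous (S n) := by
    intro n
    induction n with
    | zero => exact continuous_zero
    | succ n ih => rw [hSs]; exact hΦ _ ih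
  have key : ∀ L : ℝ, ∃ c : ℕ → ℝ, Summable c ∧ ∀ n, ∀ z ∈ Metric.closedBall (0 : ℝ × ℝ) L,
      ‖S (n + 1) z - S n z‖ ≤ c n := by
    intro L
    obtain ⟨K, hK0, hK⟩ := hK L
    obtain ⟨M, hM⟩ := (isCompact_closedBall (0 : ℝ × ℝ) L).exists_bound_of_continuousOn
      hm.continuousOn
    obtain ⟨B, hB⟩ := (isCompact_closedBall (0 : ℝ × ℝ) L).exists_bound_of_continuousOn
      (hSc 1).continuousOn
    -- The iterates start at zero. Applying the contraction hypothesis with j = n bounds the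
    -- successive differences by the terms of an exponential series.
    have hest : ∀ n : ℕ, ∀ z ∈ Metric.closedBall (0 : ℝ × ℝ) L,
        ‖S (n + 1) z - S n z‖ ≤ |B| * K ^ n / n.factorial * m z ^ n := by
      intro n
      induction n with
      | zero =>
        intro z hz
        have e : S 0 z = 0 := rfl
        rw [e, sub_zero]
        simpa using (hB z hz).trans (le_abs_self B)
      | succ n ih =>
        intro z hz
        have := hK _ _ (hSc (n + 1)) (hSc n) _ (by positivity) n ih z hz
        rw [← hSs, ← hSs] at this
        refine this.trans (le_of_eq ?_)
        rw [Nat.factorial_succ]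
        push_cast
        field_simp
        ring
    refine ⟨fun n => |B| * ((K * |M|) ^ n / n.factorial),
      (Real.summable_pow_div_factorial _).mul_left _, fun n z hz => (hest n z hz).trans ?_⟩
    have : m z ≤ |M| := (le_abs_self _).trans ((hM z hz).trans (le_abs_self _))
    calc |B| * K ^ n / n.factorial * m z ^ n ≤ |B| * K ^ n / n.factorial * |M| ^ n := by
          have := hm0 z; gcongr
      _ = |B| * ((K * |M|) ^ n / n.factorial) := by rw [mul_pow]; ring
  have hcau : ∀ z, ∃ l, Tendsto (fun n => S n z) atTop (𝓝 l) := by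
    intro z
    obtain ⟨c, hc, hcz⟩ := key ‖z‖
    refine cauchySeq_tendsto_of_complete (cauchySeq_of_dist_le_of_summable c (fun n => ?_) hc)
    rw [dist_comm, dist_eq_norm]
    exact hcz n z (by simp)
  choose u hu using hcau
  have htail : ∀ L : ℝ, ∃ r : ℕ → ℝ, Tendsto r atTop (𝓝 0) ∧ (∀ n, 0 ≤ r n) ∧
      ∀ n, ∀ z ∈ Metric.closedBall (0 : ℝ × ℝ) L, ‖u z - S n z‖ ≤ r n := by
    intro L
    obtain ⟨c, hc, hcz⟩ := key (max L 0)
    have c0 : ∀ n, 0 ≤ c n := fun n => (norm_nonneg _).trans (hcz n 0 (by simp))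
    refine ⟨fun n => ∑' k, c (n + k), ?_, fun n => tsum_nonneg fun k => c0 _, fun n z hz => ?_⟩
    · simpa [add_comm] using tendsto_sum_nat_add c
    · have := dist_le_tsum_of_dist_le_of_tendsto c (fun n => by
        rw [dist_comm, dist_eq_norm]
        exact hcz n z (Metric.closedBall_subset_closedBall (le_max_left _ _) hz)) hc (hu z) n
      rwa [dist_comm, dist_eq_norm] at this
  have hloc : TendstoLocallyUniformly S u atTop := by
    rw [Metric.tendstoLocallyUniformly_iff]
    intro ε hε z
    obtain ⟨r, hr, -, hrz⟩ := htail (‖z‖ + 1)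
    refine ⟨Metric.closedBall 0 (‖z‖ + 1), Metric.closedBall_mem_nhds_of_mem (by simp), ?_⟩
    filter_upwards [hr.eventually (gt_mem_nhds hε)] with n hn y hy
    rw [dist_eq_norm]
    exact (hrz n y hy).trans_lt hn
  have huc : Continuous u := hloc.continuous (Frequently.of_forall hSc)
  refine ⟨u, huc, funext fun z => ?_⟩
  obtain ⟨K, hK0, hK⟩ := hK ‖z‖
  obtain ⟨r, hr, hr0, hrz⟩ := htail ‖z‖
  have h1 : Tendsto (fun n => S (n + 1) z) atTop (𝓝 (Φ u z)) := by
    rw [tendsto_iff_norm_sub_tendsto_zero]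
    refine squeeze_zero (fun n => norm_nonneg _) (g := fun n => K * r n * m z) (fun n => ?_) ?_
    · rw [norm_sub_rev, hSs]
      have := hK u (S n) huc (hSc n) (r n) (hr0 n) 0 (by simpa using hrz n) z (by simp)
      simpa using this
    · simpa using (hr.const_mul K).mul_const (m z)
  exact tendsto_nhds_unique h1 ((tendsto_add_atTop_iff_nat 1).2 (hu z))

end KillingHorizon

end

noncomputable section

namespace KillingHorizon

/-! ### The characteristic initial value problem -/

open Filter Topology MeasureTheory

section Goursat

variable (b g e h : ℝ × ℝ → ℝ) (p q : ℝ → ℝ)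

/-- The integral operator of the system `∂_y U = b V + g`, `∂_x V = e U + h` with data `p`, `q` on
the diagonal. -/
def goursatOp (u : ℝ × ℝ → ℝ × ℝ) (z : ℝ × ℝ) : ℝ × ℝ :=
  (p z.1 + ∫ s in z.1..z.2, (b (z.1, s) * (u (z.1, s)).2 + g (z.1, s)),
    q z.2 + ∫ s in z.2..z.1, (e (s, z.2) * (u (s, z.2)).1 + h (s, z.2)))

lemma integral_eq_prim {w : ℝ × ℝ → ℝ} (hw : Continuous w) (x y : ℝ) :
    ∫ s in x..y, w (x, s) = prim w (x, y) - prim w (x, x) := by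
  have hc : Continuous fun s => w (x, s) := hw.comp (Continuous.prodMk_right x)
  exact (intervalIntegral.integral_interval_sub_left (hc.intervalIntegrable _ _)
    (hc.intervalIntegrable _ _)).symm

variable {b g e h p q}

/-- The solution of the characteristic initial value problem. -/
theorem exists_goursat (hb : ContDiff ℝ ∞ b) (hg : ContDiff ℝ ∞ g) (he : ContDiff ℝ ∞ e)
    (hh : ContDiff ℝ ∞ h) (hp : ContDiff ℝ ∞ p) (hq : ContDiff ℝ ∞ q) :
    ∃ U V : ℝ × ℝ → ℝ, ContDiff ℝ ∞ U ∧ ContDiff ℝ ∞ V ∧ (∀ z, pd₂ U z = b z * V z + g z) ∧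
      (∀ z, pd₁ V z = e z * U z + h z) ∧ ∀ s, U (s, s) = p s ∧ V (s, s) = q s := by
  have key : ∀ {w : ℝ × ℝ → ℝ}, Continuous w →
      Continuous fun z : ℝ × ℝ => ∫ s in z.1..z.2, w (z.1, s) := fun {w} hw => by
    have : (fun z : ℝ × ℝ => ∫ s in z.1..z.2, w (z.1, s))
        = fun z => prim w z - prim w (z.1, z.1) := funext fun z => integral_eq_prim hw _ _
    rw [this]
    have := continuous_prim hw
    fun_prop
  have hbc := hb.continuous
  have hgc := hg.continuous
  have hec := he.continuous
  have hhc := hh.continuous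
  have hpc := hp.continuous
  have hqc := hq.continuous
  -- The weight is the length of the integration paths, which run from the diagonal to the point in
  -- a coordinate direction and stay in any ball of the maximum norm containing the point.
  obtain ⟨u, hu, hfix⟩ := exists_volterra (m := fun z => |z.2 - z.1|)
    (Φ := goursatOp b g e h p q) (by fun_prop) (fun z => abs_nonneg _) (fun u hu => by
      have h1 := key (w := fun z => b z * (u z).2 + g z) (by fun_prop)
      have h2 := key (w := fun z => e z.swap * (u z.swap).1 + h z.swap) (by fun_prop)
      have h2' := h2.comp continuous_swap
      refine Continuous.prodMk (Continuous.add (by fun_prop) h1) (Continuous.add (by fun_prop) ?_)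
      exact h2') (fun L => by
      obtain ⟨K₁, hK₁⟩ := (isCompact_closedBall (0 : ℝ × ℝ) L).exists_bound_of_continuousOn
        hbc.continuousOn
      obtain ⟨K₂, hK₂⟩ := (isCompact_closedBall (0 : ℝ × ℝ) L).exists_bound_of_continuousOn
        hec.continuousOn
      refine ⟨max |K₁| |K₂|, by positivity, fun u w hu hw B hB j huw z hz => ?_⟩
      have hz' : |z.1| ≤ L ∧ |z.2| ≤ L := by
        simpa [Prod.norm_def] using hz
      have hmem : ∀ x y : ℝ, x ∈ Set.uIcc z.1 z.2 → y ∈ Set.uIcc z.1 z.2 →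
          (x, y) ∈ Metric.closedBall (0 : ℝ × ℝ) L := by
        have : ∀ x : ℝ, x ∈ Set.uIcc z.1 z.2 → |x| ≤ L := by
          intro x hx
          rw [abs_le] at hz' ⊢
          rw [abs_le] at hz'
          rcases Set.mem_uIcc.1 hx with h | h <;> constructor <;> linarith [hz'.1.1, hz'.1.2,
            hz'.2.1, hz'.2.2, h.1, h.2]
        intro x y hx hy
        simpa [Prod.norm_def] using ⟨this x hx, this y hy⟩
      have bound : ∀ {k d K : ℝ} {m : ℝ}, |k| ≤ K → K ≤ max |K₁| |K₂| → |d| ≤ B * m →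
          0 ≤ m → |k * d| ≤ max |K₁| |K₂| * B * m := by
        intro k d K m h1 h2 h3 h4
        rw [abs_mul, mul_assoc]
        exact mul_le_mul (h1.trans h2) h3 (abs_nonneg _) (by positivity)
      rw [Prod.norm_def]
      refine max_le ?_ ?_
      · have e1 : (goursatOp b g e h p q u z - goursatOp b g e h p q w z).1
            = ∫ s in z.1..z.2, b (z.1, s) * ((u (z.1, s)).2 - (w (z.1, s)).2) := by
          simp only [goursatOp, Prod.fst_sub, add_sub_add_left_eq_sub]
          rw [← intervalIntegral.integral_sub (Continuous.intervalIntegrable (by fun_prop) _ _)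
            (Continuous.intervalIntegrable (by fun_prop) _ _)]
          congr 1; funext s; ring
        rw [e1, Real.norm_eq_abs]
        refine abs_integral_le_pow fun s hs => ?_
        have hm := hmem z.1 s Set.left_mem_uIcc hs
        refine bound (hK₁ _ hm) ((le_abs_self _).trans (le_max_left _ _)) ?_ (by positivity)
        exact (norm_snd_le _).trans (huw _ hm)
      · have e1 : (goursatOp b g e h p q u z - goursatOp b g e h p q w z).2
            = ∫ s in z.2..z.1, e (s, z.2) * ((u (s, z.2)).1 - (w (s, z.2)).1) := by
          simp only [goursatOp, Prod.snd_sub, add_sub_add_left_eq_sub]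
          rw [← intervalIntegral.integral_sub (Continuous.intervalIntegrable (by fun_prop) _ _)
            (Continuous.intervalIntegrable (by fun_prop) _ _)]
          congr 1; funext s; ring
        rw [e1, Real.norm_eq_abs, abs_sub_comm]
        refine abs_integral_le_pow fun s hs => ?_
        rw [Set.uIcc_comm] at hs
        have hm := hmem s z.2 hs Set.right_mem_uIcc
        refine bound (hK₂ _ hm) ((le_abs_self _).trans (le_max_right _ _)) ?_ (by positivity)
        have := (norm_fst_le _).trans (huw _ hm)
        rwa [abs_sub_comm s z.2])
  set U : ℝ × ℝ → ℝ := fun z => (u z).1 with hU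
  set V : ℝ × ℝ → ℝ := fun z => (u z).2 with hV
  have hUc : Continuous U := hu.fst
  have hVc : Continuous V := hu.snd
  set w₁ : ℝ × ℝ → ℝ := fun z => b z * V z + g z with hw₁
  set w₂ : ℝ × ℝ → ℝ := fun z => e z.swap * U z.swap + h z.swap with hw₂
  have hw₁c : Continuous w₁ := by fun_prop
  have hw₂c : Continuous w₂ := by fun_prop
  have eU : U = fun z => p z.1 + (prim w₁ z - prim w₁ (z.1, z.1)) := by
    funext z
    have := congrArg Prod.fst (congrFun hfix z)
    rw [← integral_eq_prim hw₁c]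
    exact this.symm
  have eV : V = fun z => q z.2 + (prim w₂ z.swap - prim w₂ (z.2, z.2)) := by
    funext z
    have := congrArg Prod.snd (congrFun hfix z)
    have h2 := integral_eq_prim hw₂c z.2 z.1
    rw [Prod.swap, ← h2]
    exact this.symm
  have dU : ∀ x y, HasDerivAt (fun s => U (x, s)) (b (x, y) * V (x, y) + g (x, y)) y := by
    intro x y
    rw [eU]
    have hc : Continuous fun s => w₁ (x, s) := hw₁c.comp (Continuous.prodMk_right x)
    have := intervalIntegral.integral_hasDerivAt_right (hc.intervalIntegrable 0 y)
      (hc.stronglyMeasurableAtFilter _ _) hc.continuousAt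
    exact (this.sub_const (prim w₁ (x, x))).const_add (p x)
  have dV : ∀ x y, HasDerivAt (fun s => V (s, y)) (e (x, y) * U (x, y) + h (x, y)) x := by
    intro x y
    rw [eV]
    have hc : Continuous fun s => w₂ (y, s) := hw₂c.comp (Continuous.prodMk_right y)
    have := intervalIntegral.integral_hasDerivAt_right (hc.intervalIntegrable 0 x)
      (hc.stronglyMeasurableAtFilter _ _) hc.continuousAt
    exact (this.sub_const (prim w₂ (y, y))).const_add (q y)
  have pb := hasPartials_pd (hb.differentiable (by simp))
  have pg := hasPartials_pd (hg.differentiable (by simp))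
  have pe := hasPartials_pd (he.differentiable (by simp))
  have ph := hasPartials_pd (hh.differentiable (by simp))
  -- The derivative of `V` across the integration path is replaced by means of the other equation,
  -- so no regularity is lost.
  have dw₁ : ∀ x y, HasDerivAt (fun s => w₁ (s, y)) ((fun z => pd₁ b z * V z
      + b z * (e z * U z + h z) + pd₁ g z) (x, y)) x := fun x y =>
    ((pb.fst x y).mul (dV x y)).add (pg.fst x y)
  have dw₂ : ∀ x y, HasDerivAt (fun s => w₂ (s, y)) ((fun z => (pd₂ e z.swap * U z.swap
      + e z.swap * (b z.swap * V z.swap + g z.swap) + pd₂ h z.swap)) (x, y)) x := fun x y =>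
    ((pe.snd y x).mul (dU y x)).add (ph.snd y x)
  have inf : ∀ {f : ℝ × ℝ → ℝ}, ContDiff ℝ ∞ f → ∀ k : ℕ, ContDiff ℝ k f := fun hf k =>
    hf.of_le (by exact_mod_cast le_top)
  have inf' : ∀ {f : ℝ → ℝ}, ContDiff ℝ ∞ f → ∀ k : ℕ, ContDiff ℝ (k + 1) f := fun hf k =>
    hf.of_le (by exact_mod_cast le_top)
  have smooth : ∀ i : Bool, ContDiff ℝ ∞ (bif i then U else V) := by
    refine contDiff_infty_of_succ (by rintro (_ | _); exacts [hVc, hUc]) fun k hk => ?_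
    have hUk : ContDiff ℝ k U := hk true
    have hVk : ContDiff ℝ k V := hk false
    have b1 := inf hb k
    have b2 := inf (contDiff_pd₁ hb) k
    have g1 := inf hg k
    have g2 := inf (contDiff_pd₁ hg) k
    have e1 := inf he k
    have e2 := inf (contDiff_pd₂ he) k
    have h1 := inf hh k
    have h2 := inf (contDiff_pd₂ hh) k
    have sw : ContDiff ℝ k (Prod.swap : ℝ × ℝ → ℝ × ℝ) := contDiff_snd.prodMk contDiff_fst
    have sw' : ContDiff ℝ (k + 1) (Prod.swap : ℝ × ℝ → ℝ × ℝ) := contDiff_snd.prodMk contDiff_fst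
    have c1 := contDiff_prim_succ (k := k) ((b1.mul hVk).add g1)
      (((b2.mul hVk).add (b1.mul ((e1.mul hUk).add h1))).add g2) dw₁
    have c2 := contDiff_prim_succ (k := k)
      (((e1.comp sw).mul (hUk.comp sw)).add (h1.comp sw))
      ((((e2.comp sw).mul (hUk.comp sw)).add ((e1.comp sw).mul
        (((b1.comp sw).mul (hVk.comp sw)).add (g1.comp sw)))).add (h2.comp sw)) dw₂
    rintro (_ | _)
    · change ContDiff ℝ (k + 1) V
      rw [eV]
      exact ((inf' hq k).comp contDiff_snd).add
        ((c2.comp sw').sub (c2.comp (contDiff_snd.prodMk contDiff_snd)))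
    · change ContDiff ℝ (k + 1) U
      rw [eU]
      exact ((inf' hp k).comp contDiff_fst).add
        (c1.sub (c1.comp (contDiff_fst.prodMk contDiff_fst)))
  have hUs : ContDiff ℝ ∞ U := smooth true
  have hVs : ContDiff ℝ ∞ V := smooth false
  refine ⟨U, V, hUs, hVs, fun z => ?_, fun z => ?_, fun s => ⟨?_, ?_⟩⟩
  · exact ((hasPartials_pd (hUs.differentiable (by simp))).snd z.1 z.2).unique (dU z.1 z.2)
  · exact ((hasPartials_pd (hVs.differentiable (by simp))).fst z.1 z.2).unique (dV z.1 z.2)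
  · rw [eU]; simp
  · rw [eV]; simp

end Goursat

end KillingHorizon

end

noncomputable section

namespace KillingHorizon

/-! ### The flow of a scalar differential equation -/

open Filter Topology MeasureTheory

lemma linear_ode_eq {D A : ℝ → ℝ} (hA : Continuous A) (hD : ∀ s, HasDerivAt D (A s * D s) s)
    (t : ℝ) : D t = D 0 * Real.exp (∫ s in (0 : ℝ)..t, A s) := by
  have hI : ∀ s, HasDerivAt (fun t => ∫ s in (0 : ℝ)..t, A s) (A s) s := fun s =>
    intervalIntegral.integral_hasDerivAt_right (hA.intervalIntegrable 0 s)
      (hA.stronglyMeasurableAtFilter _ _) hA.continuousAt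
  have hE : ∀ s, HasDerivAt (fun t => D t * Real.exp (-∫ s in (0 : ℝ)..t, A s)) 0 s := fun s => by
    refine ((hD s).mul ((hI s).neg.exp)).congr_deriv ?_
    simp only [Pi.neg_apply]
    ring
  have := is_const_of_deriv_eq_zero (fun s => (hE s).differentiableAt) (fun s => (hE s).deriv) t 0
  simp only [intervalIntegral.integral_same, neg_zero, Real.exp_zero, mul_one] at this
  rw [← this, mul_assoc, ← Real.exp_add, neg_add_cancel, Real.exp_zero, mul_one]

/-- The averaged partial derivative. -/
def slope₂ (l : ℝ × ℝ → ℝ) (s a b : ℝ) : ℝ := ∫ σ in (0 : ℝ)..1, pd₂ l (s, b + σ * (a - b))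

/-- The mean value theorem in integral form: the difference of two trajectories solves an exactly
linear equation with continuous coefficient. -/
lemma sub_eq_slope₂ {l : ℝ × ℝ → ℝ} (hl : ContDiff ℝ ∞ l) (s a b : ℝ) :
    l (s, a) - l (s, b) = slope₂ l s a b * (a - b) := by
  have hc := (contDiff_pd₂ hl).continuous
  have h1 : ∀ σ ∈ Set.uIcc (0 : ℝ) 1, HasDerivAt (fun σ => l (s, b + σ * (a - b)))
      (pd₂ l (s, b + σ * (a - b)) * (a - b)) σ := fun σ _ => by
    have := hasDerivAt_comp_curve (f := l) (a := fun _ => s) (b := fun σ => b + σ * (a - b))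
      ((hl.differentiable (by simp)) _) (hasDerivAt_const σ s)
      (((hasDerivAt_id σ).mul_const (a - b)).const_add b)
    convert this using 1
    simp only [one_mul, zero_mul, zero_add]; ring
  have h2 := intervalIntegral.integral_eq_sub_of_hasDerivAt h1
    (Continuous.intervalIntegrable (by fun_prop) _ _)
  rw [intervalIntegral.integral_mul_const] at h2
  simpa [slope₂] using h2.symm

lemma abs_slope₂_le {l : ℝ × ℝ → ℝ} {K : ℝ} (hK : ∀ z, |pd₂ l z| ≤ K) (s a b : ℝ) :
    |slope₂ l s a b| ≤ K := by
  simpa [slope₂] using intervalIntegral.norm_integral_le_of_norm_le_const (a := 0) (b := 1) (C := K)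
    (f := fun σ => pd₂ l (s, b + σ * (a - b))) fun σ _ => hK (s, b + σ * (a - b))

lemma continuous_slope₂ {l : ℝ × ℝ → ℝ} (hl : ContDiff ℝ ∞ l) {X : Type*} [TopologicalSpace X]
    [FirstCountableTopology X] [LocallyCompactSpace X] {s a b : X → ℝ} (hs : Continuous s)
    (ha : Continuous a) (hb : Continuous b) : Continuous fun x => slope₂ l (s x) (a x) (b x) := by
  have hc := (contDiff_pd₂ hl).continuous
  exact intervalIntegral.continuous_parametric_intervalIntegral_of_continuous'
    (f := fun x σ => pd₂ l (s x, b x + σ * (a x - b x))) (by fun_prop) 0 1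

/-- A flow `F (t, x)` of the equation `dx/dt = l (t, x)`, starting at time zero. -/
structure IsFlow (l F : ℝ × ℝ → ℝ) : Prop where
  smooth : ContDiff ℝ ∞ F
  zero : ∀ x, F (0, x) = x
  fst : ∀ t x, HasDerivAt (fun s => F (s, x)) (l (t, F (t, x))) t
  pos : ∀ z, 0 < pd₂ F z

/-- The bound on the derivative makes Picard iteration global. By `linear_ode_eq` the difference
quotient in the initial value is an exponential of averaged slopes, and its limit is the positive
derivative of the flow. Smoothness then follows by bootstrapping. -/
lemma exists_flow {l : ℝ × ℝ → ℝ} (hl : ContDiff ℝ ∞ l) {K : ℝ} (hK : ∀ z, |pd₂ l z| ≤ K) :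
    ∃ F, IsFlow l F := by
  have hlc := hl.continuous
  obtain ⟨F, hF, hfix⟩ := exists_volterra (m := fun z => |z.1|)
    (Φ := fun f z => z.2 + ∫ s in (0 : ℝ)..z.1, l (s, f (s, z.2))) (by fun_prop)
    (fun z => abs_nonneg _) (fun f hf => by
      refine continuous_snd.add ?_
      exact (continuous_prim (w := fun z => l (z.2, f (z.2, z.1))) (by fun_prop)).comp
        continuous_swap) (fun L => by
      refine ⟨K, (abs_nonneg _).trans (hK 0), fun u w hu hw B hB j huw z hz => ?_⟩
      have e1 : (z.2 + ∫ s in (0 : ℝ)..z.1, l (s, u (s, z.2)))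
          - (z.2 + ∫ s in (0 : ℝ)..z.1, l (s, w (s, z.2)))
          = ∫ s in (0 : ℝ)..z.1, slope₂ l s (u (s, z.2)) (w (s, z.2))
            * (u (s, z.2) - w (s, z.2)) := by
        rw [add_sub_add_left_eq_sub, ← intervalIntegral.integral_sub
          (Continuous.intervalIntegrable (by fun_prop) _ _)
          (Continuous.intervalIntegrable (by fun_prop) _ _)]
        congr 1; funext s; exact sub_eq_slope₂ hl _ _ _
      rw [e1, Real.norm_eq_abs]
      have := abs_integral_le_pow (f := fun s => slope₂ l s (u (s, z.2)) (w (s, z.2))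
            * (u (s, z.2) - w (s, z.2))) (a := 0) (b := z.1) (C := K * B) (j := j) fun s hs => ?_
      · simpa using this
      · have hz' : |z.1| ≤ L ∧ |z.2| ≤ L := by simpa [Prod.norm_def] using hz
        have hs' : |s| ≤ |z.1| := by simpa using Set.abs_sub_left_of_mem_uIcc hs
        have hm : ((s, z.2) : ℝ × ℝ) ∈ Metric.closedBall (0 : ℝ × ℝ) L := by
          simpa [Prod.norm_def] using ⟨hs'.trans hz'.1, hz'.2⟩
        have h3 := huw _ hm
        rw [abs_mul, mul_assoc, sub_zero]
        exact mul_le_mul (abs_slope₂_le hK _ _ _) h3 (abs_nonneg _) ((abs_nonneg _).trans (hK 0)))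
  have hF' : ∀ z : ℝ × ℝ, F z = z.2 + ∫ s in (0 : ℝ)..z.1, l (s, F (s, z.2)) := fun z =>
    (congrFun hfix z).symm
  have hF0 : ∀ x, F (0, x) = x := fun x => by rw [hF']; simp
  have hFt : ∀ t x, HasDerivAt (fun s => F (s, x)) (l (t, F (t, x))) t := fun t x => by
    have hc : Continuous fun s => l (s, F (s, x)) := by fun_prop
    have := intervalIntegral.integral_hasDerivAt_right (hc.intervalIntegrable 0 t)
      (hc.stronglyMeasurableAtFilter _ _) hc.continuousAt
    refine (this.const_add x).congr_of_eventuallyEq (Eventually.of_forall fun s => hF' (s, x))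
  set k : ℝ × ℝ → ℝ := fun z => pd₂ l (z.2, F (z.2, z.1)) with hk
  have hkc : Continuous k := by
    have := (contDiff_pd₂ hl).continuous
    fun_prop
  have hFx : ∀ t x, HasDerivAt (fun y => F (t, y)) (Real.exp (prim k (x, t))) x := by
    intro t x
    have hc : Continuous fun y => Real.exp (∫ s in (0 : ℝ)..t, slope₂ l s (F (s, y)) (F (s, x))) := by
      refine Real.continuous_exp.comp ?_
      exact intervalIntegral.continuous_parametric_intervalIntegral_of_continuous'
        (f := fun y s => slope₂ l s (F (s, y)) (F (s, x)))
        (continuous_slope₂ hl (X := ℝ × ℝ) (by fun_prop) (by fun_prop) (by fun_prop)) 0 t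
    have hlim : Real.exp (∫ s in (0 : ℝ)..t, slope₂ l s (F (s, x)) (F (s, x)))
        = Real.exp (prim k (x, t)) := by
      simp [slope₂, prim, hk]
    rw [hasDerivAt_iff_tendsto_slope, ← hlim]
    refine (hc.tendsto x |>.mono_left inf_le_left).congr' ?_
    filter_upwards [self_mem_nhdsWithin] with y hy
    have hyx : y - x ≠ 0 := sub_ne_zero.2 hy
    have := linear_ode_eq (D := fun s => F (s, y) - F (s, x))
      (A := fun s => slope₂ l s (F (s, y)) (F (s, x)))
      (continuous_slope₂ hl (by fun_prop) (by fun_prop) (by fun_prop)) (fun s => by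
        rw [← sub_eq_slope₂ hl]
        exact (hFt s y).sub (hFt s x)) t
    simp only [hF0] at this
    rw [slope_def_field, this]
    field_simp
  have hpart : HasPartials F (fun z => l (z.1, F z)) (fun z => Real.exp (prim k z.swap)) :=
    ⟨hFt, hFx⟩
  have hsm : ContDiff ℝ ∞ F := by
    refine contDiff_infty_of_succ (ι := Unit) (f := fun _ => F) (fun _ => hF) (fun n hn _ => ?_) ()
    have hFn : ContDiff ℝ n F := hn ()
    have l1 : ContDiff ℝ n l := hl.of_le (by exact_mod_cast le_top)
    have l2 : ContDiff ℝ n (pd₂ l) := (contDiff_pd₂ hl).of_le (by exact_mod_cast le_top)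
    have sw : ContDiff ℝ n (Prod.swap : ℝ × ℝ → ℝ × ℝ) := contDiff_snd.prodMk contDiff_fst
    refine hpart.contDiff_succ (l1.comp (contDiff_fst.prodMk hFn)) ?_
    exact ((contDiff_prim (l2.comp (contDiff_snd.prodMk (hFn.comp sw)))).comp sw).exp
  refine ⟨F, hsm, hF0, hFt, fun z => ?_⟩
  rw [(hpart.pd_eq (hsm.differentiable (by simp))).2]
  exact Real.exp_pos _

namespace IsFlow

variable {l F : ℝ × ℝ → ℝ} {M : ℝ}

lemma abs_sub_le (h : IsFlow l F) (hM : ∀ z, |l z| ≤ M) (t s x : ℝ) :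
    |F (t, x) - F (s, x)| ≤ M * |t - s| := by
  have := Convex.norm_image_sub_le_of_norm_hasDerivWithin_le (s := Set.univ)
    (fun s _ => (h.fst s x).hasDerivWithinAt) (fun s _ => hM (s, F (s, x))) convex_univ
    (Set.mem_univ s) (Set.mem_univ t)
  simpa using this

end IsFlow

/-! ### Global inverses -/

/-- An invertible derivative, with inverse given by Cramer's rule, makes the map open. A continuous
open bijection is a homeomorphism, and its inverse is smooth by the inverse function theorem. -/
lemma exists_smooth_inverse {f g : ℝ × ℝ → ℝ} (hf : ContDiff ℝ ∞ f) (hg : ContDiff ℝ ∞ g)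
    (hdet : ∀ z, pd₁ f z * pd₂ g z - pd₂ f z * pd₁ g z ≠ 0)
    (hbij : Function.Bijective fun z => (f z, g z)) :
    ∃ Ψ : ℝ × ℝ → ℝ × ℝ, ContDiff ℝ ∞ Ψ ∧ (∀ z, Ψ (f z, g z) = z) ∧
      ∀ w, f (Ψ w) = w.1 ∧ g (Ψ w) = w.2 := by
  have hs : ContDiff ℝ ∞ fun z => (f z, g z) := hf.prodMk hg
  let π₁ := ContinuousLinearMap.fst ℝ ℝ ℝ
  let π₂ := ContinuousLinearMap.snd ℝ ℝ ℝ
  let L : ℝ × ℝ → (ℝ × ℝ) ≃L[ℝ] (ℝ × ℝ) := fun z =>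
    ContinuousLinearEquiv.equivOfInverse
      ((pd₁ f z • π₁ + pd₂ f z • π₂).prod (pd₁ g z • π₁ + pd₂ g z • π₂))
      ((pd₁ f z * pd₂ g z - pd₂ f z * pd₁ g z)⁻¹ •
        ((pd₂ g z • π₁ - pd₂ f z • π₂).prod (-(pd₁ g z • π₁) + pd₁ f z • π₂)))
      (fun w => by
        have := inv_mul_cancel₀ (hdet z)
        ext <;> simp [π₁, π₂] <;> [linear_combination w.1 * this; linear_combination w.2 * this])
      (fun w => by
        have := inv_mul_cancel₀ (hdet z)
        ext <;> simp [π₁, π₂] <;> [linear_combination w.1 * this; linear_combination w.2 * this])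
  have hL : ∀ z, HasFDerivAt (fun z => (f z, g z)) (L z : (ℝ × ℝ) →L[ℝ] (ℝ × ℝ)) z := fun z =>
    ((hasPartials_pd (hf.differentiable (by simp))).hasFDerivAt (contDiff_pd₁ hf).continuous
      (contDiff_pd₂ hf).continuous z).prodMk
    ((hasPartials_pd (hg.differentiable (by simp))).hasFDerivAt (contDiff_pd₁ hg).continuous
      (contDiff_pd₂ hg).continuous z)
  have hopen : IsOpenMap fun z => (f z, g z) :=
    isOpenMap_of_hasStrictFDerivAt_equiv (f' := L) fun z =>
      hs.contDiffAt.hasStrictFDerivAt' (hL z) (by simp)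
  let H : (ℝ × ℝ) ≃ₜ (ℝ × ℝ) :=
    (Equiv.ofBijective _ hbij).toHomeomorphOfContinuousOpen hs.continuous hopen
  refine ⟨H.symm, H.contDiff_symm hL hs, fun z => H.symm_apply_apply z, fun w => ?_⟩
  exact Prod.ext_iff.1 (H.apply_symm_apply w)

/-- The starting points of the trajectories of a flow. -/
structure IsFoot (l F ξ : ℝ × ℝ → ℝ) : Prop where
  smooth : ContDiff ℝ ∞ ξ
  left : ∀ t x, ξ (t, F (t, x)) = x
  right : ∀ t x, F (t, ξ (t, x)) = x
  pos : ∀ z, 0 < pd₂ ξ z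
  eq : ∀ z, pd₁ ξ z = -(l z * pd₂ ξ z)

/-- The map (t, x) ↦ (t, F(t, x)) is inverted. Each F(t, ·) is increasing, and onto because a
bounded speed moves points only a bounded distance in time t. The transport equation results from
differentiating ξ(t, F(t, y)) = y. -/
lemma IsFlow.exists_foot {l F : ℝ × ℝ → ℝ} {M : ℝ} (h : IsFlow l F) (hM : ∀ z, |l z| ≤ M) :
    ∃ ξ, IsFoot l F ξ := by
  have hFd := h.smooth.differentiable (by simp)
  have hFc := h.smooth.continuous
  have hmono : ∀ t, StrictMono fun x => F (t, x) := fun t =>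
    strictMono_of_deriv_pos fun x => by
      rw [((hasPartials_pd hFd).snd t x).deriv]; exact h.pos _
  have hb : ∀ t x, |F (t, x) - x| ≤ M * |t| := fun t x => by
    have := h.abs_sub_le hM t 0 x
    rwa [h.zero, sub_zero] at this
  have hsurj : ∀ t, Function.Surjective fun x => F (t, x) := fun t => by
    refine Continuous.surjective (by fun_prop) ?_ ?_
    · refine tendsto_atTop_mono (fun x => ?_) (tendsto_atTop_add_const_right atTop (-(M * |t|))
        tendsto_id)
      have := (abs_le.1 (hb t x)).1
      simp only [id]; linarith
    · refine tendsto_atBot_mono (fun x => ?_) (tendsto_atBot_add_const_right atBot (M * |t|)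
        tendsto_id)
      have := (abs_le.1 (hb t x)).2
      simp only [id]; linarith
  have p1 : ∀ z : ℝ × ℝ, pd₁ Prod.fst z = 1 ∧ pd₂ Prod.fst z = 0 := fun z => by
    simp [pd₁, pd₂, fderiv_fst]
  obtain ⟨Ψ, hΨ, h1, h2⟩ := exists_smooth_inverse (f := Prod.fst) (g := F) contDiff_fst h.smooth
    (fun z => by rw [(p1 z).1, (p1 z).2]; simpa using (h.pos z).ne')
    ⟨fun z w hzw => by
      obtain ⟨e1, e2⟩ := Prod.ext_iff.1 hzw
      obtain ⟨t, x⟩ := z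
      obtain ⟨t', x'⟩ := w
      obtain rfl : t = t' := e1
      rw [(hmono t).injective e2], fun w => by
      obtain ⟨x, hx⟩ := hsurj w.1 w.2
      exact ⟨(w.1, x), Prod.ext rfl hx⟩⟩
  set ξ : ℝ × ℝ → ℝ := fun z => (Ψ z).2 with hξ
  have hs : ContDiff ℝ ∞ ξ := hΨ.snd
  have left : ∀ t x, ξ (t, F (t, x)) = x := fun t x => congrArg Prod.snd (h1 (t, x))
  have right : ∀ t x, F (t, ξ (t, x)) = x := fun t x => by
    obtain ⟨e1, e2⟩ := h2 (t, x)
    have : Ψ (t, x) = (t, ξ (t, x)) := Prod.ext e1 rfl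
    rw [this] at e2
    exact e2
  have hsd := hs.differentiable (by simp)
  have key : ∀ t y, pd₂ ξ (t, F (t, y)) * pd₂ F (t, y) = 1 ∧
      pd₁ ξ (t, F (t, y)) = -(l (t, F (t, y)) * pd₂ ξ (t, F (t, y))) := by
    intro t y
    have d1 := hasDerivAt_comp_curve (f := ξ) (a := fun _ => t) (b := fun y => F (t, y)) (hsd _)
      (hasDerivAt_const y t) ((hasPartials_pd hFd).snd t y)
    have d2 := hasDerivAt_comp_curve (f := ξ) (a := fun s => s) (b := fun s => F (s, y)) (hsd _)
      (hasDerivAt_id t) (h.fst t y)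
    simp only [left] at d1 d2
    have e1 := d1.unique (hasDerivAt_id y)
    have e2 := d2.unique (hasDerivAt_const t y)
    constructor <;> linarith
  refine ⟨ξ, hs, left, right, fun z => ?_, fun z => ?_⟩
  · have := (key z.1 (ξ z)).1
    rw [show F (z.1, ξ z) = z.2 from right z.1 z.2] at this
    exact (pos_iff_pos_of_mul_pos (by rw [this]; exact one_pos)).2 (h.pos _)
  · have := (key z.1 (ξ z)).2
    rwa [show F (z.1, ξ z) = z.2 from right z.1 z.2] at this

end KillingHorizon

end

noncomputable section

namespace KillingHorizon

/-! ### Diagonal hyperbolic systems with bounded speed -/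

open Filter Topology MeasureTheory

lemma pd₂_prim {w : ℝ × ℝ → ℝ} (hw : ContDiff ℝ ∞ w) : pd₂ (prim w) = w :=
  ((hasPartials_prim hw.continuous (contDiff_pd₁ hw).continuous
    (hasPartials_pd (hw.differentiable (by simp))).fst).pd_eq
    ((contDiff_prim_infty hw).differentiable (by simp))).2

/-- The characteristic initial value problem for a general linear system. -/
theorem exists_goursat_linear {a b g e c h : ℝ × ℝ → ℝ} {p q : ℝ → ℝ} (ha : ContDiff ℝ ∞ a)
    (hb : ContDiff ℝ ∞ b) (hg : ContDiff ℝ ∞ g) (he : ContDiff ℝ ∞ e) (hc : ContDiff ℝ ∞ c)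
    (hh : ContDiff ℝ ∞ h) (hp : ContDiff ℝ ∞ p) (hq : ContDiff ℝ ∞ q) :
    ∃ U V : ℝ × ℝ → ℝ, ContDiff ℝ ∞ U ∧ ContDiff ℝ ∞ V ∧
      (∀ z, pd₂ U z = a z * U z + b z * V z + g z) ∧
      (∀ z, pd₁ V z = e z * U z + c z * V z + h z) ∧ ∀ s, U (s, s) = p s ∧ V (s, s) = q s := by
  have sw : ContDiff ℝ ∞ (Prod.swap : ℝ × ℝ → ℝ × ℝ) := contDiff_snd.prodMk contDiff_fst
  have diag : ContDiff ℝ ∞ fun s : ℝ => (s, s) := contDiff_id.prodMk contDiff_id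
  set A : ℝ × ℝ → ℝ := prim a with hA
  set G : ℝ × ℝ → ℝ := fun z => prim (fun z => c z.swap) z.swap with hG
  have As : ContDiff ℝ ∞ A := contDiff_prim_infty ha
  have Gs : ContDiff ℝ ∞ G := (contDiff_prim_infty (hc.comp sw)).comp sw
  have dA : ∀ x y, HasDerivAt (fun s => A (x, s)) (a (x, y)) y := fun x y => by
    have := (hasPartials_pd (As.differentiable (by simp))).snd x y
    rwa [hA, pd₂_prim ha] at this
  have dG : ∀ x y, HasDerivAt (fun s => G (s, y)) (c (x, y)) x := fun x y => by
    have := (hasPartials_pd ((contDiff_prim_infty (hc.comp sw)).differentiable (by simp))).snd y x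
    rwa [pd₂_prim (hc.comp sw)] at this
  -- Integrating factors remove the diagonal coefficients `a` and `c`.
  obtain ⟨U, V, hU, hV, h1, h2, h3⟩ := exists_goursat
    (b := fun z => b z * Real.exp (G z - A z)) (g := fun z => g z * Real.exp (-A z))
    (e := fun z => e z * Real.exp (A z - G z)) (h := fun z => h z * Real.exp (-G z))
    (p := fun s => p s * Real.exp (-A (s, s))) (q := fun s => q s * Real.exp (-G (s, s)))
    (hb.mul (Gs.sub As).exp) (hg.mul As.neg.exp) (he.mul (As.sub Gs).exp) (hh.mul Gs.neg.exp)
    (hp.mul (As.comp diag).neg.exp) (hq.mul (Gs.comp diag).neg.exp)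
  have hU' : ContDiff ℝ ∞ fun z => Real.exp (A z) * U z := As.exp.mul hU
  have hV' : ContDiff ℝ ∞ fun z => Real.exp (G z) * V z := Gs.exp.mul hV
  refine ⟨_, _, hU', hV', fun z => ?_, fun z => ?_, fun s => ?_⟩
  · have d1 := (hasPartials_pd (hU.differentiable (by simp))).snd z.1 z.2
    have d2 := ((dA z.1 z.2).exp).mul d1
    have d3 := (hasPartials_pd (hU'.differentiable (by simp))).snd z.1 z.2
    rw [d3.unique d2, h1]
    simp only [Real.exp_sub, Real.exp_neg]
    field_simp
    ring
  · have d1 := (hasPartials_pd (hV.differentiable (by simp))).fst z.1 z.2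
    have d2 := ((dG z.1 z.2).exp).mul d1
    have d3 := (hasPartials_pd (hV'.differentiable (by simp))).fst z.1 z.2
    rw [d3.unique d2, h2]
    simp only [Real.exp_sub, Real.exp_neg]
    field_simp
    ring
  · simp only [h3]
    constructor
    · rw [mul_left_comm, ← Real.exp_add]; simp
    · rw [mul_left_comm, ← Real.exp_add]; simp

lemma pd_comp {U ξ η : ℝ × ℝ → ℝ} (hU : ContDiff ℝ ∞ U) (hξ : ContDiff ℝ ∞ ξ)
    (hη : ContDiff ℝ ∞ η) (z : ℝ × ℝ) :
    pd₁ (fun z => U (ξ z, η z)) z = pd₁ ξ z * pd₁ U (ξ z, η z) + pd₁ η z * pd₂ U (ξ z, η z) ∧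
    pd₂ (fun z => U (ξ z, η z)) z = pd₂ ξ z * pd₁ U (ξ z, η z) + pd₂ η z * pd₂ U (ξ z, η z) := by
  have hd := (hasPartials_pd ((hU.comp (hξ.prodMk hη)).differentiable (by simp)))
  have hUd := hU.differentiable (by simp)
  have dξ := hasPartials_pd (hξ.differentiable (by simp))
  have dη := hasPartials_pd (hη.differentiable (by simp))
  exact ⟨(hd.fst z.1 z.2).unique (hasDerivAt_comp_curve (a := fun s => ξ (s, z.2))
      (b := fun s => η (s, z.2)) (hUd _) (dξ.fst z.1 z.2) (dη.fst z.1 z.2)),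
    (hd.snd z.1 z.2).unique (hasDerivAt_comp_curve (a := fun s => ξ (z.1, s))
      (b := fun s => η (z.1, s)) (hUd _) (dξ.snd z.1 z.2) (dη.snd z.1 z.2))⟩

lemma pd₂_neg (l : ℝ × ℝ → ℝ) (z : ℝ × ℝ) : pd₂ (fun z => -l z) z = -pd₂ l z := by
  have : fderiv ℝ (fun z => -l z) z = -fderiv ℝ l z := fderiv_fun_neg
  simp [pd₂, this]

/-- The characteristic coordinates are a bijection of the plane. -/
lemma bijective_feet {l F G ξ η : ℝ × ℝ → ℝ} {m : ℝ} (hm : 0 < m) (hml : ∀ z, m ≤ l z)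
    (hF : IsFlow l F) (hG : IsFlow (fun z => -l z) G) (hξ : IsFoot l F ξ)
    (hη : IsFoot (fun z => -l z) G η) : Function.Bijective fun z => (ξ z, η z) := by
  have hd : ∀ a b t, HasDerivAt (fun s => F (s, a) - G (s, b) - 2 * m * s)
      (l (t, F (t, a)) + l (t, G (t, b)) - 2 * m) t := fun a b t => by
    refine (((hF.fst t a).sub (hG.fst t b)).sub ((hasDerivAt_id t).const_mul (2 * m))).congr_deriv ?_
    ring
  -- A right-moving and a left-moving curve separate at a rate of at least 2m; hence any two of them
  -- meet exactly once.
  have hmono : ∀ a b, Monotone fun s => F (s, a) - G (s, b) - 2 * m * s := fun a b =>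
    monotone_of_deriv_nonneg (fun t => (hd a b t).differentiableAt) fun t => by
      rw [(hd a b t).deriv]
      linarith [hml (t, F (t, a)), hml (t, G (t, b))]
  have hstrict : ∀ a b, StrictMono fun s => F (s, a) - G (s, b) := fun a b s t hst => by
    have := hmono a b hst.le
    simp only at this ⊢
    nlinarith
  constructor
  · intro z w hzw
    obtain ⟨e1, e2⟩ := Prod.ext_iff.1 hzw
    simp only at e1 e2
    have z1 : F (z.1, ξ z) = z.2 := hξ.right z.1 z.2
    have z2 : G (z.1, η z) = z.2 := hη.right z.1 z.2
    have w1 : F (w.1, ξ w) = w.2 := hξ.right w.1 w.2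
    have w2 : G (w.1, η w) = w.2 := hη.right w.1 w.2
    have ht : z.1 = w.1 := (hstrict (ξ z) (η z)).injective (by
      rw [z1, z2, e1, e2, w1, w2, sub_self, sub_self])
    refine Prod.ext ht ?_
    rw [← z1, ht, e1, w1]
  · rintro ⟨a, b⟩
    have hc : Continuous fun s => F (s, a) - G (s, b) := by
      have := hF.smooth.continuous
      have := hG.smooth.continuous
      fun_prop
    have hl : Tendsto (fun s : ℝ => 2 * m * s) atTop atTop :=
      tendsto_id.const_mul_atTop (by positivity)
    have hl' : Tendsto (fun s : ℝ => 2 * m * s) atBot atBot :=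
      tendsto_id.const_mul_atBot (by positivity)
    set k := F (0, a) - G (0, b) - 2 * m * 0 with hk
    have hsurj : Function.Surjective fun s => F (s, a) - G (s, b) := by
      refine hc.surjective ?_ ?_
      · refine tendsto_atTop_mono' _ ?_ (tendsto_atTop_add_const_right _ k hl)
        filter_upwards [eventually_ge_atTop 0] with s hs
        have := hmono a b hs
        simp only at this
        linarith
      · refine tendsto_atBot_mono' _ ?_ (tendsto_atBot_add_const_right _ k hl')
        filter_upwards [eventually_le_atBot 0] with s hs
        have := hmono a b hs
        simp only at this
        linarith
    obtain ⟨t, ht⟩ := hsurj 0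
    have ht' : F (t, a) = G (t, b) := sub_eq_zero.1 ht
    refine ⟨(t, F (t, a)), Prod.ext (hξ.left t a) ?_⟩
    simp only
    rw [ht']
    exact hη.left t b

/-- The Cauchy problem for a diagonal hyperbolic system with bounded speed. -/
theorem exists_diagonal_of_bounded {l α₁ β₁ γ₁ α₂ β₂ γ₂ : ℝ × ℝ → ℝ} {p q : ℝ → ℝ} {m M K : ℝ}
    (hl : ContDiff ℝ ∞ l) (hm : 0 < m) (hml : ∀ z, m ≤ l z) (hM : ∀ z, |l z| ≤ M)
    (hK : ∀ z, |pd₂ l z| ≤ K) (h₁ : ContDiff ℝ ∞ α₁) (h₂ : ContDiff ℝ ∞ β₁)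
    (h₃ : ContDiff ℝ ∞ γ₁) (h₄ : ContDiff ℝ ∞ α₂) (h₅ : ContDiff ℝ ∞ β₂) (h₆ : ContDiff ℝ ∞ γ₂)
    (hp : ContDiff ℝ ∞ p) (hq : ContDiff ℝ ∞ q) :
    ∃ u v : ℝ × ℝ → ℝ, ContDiff ℝ ∞ u ∧ ContDiff ℝ ∞ v ∧
      (∀ z, pd₁ u z + l z * pd₂ u z = α₁ z * u z + β₁ z * v z + γ₁ z) ∧
      (∀ z, pd₁ v z - l z * pd₂ v z = α₂ z * u z + β₂ z * v z + γ₂ z) ∧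
      ∀ x, u (0, x) = p x ∧ v (0, x) = q x := by
  obtain ⟨F, hF⟩ := exists_flow hl hK
  obtain ⟨G, hG⟩ := exists_flow (l := fun z => -l z) hl.neg (K := K)
    (fun z => by rw [pd₂_neg, abs_neg]; exact hK z)
  obtain ⟨ξ, hξ⟩ := hF.exists_foot hM
  obtain ⟨η, hη⟩ := hG.exists_foot (M := M) (fun z => by rw [abs_neg]; exact hM z)
  have l0 : ∀ z, 0 < l z := fun z => hm.trans_le (hml z)
  have hxi : ∀ z, -(2 * l z * pd₂ ξ z) ≠ 0 := fun z => by
    have := l0 z; have := hξ.pos z; exact neg_ne_zero.2 (by positivity)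
  have het : ∀ z, 2 * l z * pd₂ η z ≠ 0 := fun z => by
    have := l0 z; have := hη.pos z; positivity
  -- By the transport equations the Jacobian determinant is -2 l ξ_x η_x.
  obtain ⟨Ψ, hΨ, i1, -⟩ := exists_smooth_inverse hξ.smooth hη.smooth (fun z => by
    rw [hξ.eq, hη.eq]
    have := l0 z; have := hξ.pos z; have := hη.pos z
    have : 0 < l z * pd₂ ξ z * pd₂ η z := by positivity
    intro h0
    linarith) (bijective_feet hm hml hF hG hξ hη)
  have sξ : ContDiff ℝ ∞ fun z => -(2 * l z * pd₂ ξ z) :=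
    ((contDiff_const.mul hl).mul (contDiff_pd₂ hξ.smooth)).neg
  have sη : ContDiff ℝ ∞ fun z => 2 * l z * pd₂ η z :=
    (contDiff_const.mul hl).mul (contDiff_pd₂ hη.smooth)
  have cη : ∀ {w : ℝ × ℝ → ℝ}, ContDiff ℝ ∞ w →
      ContDiff ℝ ∞ fun z => w (Ψ z) / (2 * l (Ψ z) * pd₂ η (Ψ z)) := fun hw =>
    (hw.div sη het).comp hΨ
  have cξ : ∀ {w : ℝ × ℝ → ℝ}, ContDiff ℝ ∞ w →
      ContDiff ℝ ∞ fun z => w (Ψ z) / (-(2 * l (Ψ z) * pd₂ ξ (Ψ z))) := fun hw =>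
    (hw.div sξ hxi).comp hΨ
  -- In the coordinates (ξ, η) the operators become ∂_t + l ∂_x = 2 l η_x ∂_η and ∂_t - l ∂_x = -2 l
  -- ξ_x ∂_ξ, and the line t = 0 becomes the diagonal.
  obtain ⟨U, V, hU, hV, e1, e2, e3⟩ := exists_goursat_linear (cη h₁) (cη h₂) (cη h₃) (cξ h₄) (cξ h₅)
    (cξ h₆) hp hq
  refine ⟨_, _, hU.comp (hξ.smooth.prodMk hη.smooth), hV.comp (hξ.smooth.prodMk hη.smooth),
    fun z => ?_, fun z => ?_, fun x => ?_⟩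
  · obtain ⟨d1, d2⟩ := pd_comp hU hξ.smooth hη.smooth z
    have e := e1 (ξ z, η z)
    have := het z
    rw [i1] at e
    simp only [Function.comp_def]
    rw [d1, d2, hξ.eq, hη.eq, e]
    have := l0 z; have := hη.pos z
    field_simp
    ring
  · obtain ⟨d1, d2⟩ := pd_comp hV hξ.smooth hη.smooth z
    have e := e2 (ξ z, η z)
    have := hxi z
    rw [i1] at e
    simp only [Function.comp_def]
    rw [d1, d2, hξ.eq, hη.eq, e]
    have := l0 z; have := hξ.pos z
    field_simp
    ring
  · have x1 : ξ (0, x) = x := by have := hξ.left 0 x; rwa [hF.zero] at this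
    have x2 : η (0, x) = x := by have := hη.left 0 x; rwa [hG.zero] at this
    simp only [Function.comp_def, x1, x2]
    exact e3 x

/-- Integration of a transport equation over a cone of dependence. -/
lemma abs_le_of_transport {l F ξ u w : ℝ × ℝ → ℝ} {M L R C : ℝ} {j : ℕ} (hF : IsFlow l F)
    (hξ : IsFoot l F ξ) (hM : ∀ z, |l z| ≤ M) (hu : ContDiff ℝ ∞ u) (hw : Continuous w)
    (heq : ∀ z : ℝ × ℝ, |z.1| ≤ L → pd₁ u z + l z * pd₂ u z = w z) (h0 : ∀ x, u (0, x) = 0)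
    (hb : ∀ z : ℝ × ℝ, |z.1| ≤ L → |z.2| ≤ R - M * |z.1| → |w z| ≤ C * |z.1| ^ j) (z : ℝ × ℝ)
    (hz : |z.1| ≤ L) (hz' : |z.2| ≤ R - M * |z.1|) :
    |u z| ≤ C * |z.1| ^ (j + 1) / (j + 1) := by
  have hFc := hF.smooth.continuous
  set y := ξ z with hy
  have hzy : F (z.1, y) = z.2 := hξ.right z.1 z.2
  have hle : ∀ s ∈ Set.uIcc 0 z.1, |s| ≤ |z.1| ∧ |z.1 - s| = |z.1| - |s| := by
    intro s hs
    rcases Set.mem_uIcc.1 hs with h | h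
    · rw [abs_of_nonneg h.1, abs_of_nonneg (h.1.trans h.2), abs_of_nonneg (sub_nonneg.2 h.2)]
      exact ⟨h.2, rfl⟩
    · rw [abs_of_nonpos h.2, abs_of_nonpos (h.1.trans h.2), abs_of_nonpos (sub_nonpos.2 h.1)]
      constructor <;> linarith [h.1]
  have hd : ∀ s ∈ Set.uIcc 0 z.1, HasDerivAt (fun s => u (s, F (s, y))) (w (s, F (s, y))) s := by
    intro s hs
    have := hasDerivAt_comp_curve (f := u) (a := fun s => s) (b := fun s => F (s, y))
      (hu.differentiable (by simp) _) (hasDerivAt_id s) (hF.fst s y)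
    rwa [one_mul, heq (s, F (s, y)) ((hle s hs).1.trans hz)] at this
  have hI := intervalIntegral.integral_eq_sub_of_hasDerivAt hd
    (Continuous.intervalIntegrable (by fun_prop) _ _)
  simp only [h0, sub_zero, hzy] at hI
  have hest := abs_integral_le_pow (f := fun s => w (s, F (s, y))) (a := 0) (b := z.1) (C := C)
    (j := j) fun s hs => by
      rw [sub_zero]
      obtain ⟨l1, l2⟩ := hle s hs
      refine hb (s, F (s, y)) (l1.trans hz) ?_
      -- The characteristic through z moves at speed at most M, so it stays in the cone on its way
      -- back to t = 0.
      have h1 := hF.abs_sub_le hM s z.1 y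
      rw [hzy, abs_sub_comm s, l2] at h1
      have h2 : |F (s, y)| ≤ |F (s, y) - z.2| + |z.2| := by
        simpa using abs_add_le (F (s, y) - z.2) z.2
      simp only
      linarith
  rw [hI, sub_zero] at hest
  exact hest

/-- Uniqueness for the Cauchy problem in a strip. -/
theorem diagonal_unique_strip {l α₁ β₁ α₂ β₂ u v : ℝ × ℝ → ℝ} {M K L : ℝ}
    (hl : ContDiff ℝ ∞ l) (hM : ∀ z, |l z| ≤ M) (hK : ∀ z, |pd₂ l z| ≤ K) (h₁ : Continuous α₁)
    (h₂ : Continuous β₁) (h₃ : Continuous α₂) (h₄ : Continuous β₂) (hu : ContDiff ℝ ∞ u)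
    (hv : ContDiff ℝ ∞ v)
    (e1 : ∀ z : ℝ × ℝ, |z.1| ≤ L → pd₁ u z + l z * pd₂ u z = α₁ z * u z + β₁ z * v z)
    (e2 : ∀ z : ℝ × ℝ, |z.1| ≤ L → pd₁ v z - l z * pd₂ v z = α₂ z * u z + β₂ z * v z)
    (h0 : ∀ x, u (0, x) = 0 ∧ v (0, x) = 0) (z : ℝ × ℝ) (hz : |z.1| ≤ L) :
    u z = 0 ∧ v z = 0 := by
  obtain ⟨F, hF⟩ := exists_flow hl hK
  have hM' : ∀ z, |(fun z => -l z) z| ≤ M := fun z => by rw [abs_neg]; exact hM z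
  obtain ⟨G, hG⟩ := exists_flow (l := fun z => -l z) hl.neg (K := K)
    (fun z => by rw [pd₂_neg, abs_neg]; exact hK z)
  obtain ⟨ξ, hξ⟩ := hF.exists_foot hM
  obtain ⟨η, hη⟩ := hG.exists_foot hM'
  have huc := hu.continuous
  have hvc := hv.continuous
  have M0 : 0 ≤ M := (abs_nonneg _).trans (hM 0)
  -- The smallest cone of dependence that contains the given point.
  set R := |z.2| + M * |z.1| with hR
  have hmem : ∀ w : ℝ × ℝ, |w.1| ≤ L → |w.2| ≤ R - M * |w.1| →
      w ∈ Metric.closedBall (0 : ℝ × ℝ) (max L R) := fun w h h' => by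
    have : 0 ≤ M * |w.1| := by positivity
    simp only [mem_closedBall_zero_iff, Prod.norm_def, Real.norm_eq_abs]
    exact max_le (h.trans (le_max_left _ _)) ((h'.trans (by linarith)).trans (le_max_right _ _))
  obtain ⟨B, hB⟩ := (isCompact_closedBall (0 : ℝ × ℝ) (max L R)).exists_bound_of_continuousOn
    (f := fun z => |u z| + |v z|) (by fun_prop)
  obtain ⟨D, hD⟩ := (isCompact_closedBall (0 : ℝ × ℝ) (max L R)).exists_bound_of_continuousOn
    (f := fun z => |α₁ z| + |β₁ z| + |α₂ z| + |β₂ z|) (by fun_prop)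
  have hzz : |z.2| ≤ R - M * |z.1| := by rw [hR]; linarith
  have B0 : 0 ≤ B := (norm_nonneg _).trans (hB z (hmem z hz hzz))
  have D0 : 0 ≤ D := (norm_nonneg _).trans (hD z (hmem z hz hzz))
  have hD' : ∀ w ∈ Metric.closedBall (0 : ℝ × ℝ) (max L R),
      |α₁ w| + |β₁ w| ≤ D ∧ |α₂ w| + |β₂ w| ≤ D := fun w hw => by
    have := (le_abs_self _).trans (hD w hw)
    constructor <;> linarith [abs_nonneg (α₁ w), abs_nonneg (β₁ w), abs_nonneg (α₂ w),
      abs_nonneg (β₂ w)]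
  have lin : ∀ {a b x y E : ℝ}, |a| + |b| ≤ D → |x| ≤ E → |y| ≤ E →
      |a * x + b * y| ≤ D * E := fun {a b x y E} h1 h2 h3 => by
    have hE := (abs_nonneg _).trans h2
    calc |a * x + b * y| ≤ |a| * |x| + |b| * |y| := by
          rw [← abs_mul, ← abs_mul]; exact abs_add_le _ _
      _ ≤ |a| * E + |b| * E := by gcongr
      _ = (|a| + |b|) * E := by ring
      _ ≤ D * E := by gcongr
  -- Integrating along characteristics improves a bound by the factor D |t| / (n + 1), so the
  -- solution is bounded by every term of a null sequence.
  have key : ∀ n : ℕ, ∀ w : ℝ × ℝ, |w.1| ≤ L → |w.2| ≤ R - M * |w.1| →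
      |u w| ≤ B * D ^ n / n.factorial * |w.1| ^ n ∧
      |v w| ≤ B * D ^ n / n.factorial * |w.1| ^ n := by
    intro n
    induction n with
    | zero =>
      intro w h h'
      have := (le_abs_self _).trans (hB w (hmem w h h'))
      simp only [pow_zero, mul_one, Nat.factorial_zero, Nat.cast_one, div_one]
      constructor <;> linarith [abs_nonneg (u w), abs_nonneg (v w)]
    | succ n ih =>
      intro w h h'
      have e : D * (B * D ^ n / n.factorial) * |w.1| ^ (n + 1) / (n + 1)
          = B * D ^ (n + 1) / (n + 1).factorial * |w.1| ^ (n + 1) := by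
        rw [Nat.factorial_succ]
        push_cast
        field_simp
        ring
      rw [← e]
      constructor
      · refine abs_le_of_transport hF hξ hM hu (by fun_prop) e1 (fun x => (h0 x).1)
          (fun y hy hy' => ?_) w h h'
        rw [mul_assoc]
        exact lin (hD' y (hmem y hy hy')).1 (ih y hy hy').1 (ih y hy hy').2
      · refine abs_le_of_transport hG hη hM' hv (w := fun z => α₂ z * u z + β₂ z * v z)
          (by fun_prop) (fun y hy => by rw [← e2 y hy]; ring) (fun x => (h0 x).2)
          (fun y hy hy' => ?_) w h h'
        rw [mul_assoc]
        exact lin (hD' y (hmem y hy hy')).2 (ih y hy hy').1 (ih y hy hy').2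
  have hlim : Tendsto (fun n : ℕ => B * D ^ n / n.factorial * |z.1| ^ n) atTop (𝓝 0) := by
    have := (FloorSemiring.tendsto_pow_div_factorial_atTop (D * |z.1|)).const_mul B
    rw [mul_zero] at this
    refine this.congr fun n => ?_
    rw [mul_pow]; ring
  exact ⟨abs_nonpos_iff.1 (ge_of_tendsto' hlim fun n => (key n z hz hzz).1),
    abs_nonpos_iff.1 (ge_of_tendsto' hlim fun n => (key n z hz hzz).2)⟩

end KillingHorizon

end

noncomputable section

namespace KillingHorizon

/-! ### Periodic diagonal hyperbolic systems in the plane -/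

open Filter Topology

/-- Periodicity in the second variable. -/
def IsPeriodic₂ (f : ℝ × ℝ → ℝ) : Prop := ∀ z : ℝ × ℝ, f (z.1, z.2 + 2 * Real.pi) = f z

lemma fderiv_shift₂ (f : ℝ × ℝ → ℝ) (c : ℝ) (z : ℝ × ℝ) :
    fderiv ℝ (fun z => f (z.1, z.2 + c)) z = fderiv ℝ f (z.1, z.2 + c) := by
  have h := fderiv_comp_add_right (𝕜 := ℝ) (f := f) (x := z) ((0, c) : ℝ × ℝ)
  simpa [Prod.add_def] using h

lemma IsPeriodic₂.pd₂ {f : ℝ × ℝ → ℝ} (h : IsPeriodic₂ f) : IsPeriodic₂ (pd₂ f) := fun z => by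
  rw [KillingHorizon.pd₂, KillingHorizon.pd₂, ← fderiv_shift₂, show (fun z : ℝ × ℝ =>
    f (z.1, z.2 + 2 * Real.pi)) = f from funext h]

lemma IsPeriodic₂.exists_bound {f : ℝ × ℝ → ℝ} (h : IsPeriodic₂ f) (hf : Continuous f) (L : ℝ) :
    ∃ C, ∀ z : ℝ × ℝ, |z.1| ≤ L → |f z| ≤ C := by
  obtain ⟨C, hC⟩ := (isCompact_Icc.prod isCompact_Icc).exists_bound_of_continuousOn
    (s := Set.Icc (-L) L ×ˢ Set.Icc 0 (2 * Real.pi)) hf.continuousOn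
  refine ⟨C, fun z hz => ?_⟩
  have hp : Function.Periodic (fun x => f (z.1, x)) (2 * Real.pi) := fun x => h (z.1, x)
  obtain ⟨y, hy, hxy⟩ := hp.exists_mem_Ico₀ Real.two_pi_pos z.2
  have e : f z = f (z.1, y) := hxy
  rw [e]
  exact hC (z.1, y) ⟨abs_le.1 hz, hy.1, hy.2.le⟩

/-- Composing the speed with χ in the time variable leaves the strip |t| ≤ L unchanged and involves
only times in a compact interval, on which a periodic speed is bounded above and away from zero. -/
lemma exists_cutoff {L : ℝ} (hL : 0 < L) : ∃ χ : ℝ → ℝ, ContDiff ℝ ∞ χ ∧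
    (∀ t, |t| ≤ L → χ t = t) ∧ ∀ t, |χ t| ≤ L + 1 := by
  let B : ContDiffBump (0 : ℝ) := ⟨L, L + 1, hL, by linarith⟩
  refine ⟨fun t => t * B t, contDiff_id.mul B.contDiff, fun t ht => ?_, fun t => ?_⟩
  · change t * B t = t
    rw [B.one_of_mem_closedBall (by simpa using ht), mul_one]
  · change |t * B t| ≤ L + 1
    rcases le_total (L + 1) |t| with h | h
    · rw [B.zero_of_le_dist (by simpa using h), mul_zero, abs_zero]
      linarith
    · rw [abs_mul, abs_of_nonneg B.nonneg]
      have := mul_le_mul h (B.le_one (x := t)) B.nonneg (by linarith)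
      linarith

/-- A positive periodic speed agrees in a strip with a bounded one. -/
lemma exists_bounded_speed {l : ℝ × ℝ → ℝ} (hl : ContDiff ℝ ∞ l) (h0 : ∀ z, 0 < l z)
    (hper : IsPeriodic₂ l) {L : ℝ} (hL : 0 < L) : ∃ (k : ℝ × ℝ → ℝ) (m M K : ℝ), ContDiff ℝ ∞ k ∧
      (∀ z : ℝ × ℝ, |z.1| ≤ L → k z = l z) ∧ 0 < m ∧ (∀ z, m ≤ k z) ∧ (∀ z, |k z| ≤ M) ∧
      ∀ z, |pd₂ k z| ≤ K := by
  obtain ⟨χ, hχ, hχL, hχb⟩ := exists_cutoff hL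
  obtain ⟨M, hM⟩ := hper.exists_bound hl.continuous (L + 1)
  obtain ⟨K, hK⟩ := hper.pd₂.exists_bound (contDiff_pd₂ hl).continuous (L + 1)
  have hper' : IsPeriodic₂ fun z => (l z)⁻¹ := fun z => by simp only; rw [hper z]
  obtain ⟨C, hC⟩ := hper'.exists_bound (hl.continuous.inv₀ fun z => (h0 z).ne') (L + 1)
  have C0 : 0 < C := (inv_pos.2 (h0 0)).trans_le ((le_abs_self _).trans (hC 0 (by simp; linarith)))
  have hk : ContDiff ℝ ∞ fun z : ℝ × ℝ => l (χ z.1, z.2) :=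
    hl.comp ((hχ.comp contDiff_fst).prodMk contDiff_snd)
  refine ⟨fun z => l (χ z.1, z.2), C⁻¹, M, K, hk, fun z hz => ?_, inv_pos.2 C0, fun z => ?_,
    fun z => hM _ (hχb _), fun z => ?_⟩
  · simp only; rw [hχL _ hz]
  · rw [inv_le_comm₀ C0 (h0 _)]
    exact (le_abs_self _).trans (hC _ (hχb _))
  · have h1 := (hasPartials_pd (hk.differentiable (by simp))).snd z.1 z.2
    have h2 := (hasPartials_pd (hl.differentiable (by simp))).snd (χ z.1) z.2
    rw [show pd₂ (fun z : ℝ × ℝ => l (χ z.1, z.2)) z = pd₂ l (χ z.1, z.2) from h1.unique h2]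
    exact hK _ (hχb _)

section

variable {l α₁ β₁ γ₁ α₂ β₂ γ₂ : ℝ × ℝ → ℝ}

/-- Uniqueness for the Cauchy problem with a periodic speed. -/
theorem diagonal_unique {u v u' v' : ℝ × ℝ → ℝ} {L : ℝ} (hL : 0 < L)
    (hl : ContDiff ℝ ∞ l) (l0 : ∀ z, 0 < l z) (hper : IsPeriodic₂ l) (h₁ : Continuous α₁)
    (h₂ : Continuous β₁) (h₃ : Continuous α₂) (h₄ : Continuous β₂) (hu : ContDiff ℝ ∞ u)
    (hv : ContDiff ℝ ∞ v) (hu' : ContDiff ℝ ∞ u') (hv' : ContDiff ℝ ∞ v')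
    (e1 : ∀ z : ℝ × ℝ, |z.1| ≤ L → pd₁ u z + l z * pd₂ u z = α₁ z * u z + β₁ z * v z + γ₁ z)
    (e2 : ∀ z : ℝ × ℝ, |z.1| ≤ L → pd₁ v z - l z * pd₂ v z = α₂ z * u z + β₂ z * v z + γ₂ z)
    (e1' : ∀ z : ℝ × ℝ, |z.1| ≤ L → pd₁ u' z + l z * pd₂ u' z = α₁ z * u' z + β₁ z * v' z + γ₁ z)
    (e2' : ∀ z : ℝ × ℝ, |z.1| ≤ L → pd₁ v' z - l z * pd₂ v' z = α₂ z * u' z + β₂ z * v' z + γ₂ z)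
    (h0 : ∀ x, u (0, x) = u' (0, x) ∧ v (0, x) = v' (0, x)) (z : ℝ × ℝ) (hz : |z.1| ≤ L) :
    u z = u' z ∧ v z = v' z := by
  obtain ⟨k, m, M, K, hk, hkl, -, -, hM, hK⟩ := exists_bounded_speed hl l0 hper hL
  have hsub : ∀ {f g : ℝ × ℝ → ℝ}, ContDiff ℝ ∞ f → ContDiff ℝ ∞ g → ∀ z,
      pd₁ (f - g) z = pd₁ f z - pd₁ g z ∧ pd₂ (f - g) z = pd₂ f z - pd₂ g z := fun hf hg z => by
    have := fderiv_sub (hf.differentiable (by simp) z) (hg.differentiable (by simp) z)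
    simp [pd₁, pd₂, this]
  have := diagonal_unique_strip (u := u - u') (v := v - v') (L := L) hk hM hK h₁ h₂ h₃ h₄
    (hu.sub hu') (hv.sub hv') (fun z hz => by
      rw [hkl z hz, (hsub hu hu' z).1, (hsub hu hu' z).2]
      simp only [Pi.sub_apply]
      linear_combination e1 z hz - e1' z hz) (fun z hz => by
      rw [hkl z hz, (hsub hv hv' z).1, (hsub hv hv' z).2]
      simp only [Pi.sub_apply]
      linear_combination e2 z hz - e2' z hz) (fun x => by simp [(h0 x).1, (h0 x).2]) z hz
  exact ⟨sub_eq_zero.1 this.1, sub_eq_zero.1 this.2⟩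

/-- At time t the function with index ⌈|t|⌉ is used. The margin of one in the agreement hypothesis
makes the glued function coincide with it in a whole neighbourhood, so derivatives agree as well. -/
lemma exists_glue {U : ℕ → ℝ × ℝ → ℝ} (hU : ∀ n, ContDiff ℝ ∞ (U n))
    (h : ∀ (m n : ℕ) (z : ℝ × ℝ), |z.1| ≤ m + 1 → |z.1| ≤ n + 1 → U m z = U n z) :
    ∃ u : ℝ × ℝ → ℝ, ContDiff ℝ ∞ u ∧ ∀ z : ℝ × ℝ, u z = U ⌈|z.1|⌉₊ z ∧
      fderiv ℝ u z = fderiv ℝ (U ⌈|z.1|⌉₊) z := by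
  set u : ℝ × ℝ → ℝ := fun z => U ⌈|z.1|⌉₊ z with hu
  have hloc : ∀ z : ℝ × ℝ, u =ᶠ[𝓝 z] U ⌈|z.1|⌉₊ := fun z => by
    have ho : IsOpen {w : ℝ × ℝ | |w.1| < ⌈|z.1|⌉₊ + 1} :=
      isOpen_lt (by fun_prop) continuous_const
    filter_upwards [ho.mem_nhds (show |z.1| < ⌈|z.1|⌉₊ + 1 by
      linarith [Nat.le_ceil |z.1|])] with w hw
    exact h _ _ w (by linarith [Nat.le_ceil |w.1|]) (le_of_lt hw)
  refine ⟨u, contDiff_iff_contDiffAt.2 fun z => (hU _).contDiffAt.congr_of_eventuallyEq (hloc z),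
    fun z => ⟨rfl, (hloc z).fderiv_eq⟩⟩

/-- The Cauchy problem for a periodic diagonal hyperbolic system. -/
theorem exists_diagonal {p q : ℝ → ℝ} (hl : ContDiff ℝ ∞ l) (l0 : ∀ z, 0 < l z)
    (hper : IsPeriodic₂ l) (h₁ : ContDiff ℝ ∞ α₁) (h₂ : ContDiff ℝ ∞ β₁) (h₃ : ContDiff ℝ ∞ γ₁)
    (h₄ : ContDiff ℝ ∞ α₂) (h₅ : ContDiff ℝ ∞ β₂) (h₆ : ContDiff ℝ ∞ γ₂) (p₁ : IsPeriodic₂ α₁)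
    (p₂ : IsPeriodic₂ β₁) (p₃ : IsPeriodic₂ γ₁) (p₄ : IsPeriodic₂ α₂) (p₅ : IsPeriodic₂ β₂)
    (p₆ : IsPeriodic₂ γ₂) (hp : ContDiff ℝ ∞ p) (hq : ContDiff ℝ ∞ q)
    (pp : Function.Periodic p (2 * Real.pi)) (pq : Function.Periodic q (2 * Real.pi)) :
    ∃ u v : ℝ × ℝ → ℝ, ContDiff ℝ ∞ u ∧ ContDiff ℝ ∞ v ∧ IsPeriodic₂ u ∧ IsPeriodic₂ v ∧
      (∀ z, pd₁ u z + l z * pd₂ u z = α₁ z * u z + β₁ z * v z + γ₁ z) ∧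
      (∀ z, pd₁ v z - l z * pd₂ v z = α₂ z * u z + β₂ z * v z + γ₂ z) ∧
      ∀ x, u (0, x) = p x ∧ v (0, x) = q x := by
  have hloc : ∀ n : ℕ, ∃ u v : ℝ × ℝ → ℝ, ContDiff ℝ ∞ u ∧ ContDiff ℝ ∞ v ∧
      (∀ z : ℝ × ℝ, |z.1| ≤ n + 1 →
        pd₁ u z + l z * pd₂ u z = α₁ z * u z + β₁ z * v z + γ₁ z) ∧
      (∀ z : ℝ × ℝ, |z.1| ≤ n + 1 →
        pd₁ v z - l z * pd₂ v z = α₂ z * u z + β₂ z * v z + γ₂ z) ∧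
      ∀ x, u (0, x) = p x ∧ v (0, x) = q x := fun n => by
    obtain ⟨k, m, M, K, hk, hkl, hm, hmk, hM, hK⟩ :=
      exists_bounded_speed hl l0 hper (L := n + 1) (by positivity)
    obtain ⟨u, v, hu, hv, e1, e2, e3⟩ :=
      exists_diagonal_of_bounded hk hm hmk hM hK h₁ h₂ h₃ h₄ h₅ h₆ hp hq
    exact ⟨u, v, hu, hv, fun z hz => by rw [← hkl z hz]; exact e1 z,
      fun z hz => by rw [← hkl z hz]; exact e2 z, e3⟩
  choose U V hU hV E1 E2 E3 using hloc
  have hcomp : ∀ m n (z : ℝ × ℝ), |z.1| ≤ (m : ℕ) + 1 → |z.1| ≤ (n : ℕ) + 1 →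
      U m z = U n z ∧ V m z = V n z := fun m n z hm hn => by
    refine diagonal_unique (L := min (m + 1) (n + 1)) (by positivity) hl l0 hper h₁.continuous
      h₂.continuous h₄.continuous h₅.continuous (hU m) (hV m) (hU n) (hV n)
      (fun z hz => E1 m z (hz.trans (min_le_left _ _))) (fun z hz => E2 m z (hz.trans (min_le_left _ _)))
      (fun z hz => E1 n z (hz.trans (min_le_right _ _)))
      (fun z hz => E2 n z (hz.trans (min_le_right _ _)))
      (fun x => ⟨(E3 m x).1.trans (E3 n x).1.symm, (E3 m x).2.trans (E3 n x).2.symm⟩) z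
      (le_min hm hn)
  obtain ⟨u, hu, hun⟩ := exists_glue hU fun m n z hm hn => (hcomp m n z hm hn).1
  obtain ⟨v, hv, hvn⟩ := exists_glue hV fun m n z hm hn => (hcomp m n z hm hn).2
  have hc : ∀ z : ℝ × ℝ, |z.1| ≤ (⌈|z.1|⌉₊ : ℝ) + 1 := fun z => by linarith [Nat.le_ceil |z.1|]
  have e1 : ∀ z, pd₁ u z + l z * pd₂ u z = α₁ z * u z + β₁ z * v z + γ₁ z := fun z => by
    rw [pd₁, pd₂, (hun z).1, (hun z).2, (hvn z).1]
    exact E1 _ z (hc z)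
  have e2 : ∀ z, pd₁ v z - l z * pd₂ v z = α₂ z * u z + β₂ z * v z + γ₂ z := fun z => by
    rw [pd₁, pd₂, (hun z).1, (hvn z).2, (hvn z).1]
    exact E2 _ z (hc z)
  have e3 : ∀ x, u (0, x) = p x ∧ v (0, x) = q x := fun x => by
    rw [(hun _).1, (hvn _).1]
    exact E3 _ x
  have hs : ContDiff ℝ ∞ fun z : ℝ × ℝ => (z.1, z.2 + 2 * Real.pi) :=
    contDiff_fst.prodMk (contDiff_snd.add contDiff_const)
  -- The translate by one period solves the same Cauchy problem; uniqueness gives periodicity.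
  have hP : ∀ z, u (z.1, z.2 + 2 * Real.pi) = u z ∧ v (z.1, z.2 + 2 * Real.pi) = v z := fun z => by
    refine diagonal_unique (L := |z.1| + 1) (u := fun z => u (z.1, z.2 + 2 * Real.pi))
      (v := fun z => v (z.1, z.2 + 2 * Real.pi)) (by positivity) hl l0 hper h₁.continuous
      h₂.continuous h₄.continuous h₅.continuous (hu.comp hs) (hv.comp hs) hu hv (fun z _ => ?_)
      (fun z _ => ?_) (fun z _ => e1 z) (fun z _ => e2 z) (fun x => ?_) z (by linarith)
    · rw [pd₁, pd₂, fderiv_shift₂, ← hper z, ← p₁ z, ← p₂ z, ← p₃ z]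
      exact e1 _
    · rw [pd₁, pd₂, fderiv_shift₂, ← hper z, ← p₄ z, ← p₅ z, ← p₆ z]
      exact e2 _
    · simp only [(e3 _).1, (e3 _).2]
      exact ⟨pp x, pq x⟩
  exact ⟨u, v, hu, hv, fun z => (hP z).1, fun z => (hP z).2, e1, e2, e3⟩

end

end KillingHorizon

end

noncomputable section

namespace KillingHorizon

open scoped Shortcuts

/-! ### Transport of the angular domain to the plane -/

/-- A parametrization of `(0, π)` by the real line, with `angle t₀ 0 = π / 2 + arctan t₀`. -/
def angle (t₀ t : ℝ) : ℝ := Real.pi / 2 + Real.arctan (t + t₀)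

lemma angle_mem (t₀ t : ℝ) : angle t₀ t ∈ Set.Ioo 0 Real.pi := by
  have := Real.arctan_mem_Ioo (t + t₀)
  constructor <;> simp only [angle] <;> linarith [this.1, this.2]

lemma angle_tan (t₀ : ℝ) {θ : ℝ} (hθ : θ ∈ Set.Ioo 0 Real.pi) :
    angle t₀ (Real.tan (θ - Real.pi / 2) - t₀) = θ := by
  rw [angle, sub_add_cancel, Real.arctan_tan (by linarith [hθ.1]) (by linarith [hθ.2])]
  ring

lemma tan_angle (t₀ t : ℝ) : Real.tan (angle t₀ t - Real.pi / 2) - t₀ = t := by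
  rw [angle, add_sub_cancel_left, Real.tan_arctan, add_sub_cancel_right]

lemma contDiff_angle (t₀ : ℝ) : ContDiff ℝ ∞ (angle t₀) :=
  contDiff_const.add (Real.contDiff_arctan.comp (contDiff_id.add contDiff_const))

/-- The derivative of `angle t₀`. -/
def angleRate (t₀ : ℝ) (z : ℝ × ℝ) : ℝ := (1 + (z.1 + t₀) ^ 2)⁻¹

lemma angleRate_pos (t₀ : ℝ) (z : ℝ × ℝ) : 0 < angleRate t₀ z := by unfold angleRate; positivity

lemma contDiff_angleRate (t₀ : ℝ) : ContDiff ℝ ∞ (angleRate t₀) :=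
  (contDiff_const.add ((contDiff_fst.add contDiff_const).pow 2)).inv fun z =>
    (by positivity : (0 : ℝ) < 1 + (z.1 + t₀) ^ 2).ne'

lemma hasDerivAt_angle (t₀ t x : ℝ) : HasDerivAt (angle t₀) (angleRate t₀ (t, x)) t := by
  have := (Real.hasDerivAt_arctan' (t + t₀)).comp_add_const t t₀
  exact this.const_add (Real.pi / 2)

/-- The point of the angular domain with parameter `z`. -/
def anglePoint (t₀ : ℝ) (z : ℝ × ℝ) : Angles := ⟨(angle t₀ z.1, z.2), angle_mem _ _, trivial⟩

lemma exists_anglePoint (t₀ : ℝ) (x : Angles) : ∃ z, anglePoint t₀ z = x :=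
  ⟨(Real.tan (x.1.1 - Real.pi / 2) - t₀, x.1.2), Subtype.ext (Prod.ext (angle_tan t₀ x.2.1) rfl)⟩

/-- An angular function as a function on the plane. -/
def pull (t₀ : ℝ) (a : Ang) (z : ℝ × ℝ) : ℝ := a.1 (anglePoint t₀ z)

lemma pull_eq_ext (t₀ : ℝ) (a : Ang) (z : ℝ × ℝ) : pull t₀ a z = ext a.1 (angle t₀ z.1, z.2) :=
  (ext_apply a.1 (anglePoint t₀ z)).symm

lemma contDiff_pull (t₀ : ℝ) (a : Ang) : ContDiff ℝ ∞ (pull t₀ a) := by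
  rw [show pull t₀ a = fun z => ext a.1 (angle t₀ z.1, z.2) from funext (pull_eq_ext t₀ a),
    contDiff_iff_contDiffAt]
  intro z
  exact (ext_contDiffAt a (anglePoint t₀ z)).comp z
    (((contDiff_angle t₀).comp contDiff_fst).prodMk contDiff_snd).contDiffAt

lemma isPeriodic₂_pull (t₀ : ℝ) (a : Ang) : IsPeriodic₂ (pull t₀ a) := fun z => by
  rw [pull_eq_ext, pull_eq_ext]
  exact a.2.2 (angle t₀ z.1, z.2)

lemma pd_pull (t₀ : ℝ) (a : Ang) (z : ℝ × ℝ) :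
    pd₁ (pull t₀ a) z = angleRate t₀ z * pull t₀ (dθ a) z ∧
    pd₂ (pull t₀ a) z = pull t₀ (dφ a) z := by
  have h := hasPartials_pd ((contDiff_pull t₀ a).differentiable (by simp))
  have hd := ext_differentiableAt a (anglePoint t₀ z)
  have h1 := h.fst z.1 z.2
  have h2 := h.snd z.1 z.2
  simp only [pull_eq_ext] at h1 h2
  have d1 := hasDerivAt_comp_curve (f := ext a.1) (a := angle t₀) (b := fun _ => z.2) (t := z.1) hd
    (hasDerivAt_angle t₀ z.1 z.2) (hasDerivAt_const z.1 z.2)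
  have d2 := hasDerivAt_comp_curve (f := ext a.1) (a := fun _ => angle t₀ z.1) (b := fun s => s)
    (t := z.2) hd (hasDerivAt_const z.2 (angle t₀ z.1)) (hasDerivAt_id z.2)
  have u1 := h1.unique d1
  have u2 := h2.unique d2
  rw [zero_mul, add_zero] at u1
  rw [zero_mul, zero_add, one_mul] at u2
  exact ⟨u1, u2⟩

/-- Every smooth periodic function on the plane comes from an angular function. -/
lemma exists_pull_eq (t₀ : ℝ) {u : ℝ × ℝ → ℝ} (hu : ContDiff ℝ ∞ u) (hp : IsPeriodic₂ u) :
    ∃ a : Ang, pull t₀ a = u := by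
  refine ⟨⟨fun x => u (Real.tan (x.1.1 - Real.pi / 2) - t₀, x.1.2), ?_, fun x => ?_⟩,
    funext fun z => ?_⟩
  · have hs : ContDiffOn ℝ ∞ (fun x : ℝ × ℝ => u (Real.tan (x.1 - Real.pi / 2) - t₀, x.2))
        Angles := by
      intro x hx
      have hc : Real.cos (x.1 - Real.pi / 2) ≠ 0 := by
        rw [Real.cos_sub_pi_div_two]
        exact (Real.sin_pos_of_mem_Ioo hx.1).ne'
      have ht : ContDiffAt ℝ ∞ (fun x : ℝ × ℝ => Real.tan (x.1 - Real.pi / 2)) x :=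
        ContDiffAt.comp (g := Real.tan) (f := fun x : ℝ × ℝ => x.1 - Real.pi / 2) x
          (Real.contDiffAt_tan.2 hc) (contDiff_fst.sub contDiff_const).contDiffAt
      exact (hu.contDiffAt.comp x ((ht.sub contDiffAt_const).prodMk
        contDiff_snd.contDiffAt)).contDiffWithinAt
    exact hs.congr fun x hx => by rw [ext_of_mem _ hx]
  · by_cases hx : x ∈ Angles
    · rw [ext_of_mem _ hx, ext_of_mem _ (shift_mem.2 hx)]
      exact hp (Real.tan (x.1 - Real.pi / 2) - t₀, x.2)
    · rw [ext_of_notMem _ hx, ext_of_notMem _ (fun h => hx (shift_mem.1 h))]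
  · change u (Real.tan (angle t₀ z.1 - Real.pi / 2) - t₀, z.2) = u z
    rw [tan_angle]

lemma smooth_slice (a : Ang) {θ₀ : ℝ} (hθ₀ : θ₀ ∈ Set.Ioo 0 Real.pi) :
    ContDiff ℝ ∞ (fun φ => ext a.1 (θ₀, φ)) ∧
      Function.Periodic (fun φ => ext a.1 (θ₀, φ)) (2 * Real.pi) :=
  ⟨contDiff_iff_contDiffAt.2 fun φ => (ext_contDiffAt a ⟨(θ₀, φ), hθ₀, trivial⟩).comp φ
    (contDiff_const.prodMk contDiff_id).contDiffAt, fun φ => a.2.2 (θ₀, φ)⟩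

/-! ### Hyperbolic systems on the angular domain -/

/-- The interval of θ is parametrized by the real line with θ₀ at t = 0. Since ∂_t = `angleRate` ·
∂_θ, the speed and all coefficients are multiplied by that positive rate. -/
theorem exists_diagonal_ang {l : Ang} (hl : ∀ x, 0 < l.1 x) {θ₀ : ℝ}
    (hθ₀ : θ₀ ∈ Set.Ioo 0 Real.pi) (α₁ β₁ γ₁ α₂ β₂ γ₂ : Ang) {p q : ℝ → ℝ}
    (hp : ContDiff ℝ ∞ p ∧ Function.Periodic p (2 * Real.pi))
    (hq : ContDiff ℝ ∞ q ∧ Function.Periodic q (2 * Real.pi)) :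
    ∃ u v : Ang, dθ u + l * dφ u = α₁ * u + β₁ * v + γ₁ ∧
      dθ v - l * dφ v = α₂ * u + β₂ * v + γ₂ ∧
      ∀ φ, ext u.1 (θ₀, φ) = p φ ∧ ext v.1 (θ₀, φ) = q φ := by
  set t₀ := Real.tan (θ₀ - Real.pi / 2) with ht₀
  have hang : angle t₀ 0 = θ₀ := by
    have := angle_tan t₀ hθ₀
    rwa [← ht₀, sub_self] at this
  have r0 := angleRate_pos t₀
  have hs : ∀ a : Ang, ContDiff ℝ ∞ fun z => angleRate t₀ z * pull t₀ a z := fun a =>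
    (contDiff_angleRate t₀).mul (contDiff_pull t₀ a)
  have hper : ∀ a : Ang, IsPeriodic₂ fun z => angleRate t₀ z * pull t₀ a z := fun a z => by
    simp only [isPeriodic₂_pull t₀ a z]
    rfl
  obtain ⟨U, V, hU, hV, pU, pV, e1, e2, e3⟩ := exists_diagonal (hs l)
    (fun z => mul_pos (r0 z) (hl _)) (hper l) (hs α₁) (hs β₁) (hs γ₁) (hs α₂) (hs β₂) (hs γ₂)
    (hper α₁) (hper β₁) (hper γ₁) (hper α₂) (hper β₂) (hper γ₂) hp.1 hq.1 hp.2 hq.2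
  obtain ⟨u, rfl⟩ := exists_pull_eq t₀ hU pU
  obtain ⟨v, rfl⟩ := exists_pull_eq t₀ hV pV
  refine ⟨u, v, ang_ext fun x => ?_, ang_ext fun x => ?_, fun φ => ?_⟩
  · obtain ⟨z, rfl⟩ := exists_anglePoint t₀ x
    have := e1 z
    rw [(pd_pull t₀ u z).1, (pd_pull t₀ u z).2] at this
    refine mul_left_cancel₀ (r0 z).ne' ?_
    simp only [pull] at this
    simp only [Subalgebra.coe_add, Subalgebra.coe_mul, Pi.add_apply, Pi.mul_apply]
    linear_combination this
  · obtain ⟨z, rfl⟩ := exists_anglePoint t₀ x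
    have := e2 z
    rw [(pd_pull t₀ v z).1, (pd_pull t₀ v z).2] at this
    refine mul_left_cancel₀ (r0 z).ne' ?_
    simp only [pull] at this
    simp only [Subalgebra.coe_add, Subalgebra.coe_sub, Subalgebra.coe_mul, Pi.add_apply,
      Pi.sub_apply, Pi.mul_apply]
    linear_combination this
  · have := e3 φ
    simp only [pull_eq_ext, hang] at this
    exact this

theorem diagonal_ang_unique {l : Ang} (hl : ∀ x, 0 < l.1 x) {θ₀ : ℝ}
    (hθ₀ : θ₀ ∈ Set.Ioo 0 Real.pi) {α₁ β₁ α₂ β₂ u v : Ang}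
    (e1 : dθ u + l * dφ u = α₁ * u + β₁ * v) (e2 : dθ v - l * dφ v = α₂ * u + β₂ * v)
    (h0 : ∀ φ, ext u.1 (θ₀, φ) = 0 ∧ ext v.1 (θ₀, φ) = 0) : u = 0 ∧ v = 0 := by
  set t₀ := Real.tan (θ₀ - Real.pi / 2) with ht₀
  have hang : angle t₀ 0 = θ₀ := by
    have := angle_tan t₀ hθ₀
    rwa [← ht₀, sub_self] at this
  have r0 := angleRate_pos t₀
  have hs : ∀ a : Ang, ContDiff ℝ ∞ fun z => angleRate t₀ z * pull t₀ a z := fun a =>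
    (contDiff_angleRate t₀).mul (contDiff_pull t₀ a)
  have hper : IsPeriodic₂ fun z => angleRate t₀ z * pull t₀ l z := fun z => by
    simp only [isPeriodic₂_pull t₀ l z]
    rfl
  have key : ∀ z, pull t₀ u z = 0 ∧ pull t₀ v z = 0 := fun z => by
    refine diagonal_unique (L := |z.1| + 1) (u' := fun _ => 0) (v' := fun _ => 0)
      (γ₁ := fun _ => 0) (γ₂ := fun _ => 0) (by positivity) (hs l)
      (fun z => mul_pos (r0 z) (hl _)) hper (hs α₁).continuous (hs β₁).continuous
      (hs α₂).continuous (hs β₂).continuous (contDiff_pull t₀ u) (contDiff_pull t₀ v)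
      contDiff_const contDiff_const (fun z _ => ?_) (fun z _ => ?_) (fun z _ => by simp [pd₁, pd₂])
      (fun z _ => by simp [pd₁, pd₂]) (fun x => ?_) z (by linarith)
    · rw [(pd_pull t₀ u z).1, (pd_pull t₀ u z).2]
      have := congrArg (fun a : Ang => a.1 (anglePoint t₀ z)) e1
      simp only [Subalgebra.coe_add, Subalgebra.coe_mul, Pi.add_apply, Pi.mul_apply] at this
      simp only [pull]
      linear_combination angleRate t₀ z * this
    · rw [(pd_pull t₀ v z).1, (pd_pull t₀ v z).2]
      have := congrArg (fun a : Ang => a.1 (anglePoint t₀ z)) e2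
      simp only [Subalgebra.coe_add, Subalgebra.coe_sub, Subalgebra.coe_mul, Pi.add_apply,
        Pi.sub_apply, Pi.mul_apply] at this
      simp only [pull]
      linear_combination angleRate t₀ z * this
    · simp only [pull_eq_ext, hang]
      exact h0 x
  constructor <;> refine ang_ext fun x => ?_ <;> obtain ⟨z, rfl⟩ := exists_anglePoint t₀ x
  exacts [(key z).1, (key z).2]

lemma exists_ang_sqrt {c : Ang} (hc : ∀ x, 0 < c.1 x) :
    ∃ l : Ang, (∀ x, 0 < l.1 x) ∧ l * l = c := by
  have e : ext (fun x => √(c.1 x)) = fun x => √(ext c.1 x) := by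
    funext x
    by_cases hx : x ∈ Angles
    · simp [ext_of_mem _ hx]
    · simp [ext_of_notMem _ hx]
  refine ⟨⟨fun x => √(c.1 x), ?_, fun x => ?_⟩, fun x => Real.sqrt_pos.2 (hc x), ang_ext fun x => ?_⟩
  · rw [e]
    exact c.2.1.sqrt fun x hx => by rw [ext_of_mem _ hx]; exact (hc _).ne'
  · rw [e]; simp only [c.2.2]
  · exact Real.mul_self_sqrt (hc x).le

lemma ang_two_cancel {a b : Ang} (h : 2 * a = 2 * b) : a = b := ang_ext fun x => by
  have := congrArg (fun a : Ang => a.1 x) h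
  exact mul_left_cancel₀ two_ne_zero this

/-- The Cauchy problem for the first-order hyperbolic system of the shift components. -/
theorem exists_hyperbolic {c : Ang} (hc : ∀ x, 0 < c.1 x) (a₁₁ a₁₂ a₂₁ a₂₂ g₁ g₂ : Ang) {θ₀ : ℝ}
    (hθ₀ : θ₀ ∈ Set.Ioo 0 Real.pi) {p q : ℝ → ℝ}
    (hp : ContDiff ℝ ∞ p ∧ Function.Periodic p (2 * Real.pi))
    (hq : ContDiff ℝ ∞ q ∧ Function.Periodic q (2 * Real.pi)) :
    ∃ τ π : Ang, dθ τ = -(c * dφ π) + a₁₁ * τ + a₁₂ * π + g₁ ∧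
      dθ π = -dφ τ + a₂₁ * τ + a₂₂ * π + g₂ ∧
      ∀ φ, ext τ.1 (θ₀, φ) = p φ ∧ ext π.1 (θ₀, φ) = q φ := by
  -- The characteristic speeds are ± the square root l of c, and the Riemann invariants are τ ± l π.
  obtain ⟨l, hl, rfl⟩ := exists_ang_sqrt hc
  obtain ⟨m, hm⟩ := exists_ang_inverse l fun x => (hl x).ne'
  set h : Ang := algebraMap ℝ Ang (1 / 2)
  have h2 : 2 * h = 1 := ang_ext fun x => by
    change (2 : ℝ) * (1 / 2) = 1
    norm_num
  obtain ⟨sl, pl⟩ := smooth_slice l hθ₀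
  -- Lower-order coefficients of the equations for τ + l π (`A`, `B`) and τ - l π (`A'`, `B'`),
  -- expressed in τ and π; the derivatives of l arise from differentiating l π.
  set A := a₁₁ + l * a₂₁
  set B := a₁₂ + l * dφ l + l * a₂₂ + dθ l
  set A' := a₁₁ - l * a₂₁
  set B' := a₁₂ + l * dφ l - l * a₂₂ - dθ l
  obtain ⟨u, v, e1, e2, e3⟩ := exists_diagonal_ang hl hθ₀ (h * (A + m * B)) (h * (A - m * B))
    (g₁ + l * g₂) (h * (A' + m * B')) (h * (A' - m * B')) (g₁ - l * g₂)
    (p := fun φ => p φ + ext l.1 (θ₀, φ) * q φ) (q := fun φ => p φ - ext l.1 (θ₀, φ) * q φ)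
    ⟨hp.1.add (sl.mul hq.1), hp.2.add (pl.mul hq.2)⟩ ⟨hp.1.sub (sl.mul hq.1), hp.2.sub (pl.mul hq.2)⟩
  obtain ⟨τ, π, rfl, rfl⟩ : ∃ τ π : Ang, u = τ + l * π ∧ v = τ - l * π :=
    ⟨h * (u + v), h * m * (u - v), by linear_combination -u * h2 - h * (u - v) * hm,
      by linear_combination -v * h2 + h * (u - v) * hm⟩
  have s1 : h * (A + m * B) * (τ + l * π) + h * (A - m * B) * (τ - l * π) = A * τ + B * π := by
    linear_combination (A * τ + B * π * l * m) * h2 + B * π * hm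
  have s2 : h * (A' + m * B') * (τ + l * π) + h * (A' - m * B') * (τ - l * π)
      = A' * τ + B' * π := by
    linear_combination (A' * τ + B' * π * l * m) * h2 + B' * π * hm
  rw [s1] at e1
  rw [s2] at e2
  simp only [map_add, map_sub, Derivation.leibniz, smul_eq_mul] at e1 e2
  refine ⟨τ, π, ang_two_cancel ?_, ang_two_cancel ?_, fun φ => ?_⟩
  · linear_combination e1 + e2
  · linear_combination m * (e1 - e2) + (2 * a₂₁ * τ + 2 * a₂₂ * π + 2 * g₂ - 2 * dθ π - 2 * dφ τ) * hm
  · obtain ⟨d1, d2⟩ := e3 φ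
    have hmem : ((θ₀, φ) : ℝ × ℝ) ∈ Angles := ⟨hθ₀, trivial⟩
    have l0 := hl ⟨(θ₀, φ), hmem⟩
    simp only [ext_of_mem _ hmem, Subalgebra.coe_add, Subalgebra.coe_sub, Subalgebra.coe_mul,
      Pi.add_apply, Pi.sub_apply, Pi.mul_apply] at d1 d2 ⊢
    exact ⟨by linarith, mul_left_cancel₀ l0.ne' (by linarith)⟩

theorem hyperbolic_unique {c : Ang} (hc : ∀ x, 0 < c.1 x) (a₁₁ a₁₂ a₂₁ a₂₂ : Ang) {θ₀ : ℝ}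
    (hθ₀ : θ₀ ∈ Set.Ioo 0 Real.pi) {τ π : Ang} (h1 : dθ τ = -(c * dφ π) + a₁₁ * τ + a₁₂ * π)
    (h2 : dθ π = -dφ τ + a₂₁ * τ + a₂₂ * π)
    (h0 : ∀ φ, ext τ.1 (θ₀, φ) = 0 ∧ ext π.1 (θ₀, φ) = 0) : τ = 0 ∧ π = 0 := by
  obtain ⟨l, hl, rfl⟩ := exists_ang_sqrt hc
  obtain ⟨m, hm⟩ := exists_ang_inverse l fun x => (hl x).ne'
  set h : Ang := algebraMap ℝ Ang (1 / 2)
  have hh2 : 2 * h = 1 := ang_ext fun x => by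
    change (2 : ℝ) * (1 / 2) = 1
    norm_num
  set A := a₁₁ + l * a₂₁
  set B := a₁₂ + l * dφ l + l * a₂₂ + dθ l
  set A' := a₁₁ - l * a₂₁
  set B' := a₁₂ + l * dφ l - l * a₂₂ - dθ l
  have s1 : h * (A + m * B) * (τ + l * π) + h * (A - m * B) * (τ - l * π) = A * τ + B * π := by
    linear_combination (A * τ + B * π * l * m) * hh2 + B * π * hm
  have s2 : h * (A' + m * B') * (τ + l * π) + h * (A' - m * B') * (τ - l * π)
      = A' * τ + B' * π := by
    linear_combination (A' * τ + B' * π * l * m) * hh2 + B' * π * hm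
  obtain ⟨z1, z2⟩ := diagonal_ang_unique hl hθ₀ (u := τ + l * π) (v := τ - l * π)
    (α₁ := h * (A + m * B)) (β₁ := h * (A - m * B)) (α₂ := h * (A' + m * B'))
    (β₂ := h * (A' - m * B')) (by
      rw [s1]
      simp only [map_add, Derivation.leibniz, smul_eq_mul]
      linear_combination h1 + l * h2) (by
      rw [s2]
      simp only [map_sub, Derivation.leibniz, smul_eq_mul]
      linear_combination h1 - l * h2) (fun φ => by
      obtain ⟨d1, d2⟩ := h0 φ
      have hmem : ((θ₀, φ) : ℝ × ℝ) ∈ Angles := ⟨hθ₀, trivial⟩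
      simp only [ext_of_mem _ hmem, Subalgebra.coe_add, Subalgebra.coe_sub, Subalgebra.coe_mul,
        Pi.add_apply, Pi.sub_apply, Pi.mul_apply] at d1 d2 ⊢
      rw [d1, d2]
      simp)
  constructor
  · exact ang_two_cancel (by linear_combination z1 + z2)
  · exact ang_two_cancel (by linear_combination m * (z1 - z2) - 2 * π * hm)

end KillingHorizon

end

noncomputable section

namespace KillingHorizon

open scoped Shortcuts

/-! ### The equations at a higher order -/

section Values

variable (v : GVal) (n : ℕ)

/-- The coefficients of the shift system at the order `n`. -/
def GVal.c : Ang := ((n : ℝ) + 1) • (v.s * v.j)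

/-- Coefficient of the shift system. -/
def GVal.a₁₁ : Ang := (1 / 2 : ℝ) • (v.i * dθ v.s) - (((n : ℝ) + 1) / 2) • (v.j * dθ v.q)
  + (1 / 2 : ℝ) • (v.n * dθ v.N)

/-- Coefficient of the shift system. -/
def GVal.a₁₂ : Ang := -((1 / 2 : ℝ) • (v.j * dφ v.s))
  + (((n : ℝ) + 1) / 2) • (v.s * v.j ^ 2 * dφ v.q) + (1 / 2 : ℝ) • (v.s * v.n * v.j * dφ v.N)

/-- Coefficient of the shift system. -/
def GVal.a₂₁ : Ang := v.i * dφ v.s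

/-- Coefficient of the shift system. -/
def GVal.a₂₂ : Ang := v.j * dθ v.q

variable {v n}

lemma GVal.eq_W (ρ : Ang) : v.W = ρ ↔
    dθ v.π = -dφ v.τ + v.a₂₁ * v.τ + v.a₂₂ * v.π + (2 : ℝ) • ρ := by
  rw [GVal.W, GVal.a₂₁, GVal.a₂₂]
  constructor
  · rintro rfl
    rw [smul_smul]; norm_num; ring
  · intro h
    rw [h, show -dφ v.τ + v.i * dφ v.s * v.τ + v.j * dθ v.q * v.π + (2 : ℝ) • ρ + dφ v.τ
      - v.τ * v.i * dφ v.s - v.π * v.j * dθ v.q = (2 : ℝ) • ρ by ring, smul_smul]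
    norm_num

/-- Here s_φφ is fixed and s_θθ varies with the lapse only, so the coefficient of `al` is (n + 1) -
(n - 1) - 2 = 0. What remains is X + (n + 1) Z - ell = ρ, a first-order equation for the shift
alone. -/
lemma GVal.eq_two_two (h1 : v.i * v.ds = (2 : ℝ) • v.al) (h2 : v.dq = 0) (ρ : Ang) :
    -(((n : ℝ) + 1) • v.QQ n) - v.PP n - (2 : ℝ) • v.al - v.ell = ρ ↔
      dθ v.τ = -(v.c n * dφ v.π) + v.a₁₁ n * v.τ + v.a₁₂ n * v.π + v.s * ρ := by
  have e : -(((n : ℝ) + 1) • v.QQ n) - v.PP n - (2 : ℝ) • v.al - v.ell - ρ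
      = v.i * (dθ v.τ - (-(v.c n * dφ v.π) + v.a₁₁ n * v.τ + v.a₁₂ n * v.π + v.s * ρ)) := by
    rw [GVal.QQ, GVal.PP, h1, h2]
    apply ang_ext; intro x
    obtain ⟨hs, hi⟩ := eval_inv v.hi x
    obtain ⟨hN, hn⟩ := eval_inv v.hn x
    obtain ⟨hq, hj⟩ := eval_inv v.hj x
    simp [GVal.X, GVal.Z, GVal.ell, GVal.adv, GVal.c, GVal.a₁₁, GVal.a₁₂, hi, hn, hj]
    field_simp
    ring
  rw [← sub_eq_zero, e, ← sub_eq_zero (a := dθ v.τ)]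
  constructor
  · intro h
    calc _ = v.s * v.i * _ := by rw [v.hi, one_mul]
      _ = _ := by rw [mul_assoc, h, mul_zero]
  · intro h
    rw [h, mul_zero]

/-- Subtracting the φφ-equation from the θθ-equation leaves n (QQ - PP) = σ - ρ, and PP - QQ = n al
- X + Z. -/
lemma GVal.eq_one_one (hn : n ≠ 0) (h1 : v.i * v.ds = (2 : ℝ) • v.al) (h2 : v.dq = 0)
    {ρ : Ang} (h : -(((n : ℝ) + 1) • v.QQ n) - v.PP n - (2 : ℝ) • v.al - v.ell = ρ) (σ : Ang) :
    -(((n : ℝ) + 1) • v.PP n) - v.QQ n - (2 : ℝ) • v.al - v.ell = σ ↔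
      v.al = (1 / n : ℝ) • (v.X - v.Z - (1 / n : ℝ) • (σ - ρ)) := by
  subst h
  rw [GVal.QQ, GVal.PP, h1, h2]
  have hn' : (n : ℝ) ≠ 0 := by exact_mod_cast hn
  have ext_iff : ∀ a b : Ang, a = b ↔ ∀ x, a.1 x = b.1 x := fun a b =>
    ⟨fun h x => by rw [h], ang_ext⟩
  rw [ext_iff, ext_iff]
  refine forall_congr' fun x => ?_
  simp
  field_simp
  constructor <;> intro h <;> linarith

end Values

namespace Expansion

variable {R : ℝ}

lemma pairVal_ds (hR : 0 < R) (E E' : Expansion) (hA : ∀ x, 0 < (E.A 0).1 x) (n : ℕ) :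
    (pairVal hR E E' hA n).i * (pairVal hR E E' hA n).ds = (2 : ℝ) • (pairVal hR E E' hA n).al := by
  rw [GVal.al]
  apply ang_ext; intro x
  simp [pairVal, baseVal]
  field_simp

lemma pairVal_al (hR : 0 < R) (E E' : Expansion) (hA : ∀ x, 0 < (E.A 0).1 x) (n : ℕ) :
    E'.A n - E.A n = E.A 0 * (pairVal hR E E' hA n).al := by
  rw [GVal.al]
  apply ang_ext; intro x
  obtain ⟨-, h⟩ := eval_inv (mul_angInv _ (pow_two_ne hA)) x
  have := (hA x).ne'
  simp [pairVal, baseVal, h]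
  field_simp

lemma c_pos (hR : 0 < R) (E E' : Expansion) (hA : ∀ x, 0 < (E.A 0).1 x) (n : ℕ) (x : Angles) :
    0 < ((pairVal hR E E' hA n).c n).1 x := by
  obtain ⟨-, h⟩ := eval_inv (mul_angInv _ four_sin_sq_ne) x
  have h1 := hA x
  have h2 := sinTheta_pos x
  simp [GVal.c, pairVal, baseVal, h]
  positivity

/-- Uniqueness at the order `n`. -/
lemma agree_succ (hR : 0 < R) {n : ℕ} (hn : 2 ≤ n) {E E' : Expansion} (h : Agree n E E')
    (hA : ∀ x, 0 < (E.A 0).1 x) (hA' : ∀ x, 0 < (E'.A 0).1 x)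
    (hf : ∀ x, 0 < (E.f 0).1 x) (hf' : ∀ x, 0 < (E'.f 0).1 x)
    (hE : SolUpTo R (n + 1) E) (hE' : SolUpTo R (n + 1) E') {θ₀ : ℝ}
    (hθ₀ : θ₀ ∈ Set.Ioo 0 Real.pi)
    (hΘ : ∀ φ, ext (E.Θ (n - 2)).1 (θ₀, φ) = ext (E'.Θ (n - 2)).1 (θ₀, φ))
    (hΦ : ∀ φ, ext (E.Φ (n - 2)).1 (θ₀, φ) = ext (E'.Φ (n - 2)).1 (θ₀, φ)) :
    Agree (n + 1) E E' := by
  have hn' : (n : ℝ) ≠ 0 := by positivity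
  obtain ⟨L, -⟩ := levelChange hR (by exact_mod_cast hn) h hA hA' hf hf'
  have hds := pairVal_ds hR E E' hA n
  have hal := pairVal_al hR E E' hA n
  have hc := c_pos hR E E' hA n
  have hq : (pairVal hR E E' hA n).dq = 0 := rfl
  have hτ : (pairVal hR E E' hA n).τ = E'.Θ (n - 2) - E.Θ (n - 2) := rfl
  have hπ : (pairVal hR E E' hA n).π = E'.Φ (n - 2) - E.Φ (n - 2) := rfl
  generalize pairVal hR E E' hA n = v at *
  have z : ∀ {u u' : Ser} {k : ℤ} {a : Ang}, Ord (k + 1) u → Ord (k + 1) u' →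
      u'.coeff k = u.coeff k + a → a = 0 := by
    intro u u' k a h1 h2 h3
    rwa [h1 _ (by omega), h2 _ (by omega), zero_add, eq_comm] at h3
  -- Both expansions satisfy the equations at this order, so the changes form a solution of the
  -- homogeneous linear problem.
  have z11 := z (hE.r11.mono (by push_cast; omega)) (hE'.r11.mono (by push_cast; omega)) L.r11
  have z22 := z (hE.r22.mono (by push_cast; omega)) (hE'.r22.mono (by push_cast; omega)) L.r22
  have z12 := z (hE.r12.mono (by push_cast; omega)) (hE'.r12.mono (by push_cast; omega)) L.r12
  have zre := z (hE.re.mono (by push_cast; omega)) (hE'.re.mono (by push_cast; omega)) L.re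
  have zim := z (hE.im.mono (by push_cast; omega)) (hE'.im.mono (by push_cast; omega)) L.im
  have cancel : ∀ {a b c : Ang}, b * a = 1 → a * c = 0 → c = 0 := by
    intro a b c hab h
    calc c = b * a * c := by rw [hab, one_mul]
      _ = 0 := by rw [mul_assoc, h, mul_zero]
  have y22 := cancel (b := v.N * v.j) (by linear_combination v.q * v.j * v.hn + v.hj) z22
  have y11 := cancel (b := v.N * v.i) (by linear_combination v.s * v.i * v.hn + v.hi) z11
  have y12 : v.W = 0 := cancel v.hn ((smul_eq_zero.1 z12).resolve_left hn')
  have s1 := (GVal.eq_two_two hds hq 0).1 y22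
  have s2 := (GVal.eq_W 0).1 y12
  rw [mul_zero, add_zero] at s1
  rw [smul_zero, add_zero] at s2
  have hext : ∀ (a b : Ang) φ, ext (b - a).1 (θ₀, φ) = ext b.1 (θ₀, φ) - ext a.1 (θ₀, φ) := by
    intro a b φ
    have hm : ((θ₀, φ) : ℝ × ℝ) ∈ Angles := ⟨hθ₀, trivial⟩
    rw [ext_of_mem _ hm, ext_of_mem _ hm, ext_of_mem _ hm]; rfl
  obtain ⟨t0, p0⟩ := hyperbolic_unique hc _ _ _ _ hθ₀ s1 s2 (fun φ => by
    rw [hτ, hπ, hext, hext, hΘ, hΦ, sub_self, sub_self]; exact ⟨rfl, rfl⟩)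
  have a0 := (GVal.eq_one_one (by omega) hds hq y22 0).1 y11
  have X0 : v.X = 0 := by rw [GVal.X, t0, p0]; simp
  have Z0 : v.Z = 0 := by rw [GVal.Z, t0, p0]; simp
  have adv0 : ∀ u, v.adv u = 0 := fun u => by rw [GVal.adv, t0, p0]; simp
  have ell0 : v.ell = 0 := by rw [GVal.ell, adv0]; simp
  rw [X0, Z0] at a0
  simp only [sub_self, smul_zero] at a0
  have PP0 : v.PP n = 0 := by rw [GVal.PP, hds, a0, X0]; simp
  have QQ0 : v.QQ n = 0 := by rw [GVal.QQ, hq, a0, Z0]; simp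
  have hF := mul_angInv (E.f 0) fun x => (hf x).ne'
  have df : E'.f n - E.f n = 0 := by
    simp only [PP0, QQ0, a0, ell0, adv0, smul_zero, add_zero, mul_zero, sub_zero] at zre
    have := cancel (b := v.N * angInv (E.f 0) fun x => (hf x).ne')
      (by linear_combination E.f 0 * (angInv (E.f 0) fun x => (hf x).ne') * v.hn + hF) zre
    rw [smul_smul] at this
    exact (smul_eq_zero.1 this).resolve_left (by positivity)
  have db : E'.b n - E.b n = 0 := by
    simp only [PP0, QQ0, a0, ell0, adv0, smul_zero, add_zero, mul_zero, sub_zero, df] at zim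
    have := cancel v.hn zim
    have := cancel (b := angInv (E.f 0) fun x => (hf x).ne') (by rw [mul_comm, hF]) this
    rw [smul_smul] at this
    exact (smul_eq_zero.1 this).resolve_left (by positivity)
  have dA : E'.A n - E.A n = 0 := by rw [hal, a0, mul_zero]
  rw [hτ] at t0
  rw [hπ] at p0
  have ext' : ∀ {F F' : ℕ → Ang} {m : ℕ}, (∀ k < m, F k = F' k) → F' m - F m = 0 →
      ∀ k < m + 1, F k = F' k := by
    intro F F' m h1 h2 k hk
    rcases (Nat.lt_succ_iff.1 hk).lt_or_eq with hk | rfl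
    · exact h1 k hk
    · exact (sub_eq_zero.1 h2).symm
  refine ⟨ext' h.f df, ext' h.b db, ext' h.A dA, fun k hk => ?_, fun k hk => ?_⟩
  · exact ext' (m := n - 2) (fun k hk => h.Θ k (by omega)) t0 k (by omega)
  · exact ext' (m := n - 2) (fun k hk => h.Φ k (by omega)) p0 k (by omega)

lemma smooth_sub_slice {p : ℝ → ℝ} (hp : ContDiff ℝ ∞ p ∧ Function.Periodic p (2 * Real.pi))
    (a : Ang) {θ₀ : ℝ} (hθ₀ : θ₀ ∈ Set.Ioo 0 Real.pi) :
    ContDiff ℝ ∞ (fun φ => p φ - ext a.1 (θ₀, φ)) ∧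
      Function.Periodic (fun φ => p φ - ext a.1 (θ₀, φ)) (2 * Real.pi) :=
  ⟨hp.1.sub (smooth_slice a hθ₀).1, hp.2.sub (smooth_slice a hθ₀).2⟩

/-- Existence at the order `n`. -/
lemma exists_succ (hR : 0 < R) {n : ℕ} (hn : 2 ≤ n) {E : Expansion}
    (hA : ∀ x, 0 < (E.A 0).1 x) (hf : ∀ x, 0 < (E.f 0).1 x) (hE : SolUpTo R n E) {θ₀ : ℝ}
    (hθ₀ : θ₀ ∈ Set.Ioo 0 Real.pi) {p q : ℝ → ℝ}
    (hp : ContDiff ℝ ∞ p ∧ Function.Periodic p (2 * Real.pi))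
    (hq : ContDiff ℝ ∞ q ∧ Function.Periodic q (2 * Real.pi)) :
    ∃ E', Agree n E E' ∧ SolUpTo R (n + 1) E' ∧
      ∀ φ, ext (E'.Θ (n - 2)).1 (θ₀, φ) = p φ ∧ ext (E'.Φ (n - 2)).1 (θ₀, φ) = q φ := by
  have hn' : (n : ℝ) ≠ 0 := by positivity
  have hn4 : (4 + n : ℝ) ≠ 0 := by positivity
  have hF := mul_angInv (E.f 0) fun x => (hf x).ne'
  set F := angInv (E.f 0) fun x => (hf x).ne'
  set r₁₁ := (E.resid R 1 1).coeff (n - 2)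
  set r₂₂ := (E.resid R 2 2).coeff (n - 2)
  set r₁₂ := (E.resid R 1 2).coeff (n - 2)
  set e₁ := (ernstRe (E.metric R) E.fS E.bS).coeff n
  set e₂ := (ernstIm (E.metric R) E.fS E.bS).coeff (n + 2)
  -- The coefficients of the shift system do not depend on the variations. They can be taken from
  -- the pair (E, E) before the new expansion is constructed.
  set w := pairVal hR E E hA n with hw
  set ρ : Ang := -(w.N * w.j * r₂₂)
  obtain ⟨τ, π, s1, s2, hdata⟩ := exists_hyperbolic (c := w.c n) (c_pos hR E E hA n) (w.a₁₁ n) (w.a₁₂ n) w.a₂₁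
    w.a₂₂ (w.s * ρ) ((2 : ℝ) • -((1 / n : ℝ) • (w.N * r₁₂))) hθ₀
    (p := fun φ => p φ - ext (E.Θ (n - 2)).1 (θ₀, φ))
    (q := fun φ => q φ - ext (E.Φ (n - 2)).1 (θ₀, φ))
    (smooth_sub_slice hp _ hθ₀) (smooth_sub_slice hq _ hθ₀)
  -- `X` and `Z` depend only on the variation of the shift and determine `al`; afterwards `u'` also
  -- contains the variation of the lapse. The leading shift is irrelevant for these quantities and
  -- is set to zero.
  set u := baseVal R hR (E.A 0) hA 0 0 0 0 0 τ π with hu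
  set al : Ang := (1 / n : ℝ) • (u.X - u.Z - (1 / n : ℝ) • (-(w.N * w.i * r₁₁) - ρ)) with hal
  set u' := baseVal R hR (E.A 0) hA 0 0 (E.A 0 * al) 0 0 τ π with hu'
  set Q : Ang := u'.PP n + u'.QQ n + (2 - n : ℝ) • al + u'.ell with hQ
  set δf : Ang := (1 / n ^ 2 : ℝ) • ((n : ℝ) • u'.adv (E.f 0) - (2 : ℝ) • (E.f 0 * Q)
    - w.N * F * e₁) with hδf
  set δb : Ang := (1 / (n * (4 + n)) : ℝ) • ((n : ℝ) • u'.adv (E.b 0) + (4 : ℝ) • u'.adv (E.b 0)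
    - (4 : ℝ) • (E.b 0 * Q) + F * ((8 : ℝ) • (E.b 0 * ((n : ℝ) • δf - u'.adv (E.f 0)))
    - w.N * e₂)) with hδb
  set E' : Expansion := ⟨Function.update E.f n (E.f n + δf), Function.update E.b n (E.b n + δb),
    Function.update E.A n (E.A n + E.A 0 * al),
    Function.update E.Θ (n - 2) (E.Θ (n - 2) + τ),
    Function.update E.Φ (n - 2) (E.Φ (n - 2) + π)⟩ with hE'
  have hag : Agree n E E' := by
    refine ⟨?_, ?_, ?_, ?_, ?_⟩ <;> intro k hk
    · exact (Function.update_of_ne (by omega) _ _).symm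
    · exact (Function.update_of_ne (by omega) _ _).symm
    · exact (Function.update_of_ne (by omega) _ _).symm
    · exact (Function.update_of_ne (by omega) _ _).symm
    · exact (Function.update_of_ne (by omega) _ _).symm
  have hA' : ∀ x, 0 < (E'.A 0).1 x := by rw [← hag.A 0 (by omega)]; exact hA
  have hf' : ∀ x, 0 < (E'.f 0).1 x := by rw [← hag.f 0 (by omega)]; exact hf
  have df : E'.f n - E.f n = δf := by simp [hE']
  have db : E'.b n - E.b n = δb := by simp [hE']
  have dA : E'.A n - E.A n = E.A 0 * al := by simp [hE']
  have dΘ : E'.Θ (n - 2) - E.Θ (n - 2) = τ := by simp [hE']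
  have dΦ : E'.Φ (n - 2) - E.Φ (n - 2) = π := by simp [hE']
  obtain ⟨L, hs⟩ := levelChange hR (by exact_mod_cast hn) hag hA hA' hf hf'
  have hds := pairVal_ds hR E E' hA n
  have hdq : (pairVal hR E E' hA n).dq = 0 := rfl
  have hvw : pairVal hR E E' hA n = baseVal R hR (E.A 0) hA ((1 / 2 : ℝ) • (E.Θ 0 + E'.Θ 0))
      ((1 / 2 : ℝ) • (E.Φ 0 + E'.Φ 0)) (E.A 0 * al) 0 0 τ π := by
    rw [pairVal, dA, dΘ, dΦ]
  have vτ : (pairVal hR E E' hA n).τ = τ := by rw [hvw]; rfl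
  have vπ : (pairVal hR E E' hA n).π = π := by rw [hvw]; rfl
  have vX : (pairVal hR E E' hA n).X = u.X := by rw [hvw]; rfl
  have vZ : (pairVal hR E E' hA n).Z = u.Z := by rw [hvw]; rfl
  have vell : (pairVal hR E E' hA n).ell = u'.ell := by rw [hvw]; rfl
  have vadv : (pairVal hR E E' hA n).adv = u'.adv := by rw [hvw]; rfl
  have vPP : (pairVal hR E E' hA n).PP n = u'.PP n := by rw [hvw]; rfl
  have vQQ : (pairVal hR E E' hA n).QQ n = u'.QQ n := by rw [hvw]; rfl
  have val : (pairVal hR E E' hA n).al = al := by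
    have := pairVal_al hR E E' hA n
    rw [dA] at this
    have hI := mul_angInv (E.A 0) fun x => (hA x).ne'
    linear_combination (-(angInv (E.A 0) fun x => (hA x).ne')) * this
      + ((pairVal hR E E' hA n).al - al) * (-hI)
  have vc : (pairVal hR E E' hA n).c n = w.c n := rfl
  have va₁₁ : (pairVal hR E E' hA n).a₁₁ n = w.a₁₁ n := rfl
  have va₁₂ : (pairVal hR E E' hA n).a₁₂ n = w.a₁₂ n := rfl
  have va₂₁ : (pairVal hR E E' hA n).a₂₁ = w.a₂₁ := rfl
  have va₂₂ : (pairVal hR E E' hA n).a₂₂ = w.a₂₂ := rfl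
  have vN : (pairVal hR E E' hA n).N = w.N := rfl
  have vn : (pairVal hR E E' hA n).n = w.n := rfl
  have vs : (pairVal hR E E' hA n).s = w.s := rfl
  have vq : (pairVal hR E E' hA n).q = w.q := rfl
  clear_value w u u'
  generalize pairVal hR E E' hA n = v at *
  have y22 : -(((n : ℝ) + 1) • v.QQ n) - v.PP n - (2 : ℝ) • v.al - v.ell = ρ := by
    rw [GVal.eq_two_two hds hdq, vτ, vπ, vc, va₁₁, va₁₂, vs]
    exact s1
  have y12 : v.W = -((1 / n : ℝ) • (w.N * r₁₂)) := by
    rw [GVal.eq_W, vτ, vπ, va₂₁, va₂₂]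
    exact s2
  have y11 : -(((n : ℝ) + 1) • v.PP n) - v.QQ n - (2 : ℝ) • v.al - v.ell
      = -(w.N * w.i * r₁₁) := by
    rw [GVal.eq_one_one (by omega) hds hdq y22, vX, vZ, val]
  refine ⟨E', hag, SolUpTo.succ (hs hE) ?_ ?_ ?_ ?_ ?_, fun φ => ?_⟩
  · rw [L.r11, y11, vn, vs]
    linear_combination (-(w.s * w.i * r₁₁)) * w.hn - r₁₁ * w.hi
  · rw [L.r12, y12, vn]
    have : (n : ℝ) • (w.n * -((1 / n : ℝ) • (w.N * r₁₂))) = -(w.N * w.n * r₁₂) := by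
      apply ang_ext; intro x
      simp
      field_simp
    rw [this, w.hn, one_mul, add_neg_cancel]
  · rw [L.r22, y22, vn, vq]
    linear_combination (-(w.q * w.j * r₂₂)) * w.hn - r₂₂ * w.hj
  · rw [L.re, vn, vadv, vPP, vQQ, val, vell, ← hQ, df]
    have : (n : ℝ) • ((n : ℝ) • δf - u'.adv (E.f 0)) + (2 : ℝ) • (E.f 0 * Q) = -(w.N * F * e₁) := by
      rw [hδf]
      apply ang_ext; intro x
      simp
      field_simp
      ring
    rw [this]
    linear_combination (-(E.f 0 * F * e₁)) * w.hn - e₁ * hF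
  · rw [L.im, vn, vadv, vPP, vQQ, val, vell, ← hQ, df, db]
    have : (n : ℝ) • ((4 + n : ℝ) • δb - u'.adv (E.b 0)) - (4 : ℝ) • u'.adv (E.b 0)
        + (4 : ℝ) • (E.b 0 * Q) = F * ((8 : ℝ) • (E.b 0 * ((n : ℝ) • δf - u'.adv (E.f 0)))
          - w.N * e₂) := by
      rw [hδb]
      apply ang_ext; intro x
      simp
      field_simp
      ring
    rw [this]
    linear_combination (-e₂) * w.hn + w.n * ((8 : ℝ) • (E.b 0 * ((n : ℝ) • δf - u'.adv (E.f 0)))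
          - w.N * e₂) * hF
  · have hext : ∀ (a b c : Ang) (r : ℝ), b - a = c → ext c.1 (θ₀, φ) = r - ext a.1 (θ₀, φ) →
        ext b.1 (θ₀, φ) = r := by
      rintro a b c r rfl h
      have hm : ((θ₀, φ) : ℝ × ℝ) ∈ Angles := ⟨hθ₀, trivial⟩
      rw [ext_of_mem _ hm] at h ⊢
      rw [ext_of_mem _ hm] at h
      simp at h
      exact h
    exact ⟨hext _ _ _ _ dΘ (hdata φ).1, hext _ _ _ _ dΦ (hdata φ).2⟩

end Expansion

end KillingHorizon

end

noncomputable section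

namespace KillingHorizon

open scoped Shortcuts

namespace Expansion

variable {R : ℝ}

/-! ### Formal solutions -/

lemma Agree.mono {n m : ℕ} {E E' : Expansion} (h : Agree n E E') (hm : m ≤ n) : Agree m E E' :=
  ⟨fun k hk => h.f k (by omega), fun k hk => h.b k (by omega), fun k hk => h.A k (by omega),
    fun k hk => h.Θ k (by omega), fun k hk => h.Φ k (by omega)⟩

lemma Agree.trans {n : ℕ} {E E' E'' : Expansion} (h : Agree n E E') (h' : Agree n E' E'') :
    Agree n E E'' :=
  ⟨fun k hk => (h.f k hk).trans (h'.f k hk), fun k hk => (h.b k hk).trans (h'.b k hk),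
    fun k hk => (h.A k hk).trans (h'.A k hk), fun k hk => (h.Θ k hk).trans (h'.Θ k hk),
    fun k hk => (h.Φ k hk).trans (h'.Φ k hk)⟩

lemma IsSolution.resid {E : Expansion} (h : E.IsSolution R) (a b : Fin 3) : E.resid R a b = 0 :=
  (ricciEquations_iff E).1 h.ricci_eq a b

lemma IsSolution.solUpTo {E : Expansion} (h : E.IsSolution R) (n : ℕ) : SolUpTo R n E := by
  obtain ⟨h1, h2⟩ := (ernstEquation_iff E).1 h.ernst_eq
  refine ⟨?_, ?_, ?_, ?_, ?_⟩
  · rw [h.resid]; exact Ord.zero _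
  · rw [h.resid]; exact Ord.zero _
  · rw [h.resid]; exact Ord.zero _
  · rw [h1]; exact Ord.zero _
  · rw [h2]; exact Ord.zero _

/-- The evolution equations hold to all orders by assumption. Proportionality of 𝒜_0 and f_0 is the
lowest-order constraint, from which the conservation law yields the remaining equations. -/
lemma isSolution_of_solUpTo (hR : 0 < R) {E : Expansion} (hA : ∀ x, 0 < (E.A 0).1 x)
    (hf : ∀ x, 0 < (E.f 0).1 x) {κ : ℝ} (hκ : E.A 0 = κ • E.f 0)
    (h : ∀ n : ℕ, SolUpTo R (n + 2) E) : E.IsSolution R := by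
  have z : ∀ {u : Ser}, (∀ n : ℕ, Ord n u) → u = 0 := fun h =>
    Ord.eq_zero fun m => (h m.toNat).mono (by omega)
  have hre := z fun n => (h n).re.mono (k := n) (by push_cast; omega)
  have him := z fun n => (h n).im.mono (k := n) (by push_cast; omega)
  have h11 := z fun n => (h n).r11.mono (k := n) (by push_cast; omega)
  have h12 := z fun n => (h n).r12.mono (k := n) (by push_cast; omega)
  have h22 := z fun n => (h n).r22.mono (k := n) (by push_cast; omega)
  obtain ⟨h01, h02⟩ := (resid_zero_ang_iff hR hA hf).2 ⟨κ, hκ⟩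
  exact ⟨hf, hA, (ernstEquation_iff E).2 ⟨hre, him⟩, (ricciEquations_iff E).2
    (resid_eq_zero hR hA hf hre him h11 h12 h22 (resid_zero_zero hR hA hf) h01 h02)⟩

lemma IsSolution.exists_kappa (hR : 0 < R) {E : Expansion} (h : E.IsSolution R) :
    ∃ κ : ℝ, 0 < κ ∧ E.A 0 = κ • E.f 0 := by
  obtain ⟨κ, hκ⟩ := (resid_zero_ang_iff hR h.A_pos h.f_pos).1
    ⟨by rw [h.resid]; exact Ord.zero _, by rw [h.resid]; exact Ord.zero _⟩
  refine ⟨κ, ?_, hκ⟩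
  have x₀ : Angles := ⟨(Real.pi / 2, 0), ⟨by constructor <;> linarith [Real.pi_pos], trivial⟩⟩
  have h1 := h.A_pos x₀
  have h2 := h.f_pos x₀
  rw [hκ] at h1
  exact (pos_iff_pos_of_mul_pos (show 0 < κ * (E.f 0).1 x₀ from h1)).2 h2

/-- Existence of formal solutions. -/
lemma exists_solution (hR : 0 < R) (f₀ b₀ : Ang) (hf : ∀ x, 0 < f₀.1 x) {κ : ℝ} (hκ : 0 < κ)
    {θ₀ : ℝ} (hθ₀ : θ₀ ∈ Set.Ioo 0 Real.pi) {p q : ℕ → ℝ → ℝ}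
    (hp : ∀ n, ContDiff ℝ ∞ (p n) ∧ Function.Periodic (p n) (2 * Real.pi))
    (hq : ∀ n, ContDiff ℝ ∞ (q n) ∧ Function.Periodic (q n) (2 * Real.pi)) :
    ∃ E : Expansion, E.IsSolution R ∧ E.f 0 = f₀ ∧ E.b 0 = b₀ ∧ E.A 0 = κ • f₀ ∧
      ∀ n φ, ext (E.Θ n).1 (θ₀, φ) = p n φ ∧ ext (E.Φ n).1 (θ₀, φ) = q n φ := by
  -- Only the indices 0 and 1 matter, the latter being forced by the first-order equations; the
  -- other values are placeholders to be overwritten.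
  set B : Expansion := ⟨fun k => if k = 0 then f₀ else -(1 / R) • f₀,
    fun k => if k = 0 then b₀ else -(2 / R) • b₀,
    fun k => if k = 0 then κ • f₀ else -(3 / (2 * R)) • κ • f₀, fun _ => 0, fun _ => 0⟩ with hB
  have hBf : ∀ x, 0 < (B.f 0).1 x := hf
  have hBA : ∀ x, 0 < (B.A 0).1 x := fun x => mul_pos hκ (hf x)
  have hB2 : SolUpTo R 2 B := (solUpTo_two_iff hR hBA hBf).2 ⟨rfl, rfl, rfl⟩
  have step : ∀ (n : ℕ) (E : {E : Expansion // Agree 2 B E ∧ SolUpTo R (n + 2) E}),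
      ∃ E' : {E : Expansion // Agree 2 B E ∧ SolUpTo R (n + 1 + 2) E}, Agree (n + 2) E.1 E'.1 ∧
        ∀ φ, ext (E'.1.Θ n).1 (θ₀, φ) = p n φ ∧ ext (E'.1.Φ n).1 (θ₀, φ) = q n φ := by
    rintro n ⟨E, h1, h2⟩
    have hA : ∀ x, 0 < (E.A 0).1 x := by rw [← h1.A 0 (by omega)]; exact hBA
    have hf : ∀ x, 0 < (E.f 0).1 x := by rw [← h1.f 0 (by omega)]; exact hBf
    obtain ⟨E', h3, h4, h5⟩ := exists_succ hR (by omega) hA hf h2 hθ₀ (hp n) (hq n)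
    exact ⟨⟨E', h1.trans (h3.mono (by omega)), h4⟩, h3, h5⟩
  choose next hnext hdata using step
  set S : ∀ n : ℕ, {E : Expansion // Agree 2 B E ∧ SolUpTo R (n + 2) E} := fun n =>
    Nat.rec ⟨B, ⟨fun _ _ => rfl, fun _ _ => rfl, fun _ _ => rfl, fun _ _ => rfl, fun _ _ => rfl⟩,
      hB2⟩ next n with hS
  have hSs : ∀ n, S (n + 1) = next n (S n) := fun n => rfl
  have hmono : ∀ n m, Agree (n + 2) (S n).1 (S (n + m)).1 := by
    intro n m
    induction m with
    | zero => exact ⟨fun _ _ => rfl, fun _ _ => rfl, fun _ _ => rfl, fun _ _ => rfl, fun _ _ => rfl⟩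
    | succ m ih =>
      refine ih.trans (Agree.mono ?_ (show n + 2 ≤ n + m + 2 by omega))
      rw [← add_assoc, hSs]
      exact hnext _ _
  -- Stage n has final values of f, b, 𝒜 at indices below n + 2, but of the shift only below n. The
  -- shift coefficient of index k is therefore read off at stage k + 1.
  set L : Expansion := ⟨fun k => (S k).1.f k, fun k => (S k).1.b k, fun k => (S k).1.A k,
    fun k => (S (k + 1)).1.Θ k, fun k => (S (k + 1)).1.Φ k⟩ with hL
  have cmp : ∀ (φ : Expansion → ℕ → Ang) (r : ℕ),
      (∀ n E E', Agree n E E' → ∀ k, k + r < n → φ E k = φ E' k) → ∀ n k, k + r < n + 2 →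
      ∀ l, k + r < l + 2 → φ (S n).1 k = φ (S l).1 k := by
    intro φ r h n k hk l hl
    have e1 := h _ _ _ (hmono n l) k hk
    have e2 := h _ _ _ (hmono l n) k hl
    rw [e1, e2]
    exact congrArg (fun m => φ (S m).1 k) (add_comm n l)
  have hSL : ∀ n, Agree (n + 2) (S n).1 L := by
    intro n
    refine ⟨fun k hk => ?_, fun k hk => ?_, fun k hk => ?_, fun k hk => ?_, fun k hk => ?_⟩
    · exact cmp Expansion.f 0 (fun n E E' h => h.f) n k hk k (by omega)
    · exact cmp Expansion.b 0 (fun n E E' h => h.b) n k hk k (by omega)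
    · exact cmp Expansion.A 0 (fun n E E' h => h.A) n k hk k (by omega)
    · exact cmp Expansion.Θ 2 (fun n E E' h => h.Θ) n k hk (k + 1) (by omega)
    · exact cmp Expansion.Φ 2 (fun n E E' h => h.Φ) n k hk (k + 1) (by omega)
  have hLA : ∀ x, 0 < (L.A 0).1 x := hBA
  have hLf : ∀ x, 0 < (L.f 0).1 x := hBf
  refine ⟨L, isSolution_of_solUpTo hR hLA hLf (κ := κ) rfl fun n => ?_, rfl, rfl, rfl, fun n φ => ?_⟩
  · have hA : ∀ x, 0 < ((S n).1.A 0).1 x := by rw [← (S n).2.1.A 0 (by omega)]; exact hBA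
    have hf : ∀ x, 0 < ((S n).1.f 0).1 x := by rw [← (S n).2.1.f 0 (by omega)]; exact hBf
    exact (levelChange hR (by push_cast; omega) (hSL n) hA hLA hf hLf).2 (S n).2.2
  · exact hdata n (S n) φ

/-- Uniqueness of formal solutions. -/
lemma agree_of_isSolution (hR : 0 < R) {E E' : Expansion} (hE : E.IsSolution R)
    (hE' : E'.IsSolution R) (hf : E.f 0 = E'.f 0) (hb : E.b 0 = E'.b 0) (hA : E.A 0 = E'.A 0)
    {θ₀ : ℝ} (hθ₀ : θ₀ ∈ Set.Ioo 0 Real.pi) (N : ℕ)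
    (h : ∀ n < N, ∀ φ, ext (E.Θ n).1 (θ₀, φ) = ext (E'.Θ n).1 (θ₀, φ) ∧
          ext (E.Φ n).1 (θ₀, φ) = ext (E'.Φ n).1 (θ₀, φ)) : Agree (N + 2) E E' := by
  induction N with
  | zero =>
    obtain ⟨a1, a2, a3⟩ := (solUpTo_two_iff hR hE.A_pos hE.f_pos).1 (hE.solUpTo 2)
    obtain ⟨b1, b2, b3⟩ := (solUpTo_two_iff hR hE'.A_pos hE'.f_pos).1 (hE'.solUpTo 2)
    refine ⟨fun k hk => ?_, fun k hk => ?_, fun k hk => ?_, fun k hk => ?_, fun k hk => ?_⟩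
    · interval_cases k
      · exact hf
      · rw [a2, b2, hf]
    · interval_cases k
      · exact hb
      · rw [a3, b3, hb]
    · interval_cases k
      · exact hA
      · rw [a1, b1, hA]
    · omega
    · omega
  | succ N ih =>
    have := ih fun n hn => h n (by omega)
    exact agree_succ hR (by omega) this hE.A_pos hE'.A_pos hE.f_pos hE'.f_pos
      (hE.solUpTo _) (hE'.solUpTo _) hθ₀ (fun φ => (h N (by omega) φ).1)
      (fun φ => (h N (by omega) φ).2)

end Expansion

end KillingHorizon

end

/-! ### The proposition. -/

open KillingHorizon in
theorem proposition3p1 (R : ℝ) (hR : 0 < R) :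
    -- leading coefficients of an arbitrary formal solution
    (∀ E : Expansion, E.IsSolution R →
      (∃ κ : ℝ, E.A 0 = κ • E.f 0) ∧
      (∀ x, (E.A 1).1 x / (E.A 0).1 x = -(3 / (2 * R))) ∧
      E.f 1 = -(1 / R) • E.f 0 ∧
      E.b 1 = -(2 / R) • E.b 0 ∧
      -- regularity of the axis
      ∀ a : ℝ → ℝ, E.RegularAxis R a →
        (∀ φ, HasDerivAt a 0 φ) ∧ E.A 0 = (2 / (R * a 0)) • E.f 0) ∧
    -- `f₀` and `b₀` are free, up to the condition on the axis; the remaining freedom consists of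
    -- the integration functions in the shift, given by its values on a circle `θ = θ₀`
    (∀ (f₀ b₀ : Ang) (a : ℝ → ℝ), (∀ x, 0 < f₀.1 x) → HasAxisValues f₀ a → (∀ φ, 0 < a φ) →
      (∀ φ, HasDerivAt a 0 φ) →
      ∀ θ₀ ∈ Set.Ioo 0 Real.pi, ∀ p q : ℕ → ℝ → ℝ,
        (∀ n, ContDiff ℝ ∞ (p n) ∧ Function.Periodic (p n) (2 * Real.pi)) →
        (∀ n, ContDiff ℝ ∞ (q n) ∧ Function.Periodic (q n) (2 * Real.pi)) →
        ∃ E : Expansion, E.IsSolution R ∧ E.RegularAxis R a ∧ E.f 0 = f₀ ∧ E.b 0 = b₀ ∧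
          ∀ n φ, ext (E.Θ n).1 (θ₀, φ) = p n φ ∧ ext (E.Φ n).1 (θ₀, φ) = q n φ) ∧
    -- all other coefficients are determined, order by order
    (∀ (E E' : Expansion) (a a' : ℝ → ℝ), E.IsSolution R → E'.IsSolution R →
      E.RegularAxis R a → E'.RegularAxis R a' → E.f 0 = E'.f 0 → E.b 0 = E'.b 0 →
      ∀ θ₀ ∈ Set.Ioo 0 Real.pi, ∀ N : ℕ,
        (∀ n < N, ∀ φ, ext (E.Θ n).1 (θ₀, φ) = ext (E'.Θ n).1 (θ₀, φ) ∧
          ext (E.Φ n).1 (θ₀, φ) = ext (E'.Φ n).1 (θ₀, φ)) →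
        (∀ n < N, E.Θ n = E'.Θ n ∧ E.Φ n = E'.Φ n) ∧
        ∀ n < N + 2, E.f n = E'.f n ∧ E.b n = E'.b n ∧ E.A n = E'.A n) := by
  refine ⟨fun E hE => ?_, ?_, ?_⟩
  · obtain ⟨κ, hκ, hκA⟩ := hE.exists_kappa hR
    obtain ⟨h1, h2, h3⟩ := (Expansion.solUpTo_two_iff hR hE.A_pos hE.f_pos).1 (hE.solUpTo 2)
    refine ⟨⟨κ, hκA⟩, fun x => ?_, h2, h3, fun a ha => ?_⟩
    · rw [h1]
      exact mul_div_cancel_right₀ _ (hE.A_pos x).ne'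
    · obtain ⟨hc, hk⟩ := ha.const hR hE.f_pos hκ hκA
      refine ⟨fun φ => ?_, by rw [← hk]; exact hκA⟩
      rw [show a = fun _ => a 0 from funext hc]
      exact hasDerivAt_const _ _
  · intro f₀ b₀ a hf ha hpos hd θ₀ hθ₀ p q hp hq
    have h0 := hpos 0
    obtain ⟨E, h1, h2, h3, h4, h5⟩ := Expansion.exists_solution hR f₀ b₀ hf
      (κ := 2 / (R * a 0)) (by positivity) hθ₀ hp hq
    refine ⟨E, h1, ?_, h2, h3, h5⟩
    subst h2
    exact Expansion.RegularAxis.of_const hR hf ha hpos hd h4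
  · intro E E' a a' hE hE' ha ha' hf hb θ₀ hθ₀ N h
    obtain ⟨κ, hκ, hκA⟩ := hE.exists_kappa hR
    obtain ⟨κ', hκ', hκA'⟩ := hE'.exists_kappa hR
    obtain ⟨hc, hk⟩ := ha.const hR hE.f_pos hκ hκA
    obtain ⟨hc', hk'⟩ := ha'.const hR hE'.f_pos hκ' hκA'
    -- The axis value is a limit of the common function f_0 at a point of the closure, so it is the
    -- same for both solutions; hence so are κ and 𝒜_0.
    have haa : a 0 = a' 0 := by
      have h1 := ha.axis 0
      rw [hf] at h1
      have : (nhdsWithin ((0 : ℝ), (0 : ℝ)) Angles).NeBot := by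
        rw [← mem_closure_iff_nhdsWithin_neBot, Angles, closure_prod_eq,
          closure_Ioo Real.pi_pos.ne, closure_univ]
        exact ⟨⟨le_rfl, Real.pi_pos.le⟩, trivial⟩
      exact tendsto_nhds_unique h1 (ha'.axis 0)
    have hA : E.A 0 = E'.A 0 := by rw [hκA, hκA', hk, hk', haa, hf]
    have := Expansion.agree_of_isSolution hR hE hE' hf hb hA hθ₀ N h
    exact ⟨fun n hn => ⟨this.Θ n (by omega), this.Φ n (by omega)⟩,
      fun n hn => ⟨this.f n hn, this.b n hn, this.A n hn⟩⟩
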